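/- Formulas are those of second-order arithmetic; a $\Sigma^0_k$ formula has the form $\exists x_1\forall x_2\cdots\theta$ with $k$ alternating number quantifiers and $\theta$ with bounded quantifiers only, and a two-sorted structure $(M,\mathcal S)$, with $\mathcal S\subseteq\mathcal P(M)$, may supply number parameters from $M$ and set parameters from $\mathcal S$. $P^-$ is the theory of non-negative parts of discretely ordered commutative rings; $\mathrm I\Sigma^0_k$ is induction for $\Sigma^0_k$ formulas with parameters; $\mathrm B\Sigma^0_k$ consists of $\mathrm I\Sigma^0_0$ and the bounding scheme $(\forall x<x_0)(\exists y)\varphi(x,y)\to(\exists y_0)(\forall x<x_0)(\exists y<y_0)\varphi(x,y)$ for $\Sigma^0_k$ formulas $\varphi$ with parameters. Finite binary strings are coded by positive elements of $M$ (prepend $1$ and read in base two). A binary tree is a set of strings closed under initial segments, a path is a binary tree that is totally ordered by end-extension, and infinite means unbounded in $M$. A set is $\Delta^A_1$ if it and its complement are $\Sigma^0_1$-definable in $(M,\{A\})$ with parameters, and $A\oplus P=\{2a:a\in A\}\cup\{2p+1:p\in P\}$. Let $n\ge 1$. **(A)** Let $(M,\{A\})\models P^-+\mathrm I\Sigma^0_1$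 (a theory that proves the totality axiom $\exp$ for $x\mapsto 2^x$), and let $T$ be an infinite $\Delta^A_1$ binary tree. 1. If $(M,\{A\})\models\mathrm I\Sigma^0_n$, there is an infinite path $P\subseteq T$ such that $(M,\{A\oplus P\})\models\mathrm I\Sigma^0_n$. 2. If $(M,\{A\})\models\mathrm B\Sigma^0_{n+1}$, there is an infinite path $P\subseteq T$ such that $(M,\{A\oplus P\})\models\mathrm B\Sigma^0_{n+1}$ (and hence also $\mathrm B\Sigma^0_n$). **(B)** (Harrington, Hájek.) $\mathsf{WKL}$ (every infinite binary tree in $\mathcal S$ has an infinite path in $\mathcal S$) is $\Pi^1_1$-conservative over $\mathsf{RCA}_0+\mathrm I\Sigma^0_n$ and over $\mathsf{RCA}_0+\mathrm B\Sigma^0_{n+1}$, where $\mathsf{RCA}_0=P^-+\Delta^0_1\text{-}\mathrm{CA}+\mathrm I\Sigma^0_1$: every sentence $\forall X_1\cdots\forall X_m\,\theta$, $\theta$ arithmetical, that is true in all models $(M,\mathcal S)$ of the theory together with $\mathsf{WKL}$ is true in all models of the theory (equivalently, by completeness, provable from it). -/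

import Mathlib

universe u

namespace SOArith

/-- Models of `P⁻`: the non-negative parts of discretely ordered commutative rings.
`CanonicallyOrderedAdd` says that `x ≤ y` holds exactly if `y = x + z` for some `z`. -/
class PMinus (M : Type u) extends CommSemiring M, LinearOrder M, IsStrictOrderedRing M,
    CanonicallyOrderedAdd M where
  /-- There is no element strictly between `0` and `1`. -/
  one_le_of_pos : ∀ x : M, 0 < x → 1 ≤ x

/-! ### Arithmetical formulas of second-order arithmetic -/

/-- Number terms with number variables `0, …, n - 1`. -/
inductive Tm (n : ℕ) : Type
  | var (i : Fin n) : Tm n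
  | zero : Tm n
  | one : Tm n
  | add (s t : Tm n) : Tm n
  | mul (s t : Tm n) : Tm n

/-- Arithmetical formulas (no set quantifiers) with set variables `0, …, m - 1` and number
variables `0, …, n - 1`. A quantifier binds the number variable `0` of its scope and shifts
the others; the bound `t` of a bounded quantifier does not contain the bound variable. -/
inductive Fml (m : ℕ) : ℕ → Type
  | eq {n : ℕ} (s t : Tm n) : Fml m n
  | lt {n : ℕ} (s t : Tm n) : Fml m n
  | mem {n : ℕ} (t : Tm n) (i : Fin m) : Fml m n
  | neg {n : ℕ} (φ : Fml m n) : Fml m n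
  | and {n : ℕ} (φ ψ : Fml m n) : Fml m n
  | or {n : ℕ} (φ ψ : Fml m n) : Fml m n
  | ball {n : ℕ} (t : Tm n) (φ : Fml m (n + 1)) : Fml m n
  | bex {n : ℕ} (t : Tm n) (φ : Fml m (n + 1)) : Fml m n
  | all {n : ℕ} (φ : Fml m (n + 1)) : Fml m n
  | ex {n : ℕ} (φ : Fml m (n + 1)) : Fml m n

/-- The value of a term under an assignment. -/
def Tm.val {M : Type u} [PMinus M] {n : ℕ} (e : Fin n → M) : Tm n → M
  | .var i => e i
  | .zero => 0
  | .one => 1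
  | .add s t => s.val e + t.val e
  | .mul s t => s.val e * t.val e

/-- Satisfaction of a formula under an assignment `X` of the set variables and an assignment
`e` of the number variables. -/
def Fml.Holds {M : Type u} [PMinus M] {m : ℕ} (X : Fin m → Set M) :
    {n : ℕ} → Fml m n → (Fin n → M) → Prop
  | _, .eq s t, e => s.val e = t.val e
  | _, .lt s t, e => s.val e < t.val e
  | _, .mem t i, e => t.val e ∈ X i
  | _, .neg φ, e => ¬ φ.Holds X e
  | _, .and φ ψ, e => φ.Holds X e ∧ ψ.Holds X e
  | _, .or φ ψ, e => φ.Holds X e ∨ ψ.Holds X e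
  | _, .ball t φ, e => ∀ a : M, a < t.val e → φ.Holds X (Matrix.vecCons a e)
  | _, .bex t φ, e => ∃ a : M, a < t.val e ∧ φ.Holds X (Matrix.vecCons a e)
  | _, .all φ, e => ∀ a : M, φ.Holds X (Matrix.vecCons a e)
  | _, .ex φ, e => ∃ a : M, φ.Holds X (Matrix.vecCons a e)

/-- `Σ⁰₀` formulas: all quantifiers are bounded. -/
def Fml.IsDelta0 {m : ℕ} : {n : ℕ} → Fml m n → Prop
  | _, .eq _ _ => True
  | _, .lt _ _ => True
  | _, .mem _ _ => True
  | _, .neg φ => φ.IsDelta0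
  | _, .and φ ψ => φ.IsDelta0 ∧ ψ.IsDelta0
  | _, .or φ ψ => φ.IsDelta0 ∧ ψ.IsDelta0
  | _, .ball _ φ => φ.IsDelta0
  | _, .bex _ φ => φ.IsDelta0
  | _, .all _ => False
  | _, .ex _ => False

mutual

/-- `Σ⁰ₖ` formulas `∃ x₁ ∀ x₂ ∃ x₃ … θ`, with `k` alternating quantifiers and `θ` in `Σ⁰₀`. -/
inductive Fml.IsSigma {m : ℕ} : {n : ℕ} → ℕ → Fml m n → Prop
  | zero {n : ℕ} {φ : Fml m n} : φ.IsDelta0 → Fml.IsSigma 0 φ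
  | succ {n k : ℕ} {φ : Fml m (n + 1)} : Fml.IsPi k φ → Fml.IsSigma (k + 1) (Fml.ex φ)

/-- `Π⁰ₖ` formulas `∀ x₁ ∃ x₂ ∀ x₃ … θ`, with `k` alternating quantifiers and `θ` in `Σ⁰₀`. -/
inductive Fml.IsPi {m : ℕ} : {n : ℕ} → ℕ → Fml m n → Prop
  | zero {n : ℕ} {φ : Fml m n} : φ.IsDelta0 → Fml.IsPi 0 φ
  | succ {n k : ℕ} {φ : Fml m (n + 1)} : Fml.IsSigma k φ → Fml.IsPi (k + 1) (Fml.all φ)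

end

/-! ### Two-sorted models `(M, S)` with `S ⊆ 𝒫(M)`, and their axioms -/

section Axioms

variable {M : Type u} [PMinus M]

/-- `B` is `Σ⁰ₖ` in `(M, S)`: definable by a `Σ⁰ₖ` formula with number parameters from `M` and
set parameters from `S`. For `S = {A}` these are the `Σₖ` sets relative to `A`. -/
def IsSigmaSet (S : Set (Set M)) (k : ℕ) (B : Set M) : Prop :=
  ∃ (m n : ℕ) (φ : Fml m (n + 1)) (X : Fin m → Set M) (e : Fin n → M),
    φ.IsSigma k ∧ (∀ i, X i ∈ S) ∧ ∀ a : M, a ∈ B ↔ φ.Holds X (Matrix.vecCons a e)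

/-- `B` is `Δ⁰ₖ` in `(M, S)`: both `B` and its complement are `Σ⁰ₖ`. -/
def IsDeltaSet (S : Set (Set M)) (k : ℕ) (B : Set M) : Prop :=
  IsSigmaSet S k B ∧ IsSigmaSet S k Bᶜ

/-- `IΣ⁰ₖ` in `(M, S)`: induction for all `Σ⁰ₖ` formulas with parameters. -/
def ISigma (k : ℕ) (S : Set (Set M)) : Prop :=
  ∀ B : Set M, IsSigmaSet S k B → 0 ∈ B → (∀ a, a ∈ B → a + 1 ∈ B) → ∀ a, a ∈ B

/-- `BΣ⁰ₖ` in `(M, S)`: bounding for all `Σ⁰ₖ` formulas with parameters, together with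
`IΣ⁰₀`, which by convention is part of this axiom system. -/
def BSigma (k : ℕ) (S : Set (Set M)) : Prop :=
  ISigma 0 S ∧
  ∀ (m n : ℕ) (φ : Fml m (n + 2)) (X : Fin m → Set M) (e : Fin n → M),
    φ.IsSigma k → (∀ i, X i ∈ S) → ∀ x₀ : M,
      (∀ x < x₀, ∃ y : M, φ.Holds X (Matrix.vecCons x (Matrix.vecCons y e))) →
      ∃ y₀ : M, ∀ x < x₀, ∃ y < y₀, φ.Holds X (Matrix.vecCons x (Matrix.vecCons y e))

/-- `Δ⁰₁` comprehension. -/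
def Delta1CA (S : Set (Set M)) : Prop :=
  ∀ B : Set M, IsDeltaSet S 1 B → B ∈ S

/-- `RCA₀`: `P⁻`, `Δ⁰₁` comprehension and `IΣ⁰₁`. -/
def RCA0 (S : Set (Set M)) : Prop :=
  Delta1CA S ∧ ISigma 1 S

/-- The join `A ⊕ B`. -/
def join (A B : Set M) : Set M :=
  {x | (∃ a ∈ A, x = 2 * a) ∨ ∃ b ∈ B, x = 2 * b + 1}

/-! ### Binary strings, trees and paths

A binary string is coded by the number whose base-two expansion is `1` followed by the string.
So the codes are the positive numbers, `1` codes the empty string, and the string `σ` extended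
by the bits of `r`, where `r < 2 ^ l`, to a string longer by `l` has the code `σ * 2 ^ l + r`. -/

/-- `p` is a power of two (with a possibly nonstandard exponent): every divisor of `p` is `1`
or even. -/
def IsPow2 (p : M) : Prop :=
  0 < p ∧ ∀ d : M, d ∣ p → d = 1 ∨ 2 ∣ d

/-- `σ` and `τ` code strings, and the string `τ` (weakly) end-extends the string `σ`. -/
def IsPrefix (σ τ : M) : Prop :=
  0 < σ ∧ ∃ p r : M, IsPow2 p ∧ r < p ∧ τ = σ * p + r

/-- Binary trees: sets of strings closed under initial segments. -/
def IsTree (T : Set M) : Prop :=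
  (∀ τ ∈ T, 0 < τ) ∧ ∀ τ ∈ T, ∀ σ, IsPrefix σ τ → σ ∈ T

/-- Paths: binary trees totally ordered by end-extension. -/
def IsPath (P : Set M) : Prop :=
  IsTree P ∧ ∀ σ ∈ P, ∀ τ ∈ P, IsPrefix σ τ ∨ IsPrefix τ σ

/-- Infinite, in the sense of unbounded in `M`. -/
def IsInfinite (B : Set M) : Prop :=
  ¬ ∃ b : M, ∀ a ∈ B, a < b

/-- `P` is an infinite path through `T`. -/
def IsInfinitePathThrough (T P : Set M) : Prop :=
  P ⊆ T ∧ IsPath P ∧ IsInfinite P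

/-- Weak Kőnig's Lemma in `(M, S)`. -/
def WKL (S : Set (Set M)) : Prop :=
  ∀ T ∈ S, IsTree T → IsInfinite T → ∃ P ∈ S, IsInfinitePathThrough T P

/-- Truth in `(M, S)` of the `Π¹₁` sentence `∀ X₀ … ∀ Xₘ₋₁ θ`, with `θ` arithmetical and without
other free variables. -/
def Pi11True (S : Set (Set M)) {m : ℕ} (θ : Fml m 0) : Prop :=
  ∀ X : Fin m → Set M, (∀ i, X i ∈ S) → θ.Holds X Matrix.vecEmpty

end Axioms

/-- `WKL` is `Π¹₁`-conservative over the axiom system `Γ` (which includes `P⁻`): every `Π¹₁`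
sentence that follows from `Γ + WKL` follows from `Γ`. Here `σ` follows from an axiom system if
it is true in all its two-sorted models `(M, S)`. -/
def WKLPi11ConservativeOver (Γ : ∀ (M : Type u) [PMinus M], Set (Set M) → Prop) : Prop :=
  ∀ (m : ℕ) (θ : Fml m 0),
    (∀ (M : Type u) [PMinus M] (S : Set (Set M)), Γ M S → WKL S → Pi11True S θ) →
    ∀ (M : Type u) [PMinus M] (S : Set (Set M)), Γ M S → Pi11True S θ

end SOArith

-- The path comes from a low basis theorem. Consider events `E j` about a growing string `τ`,
-- bounded in `A` and persistent under end-extension (`Forces`): for even `j`, that `τ` extends a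
-- given string; for odd `j`, that `τ` already verifies a given `Σ⁰₁` fact about `A ⊕ P`. Going
-- through `j` in order, `E j` is avoided whenever the tree still has arbitrarily long strings
-- avoiding it together with the events avoided so far (`Greedy`). The strings whose extension is
-- unavoidable form the path `P`, and the facts whose verification is unavoidable are exactly those
-- true of `A ⊕ P` (`TreeForcing.isUniversal`).
--
-- That `E j` is unavoidable is witnessed by one interval `[b, 2b)`, which every string `≥ b` meets
-- in a prefix (`exists_prefix_lt`). So the choices below `e` reduce to boundedly many `Σ⁰₁`
-- questions, and `IΣ⁰₁` codes the answers in one number (`exists_code_lt`,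
-- `TreeForcing.exists_alive`). This has two consequences. Initial segments of `Greedy` are coded,
-- which turns `Σ⁰₁` induction over `A ⊕ P` into bounded induction with a code as parameter
-- (`iSigma_one_join`). And `Greedy` is `Σ⁰₂` in `A` (`greedy_iff`), so for `k ≥ 2` every relation
-- `Σ⁰ₖ` in `A ⊕ P` is `Σ⁰ₖ` in `A` (`sig_of_sig_join`), and both `IΣ⁰ₙ` for `n ≥ 2` and `BΣ⁰ₙ₊₁`
-- for `n ≥ 1` carry over.
--
-- Instead of arithmetized syntax, `Σ⁰₁` truth uses a finite list of rules (`Rule`). Every fixed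
-- point of the rules represents all `Σ⁰₁` relations, by induction on standard formulas
-- (`IsUniversal.rep_s1`).
--
-- For conservation, the set parameters of a `Π¹₁` sentence are carried to a countable elementary
-- submodel and coded into one set `A`. Adding paths in `ω` steps, with bookkeeping over all `Δ⁰₁`
-- trees, gives a model of `WKL` with the same numbers (`exists_wkl_model`). The sentence holds
-- there, and its arithmetical matrix transfers back (`wkl_conservative`).

namespace SOArith

/-! ### Renaming variables -/

/-- Extend a renaming of number variables under a quantifier. -/
def liftVar {n n' : ℕ} (f : Fin n → Fin n') : Fin (n + 1) → Fin (n' + 1) :=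
  Fin.cases 0 fun i => (f i).succ

def Tm.rename {n n' : ℕ} (f : Fin n → Fin n') : Tm n → Tm n'
  | .var i => .var (f i)
  | .zero => .zero
  | .one => .one
  | .add s t => .add (s.rename f) (t.rename f)
  | .mul s t => .mul (s.rename f) (t.rename f)

def Fml.rename {m m' : ℕ} (g : Fin m → Fin m') :
    {n n' : ℕ} → (Fin n → Fin n') → Fml m n → Fml m' n'
  | _, _, f, .eq s t => .eq (s.rename f) (t.rename f)
  | _, _, f, .lt s t => .lt (s.rename f) (t.rename f)
  | _, _, f, .mem t i => .mem (t.rename f) (g i)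
  | _, _, f, .neg φ => .neg (φ.rename g f)
  | _, _, f, .and φ ψ => .and (φ.rename g f) (ψ.rename g f)
  | _, _, f, .or φ ψ => .or (φ.rename g f) (ψ.rename g f)
  | _, _, f, .ball t φ => .ball (t.rename f) (φ.rename g (liftVar f))
  | _, _, f, .bex t φ => .bex (t.rename f) (φ.rename g (liftVar f))
  | _, _, f, .all φ => .all (φ.rename g (liftVar f))
  | _, _, f, .ex φ => .ex (φ.rename g (liftVar f))

section

variable {M : Type u} [PMinus M]

theorem vecCons_comp_liftVar {α : Type*} {n n' : ℕ} (f : Fin n → Fin n') (a : α) (e : Fin n' → α) :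
    (fun i => Matrix.vecCons a e (liftVar f i)) = Matrix.vecCons a fun i => e (f i) := by
  funext i
  refine Fin.cases ?_ (fun i => ?_) i <;> simp [liftVar]

theorem Tm.val_rename {n n' : ℕ} (f : Fin n → Fin n') (e : Fin n' → M) (t : Tm n) :
    (t.rename f).val e = t.val fun i => e (f i) := by
  induction t <;> simp_all [Tm.rename, Tm.val]

theorem Fml.holds_rename {m m' n n' : ℕ} (g : Fin m → Fin m') (X : Fin m' → Set M)
    (f : Fin n → Fin n') (e : Fin n' → M) (φ : Fml m n) :
    (φ.rename g f).Holds X e ↔ φ.Holds (fun i => X (g i)) fun i => e (f i) := by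
  induction φ generalizing n' <;>
    simp_all [Fml.rename, Fml.Holds, Tm.val_rename, vecCons_comp_liftVar]

theorem Fml.isDelta0_rename {m m' n n' : ℕ} (g : Fin m → Fin m') (f : Fin n → Fin n')
    (φ : Fml m n) : (φ.rename g f).IsDelta0 ↔ φ.IsDelta0 := by
  induction φ generalizing n' <;> simp_all [Fml.rename, Fml.IsDelta0]

theorem Fml.isSigma_isPi_rename {m m' k : ℕ} (g : Fin m → Fin m') : ∀ {n n' : ℕ}
    (f : Fin n → Fin n') (φ : Fml m n),
    (φ.IsSigma k → (φ.rename g f).IsSigma k) ∧ (φ.IsPi k → (φ.rename g f).IsPi k) := by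
  induction k with
  | zero =>
    intro n n' f φ
    refine ⟨fun h => ?_, fun h => ?_⟩
    · cases h with | zero h => exact .zero ((isDelta0_rename g f φ).2 h)
    · cases h with | zero h => exact .zero ((isDelta0_rename g f φ).2 h)
  | succ k ih =>
    intro n n' f φ
    refine ⟨fun h => ?_, fun h => ?_⟩
    · cases h with | succ h => exact .succ ((ih (liftVar f) _).2 h)
    · cases h with | succ h => exact .succ ((ih (liftVar f) _).1 h)

/-! ### Definable relations, semantically -/

/-- Functions given by a term with parameters. -/
inductive TF {n : ℕ} : ((Fin n → M) → M) → Prop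
  | var (i : Fin n) : TF fun v => v i
  | const (c : M) : TF fun _ => c
  | add {s t : (Fin n → M) → M} : TF s → TF t → TF fun v => s v + t v
  | mul {s t : (Fin n → M) → M} : TF s → TF t → TF fun v => s v * t v

/-- Relations given by a `Σ⁰₀` formula with number parameters and set parameters from `S`. -/
inductive D0 (S : Set (Set M)) : {n : ℕ} → ((Fin n → M) → Prop) → Prop
  | eq {n : ℕ} {s t : (Fin n → M) → M} : TF s → TF t → D0 S fun v => s v = t v
  | lt {n : ℕ} {s t : (Fin n → M) → M} : TF s → TF t → D0 S fun v => s v < t v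
  | mem {n : ℕ} {X : Set M} {t : (Fin n → M) → M} : X ∈ S → TF t → D0 S fun v => t v ∈ X
  | not {n : ℕ} {R : (Fin n → M) → Prop} : D0 S R → D0 S fun v => ¬ R v
  | and {n : ℕ} {R R' : (Fin n → M) → Prop} : D0 S R → D0 S R' → D0 S fun v => R v ∧ R' v
  | or {n : ℕ} {R R' : (Fin n → M) → Prop} : D0 S R → D0 S R' → D0 S fun v => R v ∨ R' v
  | ballCons {n : ℕ} {t : (Fin n → M) → M} {R : (Fin (n + 1) → M) → Prop} :
      TF t → D0 S R → D0 S fun v => ∀ a, a < t v → R (Matrix.vecCons a v)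
  | bexCons {n : ℕ} {t : (Fin n → M) → M} {R : (Fin (n + 1) → M) → Prop} :
      TF t → D0 S R → D0 S fun v => ∃ a, a < t v ∧ R (Matrix.vecCons a v)

/-- Relations given by a `Σ⁰ₖ` formula with number parameters and set parameters from `S`. -/
def Sig (S : Set (Set M)) : ℕ → {n : ℕ} → ((Fin n → M) → Prop) → Prop
  | 0, _, R => D0 S R
  | k + 1, n, R => ∃ R' : (Fin (n + 1) → M) → Prop,
      Sig S k (fun v => ¬ R' v) ∧ ∀ v, R v ↔ ∃ a, R' (Matrix.vecCons a v)

theorem TF.comp {n n' : ℕ} {t : (Fin n → M) → M} (ht : TF t) (f : Fin n → Fin n') :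
    TF fun v : Fin n' → M => t fun i => v (f i) := by
  induction ht with
  | var i => exact .var _
  | const c => exact .const c
  | add _ _ h h' => exact .add h h'
  | mul _ _ h h' => exact .mul h h'

theorem TF.zero {n : ℕ} : TF fun _ : Fin n → M => (0 : M) := .const 0
theorem TF.one {n : ℕ} : TF fun _ : Fin n → M => (1 : M) := .const 1

variable {S : Set (Set M)}

theorem D0.congr {n : ℕ} {R R' : (Fin n → M) → Prop} (h : D0 S R) (e : ∀ v, R' v ↔ R v) :
    D0 S R' := by
  rwa [show R' = R from funext fun v => propext (e v)]

theorem Sig.congr {k n : ℕ} {R R' : (Fin n → M) → Prop} (h : Sig S k R) (e : ∀ v, R' v ↔ R v) :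
    Sig S k R' := by
  rwa [show R' = R from funext fun v => propext (e v)]

/-- The bound variable is an argument of `R` rather than an entry of `Matrix.vecCons`; this is the
shape in which concrete relations present it. -/
theorem D0.ball {n : ℕ} {t : (Fin n → M) → M} {R : (Fin n → M) → M → Prop} (ht : TF t)
    (hR : D0 S fun w : Fin (n + 1) → M => R (fun i => w i.succ) (w 0)) :
    D0 S fun v => ∀ a, a < t v → R v a :=
  (D0.ballCons ht hR).congr fun v => by simp

theorem D0.bex {n : ℕ} {t : (Fin n → M) → M} {R : (Fin n → M) → M → Prop} (ht : TF t)
    (hR : D0 S fun w : Fin (n + 1) → M => R (fun i => w i.succ) (w 0)) :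
    D0 S fun v => ∃ a, a < t v ∧ R v a :=
  (D0.bexCons ht hR).congr fun v => by simp

theorem D0.imp {n : ℕ} {R R' : (Fin n → M) → Prop} (h : D0 S R) (h' : D0 S R') :
    D0 S fun v => R v → R' v :=
  (h.not.or h').congr fun v => by tauto

theorem D0.iff {n : ℕ} {R R' : (Fin n → M) → Prop} (h : D0 S R) (h' : D0 S R') :
    D0 S fun v => R v ↔ R' v :=
  ((h.imp h').and (h'.imp h)).congr fun v => by tauto

theorem D0.le {n : ℕ} {s t : (Fin n → M) → M} (hs : TF s) (ht : TF t) :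
    D0 S fun v => s v ≤ t v :=
  (D0.lt ht hs).not.congr fun _ => not_lt.symm

theorem D0.comp {n n' : ℕ} {R : (Fin n → M) → Prop} (h : D0 S R) (f : Fin n → Fin n') :
    D0 S fun v : Fin n' → M => R fun i => v (f i) := by
  induction h generalizing n' with
  | eq hs ht => exact .eq (hs.comp f) (ht.comp f)
  | lt hs ht => exact .lt (hs.comp f) (ht.comp f)
  | mem hX ht => exact .mem hX (ht.comp f)
  | not _ h => exact (h f).not
  | and _ _ h h' => exact (h f).and (h' f)
  | or _ _ h h' => exact (h f).or (h' f)
  | ballCons ht _ h =>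
    refine (D0.ballCons (ht.comp f) (h (liftVar f))).congr fun v => ?_
    simp only [vecCons_comp_liftVar]
  | bexCons ht _ h =>
    refine (D0.bexCons (ht.comp f) (h (liftVar f))).congr fun v => ?_
    simp only [vecCons_comp_liftVar]

theorem TF.compTF {n n' : ℕ} {t : (Fin n → M) → M} (ht : TF t) {g : (Fin n' → M) → Fin n → M}
    (hg : ∀ i, TF fun v => g v i) : TF fun v => t (g v) := by
  induction ht with
  | var i => exact hg i
  | const c => exact .const c
  | add _ _ h h' => exact .add h h'
  | mul _ _ h h' => exact .mul h h'

/-- Substitution under a quantifier: the bound variable stays, and the substituted terms are shifted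
past it. -/
theorem TF.cons {n n' : ℕ} {g : (Fin n' → M) → Fin n → M} (hg : ∀ i, TF fun v => g v i)
    (i : Fin (n + 1)) :
    TF fun w : Fin (n' + 1) → M => Matrix.vecCons (w 0) (g fun j => w j.succ) i := by
  refine Fin.cases ?_ (fun i => ?_) i
  · exact .var 0
  · exact (hg i).comp Fin.succ

theorem D0.compTF {n n' : ℕ} {R : (Fin n → M) → Prop} (h : D0 S R)
    {g : (Fin n' → M) → Fin n → M} (hg : ∀ i, TF fun v => g v i) :
    D0 S fun v => R (g v) := by
  induction h generalizing n' with
  | eq hs ht => exact .eq (hs.compTF hg) (ht.compTF hg)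
  | lt hs ht => exact .lt (hs.compTF hg) (ht.compTF hg)
  | mem hX ht => exact .mem hX (ht.compTF hg)
  | not _ h => exact (h hg).not
  | and _ _ h h' => exact (h hg).and (h' hg)
  | or _ _ h h' => exact (h hg).or (h' hg)
  | ballCons ht _ h => exact D0.ball (R := fun v a => _) (ht.compTF hg) (h (TF.cons hg))
  | bexCons ht _ h => exact D0.bex (R := fun v a => _) (ht.compTF hg) (h (TF.cons hg))

theorem D0.mono {S S' : Set (Set M)} (hS : S ⊆ S') {n : ℕ} {R : (Fin n → M) → Prop}
    (h : D0 S R) : D0 S' R := by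
  induction h with
  | eq hs ht => exact .eq hs ht
  | lt hs ht => exact .lt hs ht
  | mem hX ht => exact .mem (hS hX) ht
  | not _ h => exact h.not
  | and _ _ h h' => exact h.and h'
  | or _ _ h h' => exact h.or h'
  | ballCons ht _ h => exact .ballCons ht h
  | bexCons ht _ h => exact .bexCons ht h

theorem Sig.mono {S S' : Set (Set M)} (hS : S ⊆ S') {k n : ℕ} {R : (Fin n → M) → Prop}
    (h : Sig S k R) : Sig S' k R := by
  induction k generalizing n with
  | zero => exact D0.mono hS h
  | succ k ih =>
    obtain ⟨R', h, e⟩ := h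
    exact ⟨R', ih h, e⟩

theorem Sig.compTF {k n n' : ℕ} {R : (Fin n → M) → Prop} (h : Sig S k R)
    {g : (Fin n' → M) → Fin n → M} (hg : ∀ i, TF fun v => g v i) :
    Sig S k fun v => R (g v) := by
  induction k generalizing n n' with
  | zero => exact D0.compTF h hg
  | succ k ih =>
    obtain ⟨R', h, e⟩ := h
    refine ⟨fun w => R' (Matrix.vecCons (w 0) (g fun j => w j.succ)), ih h (TF.cons hg), fun v => ?_⟩
    simp [e]

/-! ### Definable relations and formulas -/

theorem Tm.tf_val {n k : ℕ} (t : Tm n) {g : (Fin k → M) → Fin n → M} (hg : ∀ i, TF fun v => g v i) :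
    TF fun v => t.val (g v) := by
  induction t with
  | var i => exact hg i
  | zero => exact .zero
  | one => exact .one
  | add _ _ h h' => exact .add h h'
  | mul _ _ h h' => exact .mul h h'

/-- Assigning variables through a tuple `g` of terms lets the induction pass under quantifiers and
later absorbs number parameters as constants. -/
theorem Fml.IsDelta0.d0 {m n k : ℕ} {X : Fin m → Set M} (hX : ∀ i, X i ∈ S) {φ : Fml m n}
    (h : φ.IsDelta0) {g : (Fin k → M) → Fin n → M} (hg : ∀ i, TF fun v => g v i) :
    D0 S fun v => φ.Holds X (g v) := by
  induction φ generalizing k with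
  | eq s t => exact .eq (s.tf_val hg) (t.tf_val hg)
  | lt s t => exact .lt (s.tf_val hg) (t.tf_val hg)
  | mem t i => exact .mem (hX i) (t.tf_val hg)
  | neg φ ih => exact (ih h hg).not
  | and φ ψ ih ih' => exact (ih h.1 hg).and (ih' h.2 hg)
  | or φ ψ ih ih' => exact (ih h.1 hg).or (ih' h.2 hg)
  | ball t φ ih => exact D0.ball (R := fun v a => _) (t.tf_val hg) (ih h (TF.cons hg))
  | bex t φ ih => exact D0.bex (R := fun v a => _) (t.tf_val hg) (ih h (TF.cons hg))
  | all => exact h.elim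
  | ex => exact h.elim

theorem Fml.sig {m n k l : ℕ} {X : Fin m → Set M} (hX : ∀ i, X i ∈ S) {φ : Fml m n}
    {g : (Fin k → M) → Fin n → M} (hg : ∀ i, TF fun v => g v i) :
    (φ.IsSigma l → Sig S l fun v => φ.Holds X (g v)) ∧
      (φ.IsPi l → Sig S l fun v => ¬ φ.Holds X (g v)) := by
  induction l generalizing n k with
  | zero =>
    refine ⟨fun h => ?_, fun h => ?_⟩
    · cases h with | zero h => exact h.d0 hX hg
    · cases h with | zero h => exact (h.d0 hX hg).not
  | succ l ih =>
    refine ⟨fun h => ?_, fun h => ?_⟩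
    · cases h with
      | succ h =>
        refine ⟨_, (ih (TF.cons hg)).2 h, fun v => ?_⟩
        simp [Fml.Holds]
    · cases h with
      | @succ _ _ φ h =>
        refine ⟨fun w => ¬ φ.Holds X (Matrix.vecCons (w 0) (g fun j => w j.succ)), ?_, fun v => ?_⟩
        · simpa using (ih (TF.cons hg)).1 h
        · simp [Fml.Holds]

/-- `t` is the value of a term in the variables and parameters assigned by `ρ`. -/
theorem TF.exists_tm {n : ℕ} {t : (Fin n → M) → M} (ht : TF t) :
    ∃ (N : ℕ) (s : Tm N) (ρ : Fin N → Fin n ⊕ M),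
      ∀ v, t v = s.val fun i => Sum.elim v id (ρ i) := by
  have key : ∀ {s t : (Fin n → M) → M} (op : ∀ N, Tm N → Tm N → Tm N) (op' : M → M → M),
      (∀ N (s t : Tm N) (e : Fin N → M), (op N s t).val e = op' (s.val e) (t.val e)) →
      (∃ (N : ℕ) (s' : Tm N) (ρ : Fin N → Fin n ⊕ M), ∀ v, s v = s'.val fun i => Sum.elim v id (ρ i)) →
      (∃ (N : ℕ) (s' : Tm N) (ρ : Fin N → Fin n ⊕ M), ∀ v, t v = s'.val fun i => Sum.elim v id (ρ i)) →
      ∃ (N : ℕ) (s' : Tm N) (ρ : Fin N → Fin n ⊕ M),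
        ∀ v, op' (s v) (t v) = s'.val fun i => Sum.elim v id (ρ i) := by
    rintro s t op op' hop ⟨N, s', ρ, h⟩ ⟨N', t', ρ', h'⟩
    refine ⟨N + N', op _ (s'.rename (Fin.castAdd N')) (t'.rename (Fin.natAdd N)), Fin.append ρ ρ',
      fun v => ?_⟩
    simp [hop, Tm.val_rename, h, h']
  induction ht with
  | var i => exact ⟨1, .var 0, fun _ => .inl i, fun v => rfl⟩
  | const c => exact ⟨1, .var 0, fun _ => .inr c, fun v => rfl⟩
  | add _ _ h h' => exact key (fun N => .add) _ (fun _ _ _ _ => rfl) h h'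
  | mul _ _ h h' => exact key (fun N => .mul) _ (fun _ _ _ _ => rfl) h h'

/-- `R` is defined by a formula with the property `C`. -/
def DefinedBy (S : Set (Set M)) (C : ∀ {m n : ℕ}, Fml m n → Prop) {n : ℕ}
    (R : (Fin n → M) → Prop) : Prop :=
  ∃ (m N : ℕ) (φ : Fml m N) (X : Fin m → Set M) (ρ : Fin N → Fin n ⊕ M), C φ ∧ (∀ i, X i ∈ S) ∧
    ∀ v, R v ↔ φ.Holds X fun i => Sum.elim v id (ρ i)

/-- Variables of a formula under a quantifier: those assigned `inl 0` become bound. -/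
def bindVar {n N : ℕ} (ρ : Fin N → Fin (n + 1) ⊕ M) (i : Fin N) : Fin (N + 1) :=
  Sum.elim (Fin.cases 0 fun _ => i.succ) (fun _ => i.succ) (ρ i)

/-- The value `inr 0` at a variable that becomes bound is never read, since `bindVar` redirects that
variable. -/
def unbindVar {n N : ℕ} (ρ : Fin N → Fin (n + 1) ⊕ M) (i : Fin N) : Fin n ⊕ M :=
  Sum.elim (Fin.cases (.inr 0) .inl) .inr (ρ i)

theorem vecCons_bindVar {n N : ℕ} (ρ : Fin N → Fin (n + 1) ⊕ M) (v : Fin n → M) (a : M) :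
    (fun i => Matrix.vecCons a (fun i => Sum.elim v id (unbindVar ρ i)) (bindVar ρ i)) =
      fun i => Sum.elim (Matrix.vecCons a v) id (ρ i) := by
  funext i
  simp only [bindVar]
  rcases h : ρ i with j | c
  · refine Fin.cases (fun h => ?_) (fun j h => ?_) j h <;> simp [unbindVar, h]
  · simp [unbindVar, h]

/-- Parameters become extra variables valued by `ρ`. Subformulas with unrelated variables and
parameters are combined over disjoint copies, joined by `Fin.append`. -/
theorem D0.definedBy {n : ℕ} {R : (Fin n → M) → Prop} (h : D0 S R) :
    DefinedBy S (fun φ => φ.IsDelta0) R := by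
  have term2 : ∀ {n : ℕ} {s t : (Fin n → M) → M}, TF s → TF t → ∃ (N : ℕ) (s' t' : Tm N)
      (ρ : Fin N → Fin n ⊕ M), (∀ v, s v = s'.val fun i => Sum.elim v id (ρ i)) ∧
        ∀ v, t v = t'.val fun i => Sum.elim v id (ρ i) := by
    intro n s t hs ht
    obtain ⟨N, s', ρ, h⟩ := hs.exists_tm
    obtain ⟨N', t', ρ', h'⟩ := ht.exists_tm
    refine ⟨N + N', s'.rename (Fin.castAdd N'), t'.rename (Fin.natAdd N), Fin.append ρ ρ', ?_, ?_⟩ <;>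
      simp [Tm.val_rename, h, h']
  have bin : ∀ {n : ℕ} {R R' : (Fin n → M) → Prop} (op : ∀ {m N}, Fml m N → Fml m N → Fml m N)
      (op' : Prop → Prop → Prop), (∀ {m N} (φ ψ : Fml m N), φ.IsDelta0 → ψ.IsDelta0 → (op φ ψ).IsDelta0) →
      (∀ {m N} (φ ψ : Fml m N) (X : Fin m → Set M) (e : Fin N → M),
        (op φ ψ).Holds X e ↔ op' (φ.Holds X e) (ψ.Holds X e)) →
      DefinedBy S (fun φ => φ.IsDelta0) R → DefinedBy S (fun φ => φ.IsDelta0) R' →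
      DefinedBy S (fun φ => φ.IsDelta0) fun v => op' (R v) (R' v) := by
    rintro n R R' op op' h0 hop ⟨m, N, φ, X, ρ, hφ, hX, h⟩ ⟨m', N', φ', X', ρ', hφ', hX', h'⟩
    refine ⟨m + m', N + N', op (φ.rename (Fin.castAdd m') (Fin.castAdd N'))
      (φ'.rename (Fin.natAdd m) (Fin.natAdd N)), Fin.append X X', Fin.append ρ ρ',
      h0 _ _ ((Fml.isDelta0_rename _ _ _).2 hφ) ((Fml.isDelta0_rename _ _ _).2 hφ'), ?_, ?_⟩
    · intro i
      refine Fin.addCases (fun i => ?_) (fun i => ?_) i <;> simp [hX, hX']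
    · intro v
      simp [hop, Fml.holds_rename, h, h']
  have quant : ∀ {n : ℕ} {t : (Fin n → M) → M} {R : (Fin (n + 1) → M) → Prop}, TF t →
      DefinedBy S (fun φ => φ.IsDelta0) R → ∃ (m N : ℕ) (t' : Tm N) (φ : Fml m (N + 1))
        (X : Fin m → Set M) (ρ : Fin N → Fin n ⊕ M), φ.IsDelta0 ∧ (∀ i, X i ∈ S) ∧
        (∀ v, t v = t'.val fun i => Sum.elim v id (ρ i)) ∧
        ∀ v a, R (Matrix.vecCons a v) ↔ φ.Holds X (Matrix.vecCons a fun i => Sum.elim v id (ρ i)) := by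
    rintro n t R ht ⟨m, N', φ, X, ρ', hφ, hX, h'⟩
    obtain ⟨N, t', ρ, h⟩ := ht.exists_tm
    refine ⟨m, N + N', t'.rename (Fin.castAdd N'),
      φ.rename id (fun i => liftVar (Fin.natAdd N) (bindVar ρ' i)),
      X, Fin.append ρ (unbindVar ρ'), (Fml.isDelta0_rename _ _ _).2 hφ, hX, ?_, ?_⟩
    · intro v
      simp [Tm.val_rename, h]
    · intro v a
      rw [h', ← vecCons_bindVar, Fml.holds_rename]
      simp only [id]
      have := vecCons_comp_liftVar (Fin.natAdd N) a
        (fun i => Sum.elim v id (Fin.append ρ (unbindVar ρ') i))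
      have e : (fun i => Matrix.vecCons a (fun i => Sum.elim v id (Fin.append ρ (unbindVar ρ') i))
          (liftVar (Fin.natAdd N) (bindVar ρ' i))) = fun i =>
          Matrix.vecCons a (fun i => Sum.elim v id (unbindVar ρ' i)) (bindVar ρ' i) := by
        funext i
        rw [congrFun this]
        simp
      rw [e]
  induction h with
  | eq hs ht =>
    obtain ⟨N, s', t', ρ, h, h'⟩ := term2 hs ht
    exact ⟨0, N, .eq s' t', Fin.elim0, ρ, trivial, fun i => i.elim0, fun v => by simp [Fml.Holds, h, h']⟩
  | lt hs ht =>
    obtain ⟨N, s', t', ρ, h, h'⟩ := term2 hs ht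
    exact ⟨0, N, .lt s' t', Fin.elim0, ρ, trivial, fun i => i.elim0, fun v => by simp [Fml.Holds, h, h']⟩
  | @mem _ X _ hX ht =>
    obtain ⟨N, t', ρ, h⟩ := ht.exists_tm
    exact ⟨1, N, .mem t' 0, fun _ => X, ρ, trivial, fun _ => hX, fun v => by simp [Fml.Holds, h]⟩
  | not _ h =>
    obtain ⟨m, N, φ, X, ρ, hφ, hX, h⟩ := h
    exact ⟨m, N, φ.neg, X, ρ, hφ, hX, fun v => by simp [Fml.Holds, h]⟩
  | and _ _ h h' => exact bin .and _ (fun _ _ h h' => ⟨h, h'⟩) (fun _ _ _ _ => Iff.rfl) h h'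
  | or _ _ h h' => exact bin .or _ (fun _ _ h h' => ⟨h, h'⟩) (fun _ _ _ _ => Iff.rfl) h h'
  | ballCons ht _ h =>
    obtain ⟨m, N, t', φ, X, ρ, hφ, hX, h, h'⟩ := quant ht h
    exact ⟨m, N, .ball t' φ, X, ρ, hφ, hX, fun v => by simp [Fml.Holds, h, h']⟩
  | bexCons ht _ h =>
    obtain ⟨m, N, t', φ, X, ρ, hφ, hX, h, h'⟩ := quant ht h
    exact ⟨m, N, .bex t' φ, X, ρ, hφ, hX, fun v => by simp [Fml.Holds, h, h']⟩

theorem Sig.definedBy {k n : ℕ} {R : (Fin n → M) → Prop} :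
    (Sig S k R → DefinedBy S (fun φ => φ.IsSigma k) R) ∧
      (Sig S k (fun v => ¬ R v) → DefinedBy S (fun φ => φ.IsPi k) R) := by
  induction k generalizing n with
  | zero =>
    refine ⟨fun h => ?_, fun h => ?_⟩
    · obtain ⟨m, N, φ, X, ρ, hφ, h⟩ := D0.definedBy h
      exact ⟨m, N, φ, X, ρ, .zero hφ, h⟩
    · obtain ⟨m, N, φ, X, ρ, hφ, h⟩ := (D0.not h).definedBy
      exact ⟨m, N, φ, X, ρ, .zero hφ, by simpa using h⟩
  | succ k ih =>
    refine ⟨?_, ?_⟩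
    · rintro ⟨R', h, e⟩
      obtain ⟨m, N, φ, X, ρ, hφ, hX, h⟩ := ih.2 h
      refine ⟨m, N, .ex (φ.rename id (bindVar ρ)), X, unbindVar ρ,
        .succ ((Fml.isSigma_isPi_rename _ _ _).2 hφ), hX, fun v => ?_⟩
      simp [e, Fml.Holds, Fml.holds_rename, vecCons_bindVar, h]
    · rintro ⟨R', h, e⟩
      obtain ⟨m, N, φ, X, ρ, hφ, hX, h⟩ := ih.1 h
      refine ⟨m, N, .all (φ.rename id (bindVar ρ)), X, unbindVar ρ,
        .succ ((Fml.isSigma_isPi_rename _ _ _).1 hφ), hX, fun v => ?_⟩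
      have := e v
      simp only [not_iff_comm (a := R v)] at this
      simp [← this, Fml.Holds, Fml.holds_rename, vecCons_bindVar, ← h]

theorem isSigmaSet_iff {k : ℕ} {B : Set M} :
    IsSigmaSet S k B ↔ Sig S k fun v : Fin 1 → M => v 0 ∈ B := by
  constructor
  · rintro ⟨m, n, φ, X, e, hφ, hX, h⟩
    refine ((Fml.sig hX (g := fun v : Fin 1 → M => Matrix.vecCons (v 0) e) fun i => ?_).1 hφ).congr
      fun v => h _
    refine Fin.cases ?_ (fun i => ?_) i
    · exact .var 0
    · exact .const (e i)
  · intro h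
    obtain ⟨m, N, φ, X, ρ, hφ, hX, h⟩ := Sig.definedBy.1 h
    -- Variables assigned `inl` are identified with variable `0` and the others become parameters;
    -- the parameter slots of the former hold an unused `0`.
    refine ⟨m, N, φ.rename id fun i => Sum.elim (fun _ => 0) (fun _ => i.succ) (ρ i), X,
      fun i => Sum.elim (fun _ => 0) id (ρ i), (Fml.isSigma_isPi_rename _ _ _).1 hφ, hX, fun a => ?_⟩
    have := h fun _ => a
    simp only at this
    rw [this, Fml.holds_rename]
    refine iff_of_eq (congrArg _ (funext fun i => ?_))
    rcases h : ρ i <;> simp [h]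

theorem bSigma_iff {k : ℕ} : BSigma k S ↔ ISigma 0 S ∧ ∀ R : M → M → Prop,
    Sig S k (fun v : Fin 2 → M => R (v 0) (v 1)) → ∀ x₀ : M, (∀ x < x₀, ∃ y, R x y) →
      ∃ y₀, ∀ x < x₀, ∃ y < y₀, R x y := by
  refine and_congr_right fun _ => ⟨fun H R hR => ?_, fun H m n φ X e hφ hX => ?_⟩
  · obtain ⟨m, N, φ, X, ρ, hφ, hX, h⟩ := Sig.definedBy.1 hR
    have key : ∀ x y, R x y ↔ (φ.rename id fun i => Sum.elim (fun j : Fin 2 => j.castLE (by omega))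
        (fun _ => i.succ.succ) (ρ i)).Holds X (Matrix.vecCons x (Matrix.vecCons y fun i =>
          Sum.elim (fun _ => 0) id (ρ i))) := by
      intro x y
      have := h ![x, y]
      simp only [Matrix.cons_val_zero, Matrix.cons_val_one] at this
      rw [this, Fml.holds_rename]
      refine iff_of_eq (congrArg _ (funext fun i => ?_))
      rcases h : ρ i with j | c
      · fin_cases j <;> rfl
      · simp [h]
    simp only [key]
    exact H m N _ X _ ((Fml.isSigma_isPi_rename _ _ _).1 hφ) hX
  · refine H (fun x y => φ.Holds X (Matrix.vecCons x (Matrix.vecCons y e))) ?_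
    refine (Fml.sig hX (g := fun v : Fin 2 → M => Matrix.vecCons (v 0) (Matrix.vecCons (v 1) e))
      fun i => ?_).1 hφ
    refine Fin.cases ?_ (Fin.cases ?_ fun i => ?_) i
    · exact .var 0
    · exact .var 1
    · exact .const (e i)

end

section

variable {M : Type u} [PMinus M] {S : Set (Set M)}

/-! ### Definability by type class inference -/

/-- These classes let instance search read definability off the shape of a relation. -/
class IsTF {n : ℕ} (t : (Fin n → M) → M) : Prop where
  out : TF t

class IsD0 (S : Set (Set M)) {n : ℕ} (R : (Fin n → M) → Prop) : Prop where
  out : D0 S R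

class IsS1 (S : Set (Set M)) {n : ℕ} (R : (Fin n → M) → Prop) : Prop where
  out : Sig S 1 R

section

variable {n n' : ℕ} {s t : (Fin n → M) → M} {R R' : (Fin n → M) → Prop}

instance (priority := 10) [IsTF t] (f : Fin n → Fin n') :
    IsTF fun v : Fin n' → M => t fun i => v (f i) := ⟨IsTF.out.comp f⟩
instance (i : Fin n) : IsTF fun v : Fin n → M => v i := ⟨.var i⟩
instance (c : M) : IsTF fun _ : Fin n → M => c := ⟨.const c⟩
instance [IsTF s] [IsTF t] : IsTF fun v => s v + t v := ⟨.add IsTF.out IsTF.out⟩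
instance [IsTF s] [IsTF t] : IsTF fun v => s v * t v := ⟨.mul IsTF.out IsTF.out⟩

instance [IsTF s] [IsTF t] : IsD0 S fun v => s v = t v := ⟨.eq IsTF.out IsTF.out⟩
instance [IsTF s] [IsTF t] : IsD0 S fun v => s v < t v := ⟨.lt IsTF.out IsTF.out⟩
instance [IsTF s] [IsTF t] : IsD0 S fun v => s v ≤ t v := ⟨.le IsTF.out IsTF.out⟩
instance [IsD0 S R] [IsD0 S R'] : IsD0 S fun v => R v ∧ R' v := ⟨.and IsD0.out IsD0.out⟩
instance [IsD0 S R] [IsD0 S R'] : IsD0 S fun v => R v ∨ R' v := ⟨.or IsD0.out IsD0.out⟩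
instance [IsD0 S R] [IsD0 S R'] : IsD0 S fun v => R v → R' v := ⟨.imp IsD0.out IsD0.out⟩
instance [IsD0 S R] [IsD0 S R'] : IsD0 S fun v => R v ↔ R' v := ⟨.iff IsD0.out IsD0.out⟩
instance [IsD0 S R] : IsD0 S fun v => ¬ R v := ⟨.not IsD0.out⟩

instance {R : (Fin n → M) → M → Prop} [IsTF t]
    [IsD0 S fun w : Fin (n + 1) → M => R (fun i => w i.succ) (w 0)] :
    IsD0 S fun v => ∀ a, a < t v → R v a := ⟨.ball IsTF.out IsD0.out⟩
instance {R : (Fin n → M) → M → Prop} [IsTF t]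
    [IsD0 S fun w : Fin (n + 1) → M => R (fun i => w i.succ) (w 0)] :
    IsD0 S fun v => ∃ a, a < t v ∧ R v a := ⟨.bex IsTF.out IsD0.out⟩

theorem IsD0.congr (h : IsD0 S R) (e : ∀ v, R' v ↔ R v) : IsD0 S R' := ⟨h.out.congr e⟩

theorem IsS1.congr (h : IsS1 S R) (e : ∀ v, R' v ↔ R v) : IsS1 S R' := ⟨h.out.congr e⟩

theorem isD0_mem {X : Set M} (hX : X ∈ S) [IsTF t] : IsD0 S fun v => t v ∈ X := ⟨.mem hX IsTF.out⟩

theorem isS1_iff : IsS1 S R ↔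
    ∃ R' : (Fin (n + 1) → M) → Prop, D0 S R' ∧ ∀ v, R v ↔ ∃ a, R' (Matrix.vecCons a v) := by
  refine ⟨fun ⟨R', h, e⟩ => ⟨R', ?_, e⟩, fun ⟨R', h, e⟩ => ⟨R', h.not, e⟩⟩
  exact (D0.not h).congr fun v => not_not.symm

/-- Meant as a local instance: after `have := h.app`, instance search can substitute any terms into
`p`. -/
theorem IsD0.app {p : M → Prop} (h : IsD0 S fun v : Fin 1 → M => p (v 0)) ⦃n : ℕ⦄
    (t : (Fin n → M) → M) [IsTF t] : IsD0 S fun w => p (t w) :=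
  ⟨h.out.compTF (g := fun w _ => t w) fun _ => IsTF.out⟩

theorem IsD0.app₂ {p : M → M → Prop} (h : IsD0 S fun v : Fin 2 → M => p (v 0) (v 1)) ⦃n : ℕ⦄
    (s t : (Fin n → M) → M) [IsTF s] [IsTF t] : IsD0 S fun w => p (s w) (t w) :=
  ⟨h.out.compTF (g := fun w => ![s w, t w]) (Fin.cases (IsTF.out (t := s)) fun i => by
    rw [Subsingleton.elim i 0]; exact IsTF.out (t := t))⟩

theorem IsS1.app {p : M → Prop} (h : IsS1 S fun v : Fin 1 → M => p (v 0)) ⦃n : ℕ⦄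
    (t : (Fin n → M) → M) [IsTF t] : IsS1 S fun w => p (t w) :=
  ⟨h.out.compTF (g := fun w _ => t w) fun _ => IsTF.out⟩

theorem D0.app {R : (Fin n → M) → Prop} (h : D0 S R) ⦃k : ℕ⦄ (g : (Fin k → M) → Fin n → M)
    [∀ i, IsTF fun w => g w i] : IsD0 S fun w => R (g w) :=
  ⟨h.compTF fun _ => IsTF.out⟩

instance [IsTF t] {g : (Fin n → M) → Fin n' → M} [h : ∀ i, IsTF fun w => g w i] (i : Fin (n' + 1)) :
    IsTF fun w => Matrix.vecCons (t w) (g w) i :=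
  Fin.cases (motive := fun i => IsTF fun w => Matrix.vecCons (t w) (g w) i)
    (by simpa) (fun i => by simpa using h i) i

theorem IsD0.ex {R : (Fin n → M) → M → Prop}
    (h : IsD0 S fun w : Fin (n + 1) → M => R (fun i => w i.succ) (w 0)) :
    IsS1 S fun v => ∃ a, R v a :=
  isS1_iff.2 ⟨_, h.out, fun v => by simp⟩

theorem IsD0.isS1 (h : IsD0 S R) : IsS1 S R :=
  (IsD0.ex (R := fun v _ => R v) ⟨h.out.comp _⟩).congr fun v => by simp

end

/-! ### Elementary arithmetic -/

theorem lt_add_one_iff' {a b : M} : a < b + 1 ↔ a ≤ b := by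
  constructor
  · intro h
    by_contra hab
    obtain ⟨c, rfl⟩ := le_iff_exists_add.1 (not_le.1 hab).le
    have h0 : 0 < c := by
      rcases eq_or_ne c 0 with rfl | h'
      · simp at hab
      · exact pos_iff_ne_zero.2 h'
    have := PMinus.one_le_of_pos c h0
    grind
  · intro h
    have : (0 : M) < 1 := zero_lt_one
    grind

theorem add_one_le_iff' {a b : M} : a + 1 ≤ b ↔ a < b := by
  rw [← not_lt, lt_add_one_iff', not_le]

theorem ne_add_add_one (a b : M) : a ≠ a + (b + 1) :=
  (lt_add_of_pos_right a (lt_of_lt_of_le zero_lt_one le_add_self)).ne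

theorem eq_zero_or_succ (a : M) : a = 0 ∨ ∃ b, a = b + 1 := by
  rcases eq_or_ne a 0 with h | h
  · exact .inl h
  · obtain ⟨b, rfl⟩ := le_iff_exists_add'.1 (PMinus.one_le_of_pos a (pos_iff_ne_zero.2 h))
    exact .inr ⟨b, rfl⟩

theorem le_mul_of_pos {a b : M} (h : 0 < b) : a ≤ a * b := by
  simpa using mul_le_mul_right (PMinus.one_le_of_pos b h) a

/-- In the absence of subtraction the two quotients are compared; if the second is not larger, `b =
0`. -/
theorem dvd_of_dvd_add {m a b : M} (h : m ∣ a) (h' : m ∣ a + b) : m ∣ b := by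
  obtain ⟨u, rfl⟩ := h
  obtain ⟨v, hv⟩ := h'
  rcases le_total u v with huv | huv
  · obtain ⟨w, rfl⟩ := le_iff_exists_add.1 huv
    exact ⟨w, by grind⟩
  · have := mul_le_mul_right huv m
    have h0 : (0 : M) ≤ b := zero_le
    have : b = 0 := by grind
    simp [this]

theorem dvd_iff_exists_lt {a b : M} : a ∣ b ↔ ∃ c, c < b + 1 ∧ b = a * c := by
  constructor
  · rintro ⟨c, rfl⟩
    rcases eq_or_ne a 0 with rfl | ha
    · exact ⟨0, by simp⟩
    · refine ⟨c, lt_add_one_iff'.2 ?_, rfl⟩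
      rw [mul_comm]
      exact le_mul_of_pos (pos_iff_ne_zero.2 ha)
  · rintro ⟨c, -, rfl⟩
    exact ⟨c, rfl⟩

instance {n : ℕ} {s t : (Fin n → M) → M} [IsTF s] [IsTF t] : IsD0 S fun v => s v ∣ t v :=
  (inferInstance : IsD0 S fun v => ∃ c, c < t v + 1 ∧ t v = s v * c).congr
    fun _ => dvd_iff_exists_lt

/-- A pairing function. -/
def pr (a b : M) : M := (a + b) * (a + b) + a

/-- Since `(a + b)² ≤ pr a b < (a + b + 1)²`, the sum `a + b` is determined by the code, and then so
is `a`. -/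
theorem pr_inj {a b a' b' : M} : pr a b = pr a' b' ↔ a = a' ∧ b = b' := by
  refine ⟨fun h => ?_, fun ⟨h, h'⟩ => by rw [h, h']⟩
  have key : ∀ {a b a' b' : M}, pr a b = pr a' b' → a + b ≤ a' + b' := by
    intro a b a' b' h
    by_contra hlt
    obtain ⟨c, hc⟩ := le_iff_exists_add.1 (add_one_le_iff'.2 (not_le.1 hlt))
    have : pr a b = pr a' b' + (a' + 2 * b' + 2 * c + c * c + 2 * (c * a') + 2 * (c * b') + a + 1) := by
      simp only [pr, hc]
      ring
    exact ne_add_add_one _ _ (h.symm.trans this)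
  have e := le_antisymm (key h) (key h.symm)
  simp only [pr, e] at h
  grind

theorem le_pr_left (a b : M) : a ≤ pr a b := le_add_self

theorem le_pr_right (a b : M) : b ≤ pr a b := by
  rcases eq_or_ne b 0 with rfl | hb
  · exact zero_le
  · have : 0 < a + b := lt_of_lt_of_le (pos_iff_ne_zero.2 hb) le_add_self
    calc b ≤ a + b := le_add_self
      _ ≤ (a + b) * (a + b) := le_mul_of_pos this
      _ ≤ _ := le_self_add

theorem pr_le_pr {a b a' b' : M} (h : a ≤ a') (h' : b ≤ b') : pr a b ≤ pr a' b' := by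
  unfold pr
  gcongr

instance {n : ℕ} {s t : (Fin n → M) → M} [IsTF s] [IsTF t] : IsTF fun v => pr (s v) (t v) :=
  (inferInstance : IsTF fun v => (s v + t v) * (s v + t v) + s v)

theorem isPow2_iff {p : M} : IsPow2 p ↔ 0 < p ∧ ∀ d, d < p + 1 → d ∣ p → d = 1 ∨ 2 ∣ d := by
  refine and_congr_right fun hp => ⟨fun h d _ => h d, fun h d hd => h d ?_ hd⟩
  obtain ⟨c, rfl⟩ := hd
  exact lt_add_one_iff'.2 (le_mul_of_pos (pos_of_mul_pos_right hp zero_le))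

instance {n : ℕ} {t : (Fin n → M) → M} [IsTF t] : IsD0 S fun v => IsPow2 (t v) :=
  (inferInstance : IsD0 S fun v => 0 < t v ∧ ∀ d, d < t v + 1 → d ∣ t v → d = 1 ∨ 2 ∣ d).congr
    fun _ => isPow2_iff

theorem isPrefix_iff {σ τ : M} : IsPrefix σ τ ↔
    0 < σ ∧ ∃ p, p < τ + 1 ∧ ∃ r, r < τ + 1 ∧ IsPow2 p ∧ r < p ∧ τ = σ * p + r := by
  refine and_congr_right fun hσ => ⟨?_, ?_⟩
  · rintro ⟨p, r, hp, hr, rfl⟩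
    refine ⟨p, lt_add_one_iff'.2 ?_, r, lt_add_one_iff'.2 le_add_self, hp, hr, rfl⟩
    calc p ≤ p * σ := le_mul_of_pos hσ
      _ = σ * p := mul_comm _ _
      _ ≤ _ := le_self_add
  · rintro ⟨p, -, r, -, h⟩
    exact ⟨p, r, h⟩

instance {n : ℕ} {s t : (Fin n → M) → M} [IsTF s] [IsTF t] :
    IsD0 S fun v => IsPrefix (s v) (t v) :=
  (inferInstance : IsD0 S fun v => 0 < s v ∧ ∃ p, p < t v + 1 ∧ ∃ r, r < t v + 1 ∧
    IsPow2 p ∧ r < p ∧ t v = s v * p + r).congr fun _ => isPrefix_iff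

/-! ### Induction -/

theorem ISigma.induction {k : ℕ} (hI : ISigma k S) {p : M → Prop}
    (hp : Sig S k fun v : Fin 1 → M => p (v 0)) (h0 : p 0) (hs : ∀ a, p a → p (a + 1)) (a : M) :
    p a :=
  hI {a | p a} (isSigmaSet_iff.2 hp) h0 hs a

theorem iSigma_iff {k : ℕ} : ISigma k S ↔ ∀ p : M → Prop, Sig S k (fun v : Fin 1 → M => p (v 0)) →
    p 0 → (∀ a, p a → p (a + 1)) → ∀ a, p a :=
  ⟨fun h _ hp => h.induction hp, fun h B hB => h (· ∈ B) (isSigmaSet_iff.1 hB)⟩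

theorem ISigma.zero_of_one (hI : ISigma 1 S) : ISigma 0 S :=
  iSigma_iff.2 fun _ hp => hI.induction (IsD0.isS1 ⟨hp⟩).out

instance [h : Fact (ISigma 1 S)] : Fact (ISigma 0 S) := ⟨h.out.zero_of_one⟩

theorem d0_induction [hI : Fact (ISigma 0 S)] {p : M → Prop}
    (hp : IsD0 S fun v : Fin 1 → M => p (v 0)) (h0 : p 0) (hs : ∀ a, p a → p (a + 1)) (a : M) : p a :=
  hI.out.induction (k := 0) hp.out h0 hs a

theorem s1_induction [hI : Fact (ISigma 1 S)] {p : M → Prop}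
    (hp : IsS1 S fun v : Fin 1 → M => p (v 0)) (h0 : p 0) (hs : ∀ a, p a → p (a + 1)) (a : M) : p a :=
  hI.out.induction hp.out h0 hs a

theorem d0_least [Fact (ISigma 0 S)] {p : M → Prop}
    (hp : IsD0 S fun v : Fin 1 → M => p (v 0)) {a : M} (ha : p a) :
    ∃ b, p b ∧ ∀ c < b, ¬ p c := by
  by_contra! H
  have : ∀ x, ∀ y, y < x + 1 → ¬ p y := by
    have := hp.app
    refine d0_induction (S := S) inferInstance ?_ ?_
    · intro y hy hp
      obtain ⟨c, hc, -⟩ := H y hp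
      rw [lt_add_one_iff'] at hy
      exact absurd (hc.trans_le hy) (not_lt.2 zero_le)
    · intro x ih y hy hp
      obtain ⟨c, hc, hp'⟩ := H y hp
      exact ih c (hc.trans_le (lt_add_one_iff'.1 hy)) hp'
  exact this a a (lt_add_one_iff'.2 le_rfl) ha

theorem d0_strong_induction [Fact (ISigma 0 S)] {p : M → Prop}
    (hp : IsD0 S fun v : Fin 1 → M => p (v 0)) (h : ∀ a, (∀ b < a, p b) → p a) (a : M) : p a := by
  by_contra ha
  obtain ⟨b, hb, hb'⟩ := d0_least (p := fun x => ¬ p x) (S := S) inferInstance ha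
  exact hb (h b fun c hc => not_not.1 (hb' c hc))

/-- `Σ⁰₁` induction on the length `a'` of an initial segment that has a common bound; the premise `x
< a` lets `a'` range over all of `M`. -/
theorem d0_collection [Fact (ISigma 1 S)] {p : M → M → Prop}
    (hp : IsD0 S fun v : Fin 2 → M => p (v 0) (v 1)) {a : M} (h : ∀ x < a, ∃ y, p x y) :
    ∃ b, ∀ x < a, ∃ y, y < b ∧ p x y := by
  have key : ∀ a', ∃ b, ∀ x, x < a' → x < a → ∃ y, y < b ∧ p x y := by
    have := hp.app₂
    refine s1_induction (S := S) (IsD0.ex inferInstance) ⟨0, fun x hx => absurd hx (not_lt.2 zero_le)⟩ ?_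
    rintro c ⟨b, hb⟩
    by_cases hc : c < a
    · obtain ⟨y, hy⟩ := h c hc
      refine ⟨b + (y + 1), fun x hx hxa => ?_⟩
      rcases (lt_add_one_iff'.1 hx).lt_or_eq with hx | rfl
      · obtain ⟨y', hy', hp⟩ := hb x hx hxa
        exact ⟨y', hy'.trans_le le_self_add, hp⟩
      · exact ⟨y, lt_of_lt_of_le (lt_add_one_iff'.2 le_rfl) le_add_self, hy⟩
    · exact ⟨b, fun x hx hxa => hb x (lt_of_lt_of_le hxa (not_lt.1 hc)) hxa⟩
  obtain ⟨b, hb⟩ := key a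
  exact ⟨b, fun x hx => hb x hx hx⟩

/-! ### Closure of `Σ⁰₁` under `IΣ⁰₁` -/

section

variable {n n' : ℕ} {t : (Fin n → M) → M} {R R' : (Fin n → M) → Prop}

instance (priority := 20) [IsD0 S R] : IsS1 S R := IsD0.isS1 inferInstance

/-- Two existential quantifiers are merged by one common bound `b` for both witnesses. -/
instance {R : (Fin n → M) → M → Prop}
    [h : IsS1 S fun w : Fin (n + 1) → M => R (fun i => w i.succ) (w 0)] :
    IsS1 S fun v => ∃ a, R v a := by
  obtain ⟨R', h, e⟩ := isS1_iff.1 h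
  have := h.app
  refine (IsD0.ex inferInstance (R := fun v b => ∃ a, a < b ∧ ∃ c, c < b ∧
    R' (Matrix.vecCons c (Matrix.vecCons a v)))).congr fun v => ⟨?_, ?_⟩
  · rintro ⟨a, ha⟩
    obtain ⟨c, hc⟩ := (e (Matrix.vecCons a v)).1 (by simpa using ha)
    exact ⟨a + c + 1, a, lt_add_one_iff'.2 le_self_add, c, lt_add_one_iff'.2 le_add_self, hc⟩
  · rintro ⟨b, a, -, c, -, h⟩
    exact ⟨a, by simpa using (e (Matrix.vecCons a v)).2 ⟨c, h⟩⟩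

instance [h : IsS1 S R] [h' : IsS1 S R'] : IsS1 S fun v => R v ∧ R' v := by
  obtain ⟨R₁, h, e⟩ := isS1_iff.1 h
  obtain ⟨R₂, h', e'⟩ := isS1_iff.1 h'
  have := h.app
  have := h'.app
  exact (inferInstance : IsS1 S fun v => ∃ a b, R₁ (Matrix.vecCons a v) ∧
    R₂ (Matrix.vecCons b v)).congr fun v => by simp [e, e']

instance [h : IsS1 S R] [h' : IsS1 S R'] : IsS1 S fun v => R v ∨ R' v := by
  obtain ⟨R₁, h, e⟩ := isS1_iff.1 h
  obtain ⟨R₂, h', e'⟩ := isS1_iff.1 h'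
  have := h.app
  have := h'.app
  exact (inferInstance : IsS1 S fun v => ∃ a, R₁ (Matrix.vecCons a v) ∨
    R₂ (Matrix.vecCons a v)).congr fun v => by simp [e, e', exists_or]

instance [h : IsS1 S fun v => ¬ R v] [h' : IsS1 S R'] : IsS1 S fun v => R v → R' v :=
  (inferInstance : IsS1 S fun v => ¬ R v ∨ R' v).congr fun _ => imp_iff_not_or

/-- Collection pulls the unbounded witness in front of the bounded quantifier. Among these closure
properties only this one needs `IΣ⁰₁`. -/
instance {R : (Fin n → M) → M → Prop} [Fact (ISigma 1 S)] [IsTF t]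
    [h : IsS1 S fun w : Fin (n + 1) → M => R (fun i => w i.succ) (w 0)] :
    IsS1 S fun v => ∀ a, a < t v → R v a := by
  obtain ⟨R', h, e⟩ := isS1_iff.1 h
  have := h.app
  refine (IsD0.ex (inferInstance) (R := fun v b => ∀ a, a < t v → ∃ c, c < b ∧
    R' (Matrix.vecCons c (Matrix.vecCons a v)))).congr fun v => ⟨fun H => ?_, ?_⟩
  · refine d0_collection (S := S) (p := fun a c => R' (Matrix.vecCons c (Matrix.vecCons a v)))
      ⟨h.compTF (Fin.cases (.var 1) (Fin.cases (.var 0) fun i => .const (v i)))⟩ fun a ha => ?_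
    exact (e (Matrix.vecCons a v)).1 (by simpa using H a ha)
  · rintro ⟨b, hb⟩ a ha
    obtain ⟨c, -, hc⟩ := hb a ha
    exact by simpa using (e (Matrix.vecCons a v)).2 ⟨c, hc⟩

end

/-- If there is no least element, "no `y ≤ x` satisfies `p`" is inductive, and it is `Σ⁰₁` by
closure under bounded quantification. -/
theorem pi1_least [Fact (ISigma 1 S)] {p : M → Prop}
    (hp : IsS1 S fun v : Fin 1 → M => ¬ p (v 0)) {a : M} (ha : p a) :
    ∃ b, p b ∧ ∀ c < b, ¬ p c := by
  by_contra! H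
  have : ∀ x, ∀ y, y < x + 1 → ¬ p y := by
    have := hp.app (p := fun x => ¬ p x)
    refine s1_induction (S := S) inferInstance ?_ ?_
    · intro y hy hp
      obtain ⟨c, hc, -⟩ := H y hp
      rw [lt_add_one_iff'] at hy
      exact absurd (hc.trans_le hy) (not_lt.2 zero_le)
    · intro x ih y hy hp
      obtain ⟨c, hc, hp'⟩ := H y hp
      exact ih c (hc.trans_le (lt_add_one_iff'.1 hy)) hp'
  exact this a a (lt_add_one_iff'.2 le_rfl) ha

end

section

variable {M : Type u} [PMinus M]

theorem ISigma.anti {k : ℕ} {S S' : Set (Set M)} (hS : S ⊆ S') (h : ISigma k S') : ISigma k S :=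
  iSigma_iff.2 fun _ hp => h.induction (hp.mono hS)

variable (M) in
/-- Induction for bounded formulas without set parameters. -/
class IDelta0 : Prop where
  out : ISigma 0 (∅ : Set (Set M))

theorem ISigma.iDelta0 {S : Set (Set M)} (h : ISigma 0 S) : IDelta0 M :=
  ⟨h.anti (Set.empty_subset _)⟩

instance [h : IDelta0 M] : Fact (ISigma 0 (∅ : Set (Set M))) := ⟨h.out⟩

/-! ### Division and powers of two -/

theorem not_two_dvd_add_one (k : M) : ¬ 2 ∣ 2 * k + 1 := by
  intro h
  obtain ⟨c, hc⟩ := dvd_of_dvd_add ⟨k, rfl⟩ h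
  rcases eq_zero_or_succ c with rfl | ⟨c, rfl⟩
  · simp at hc
  · refine ne_add_add_one 1 (2 * c) (hc.trans ?_)
    ring

theorem two_pos' : (0 : M) < 2 := two_pos

theorem lt_two_iff {r : M} : r < 2 ↔ r = 0 ∨ r = 1 := by
  rw [← one_add_one_eq_two, lt_add_one_iff']
  constructor
  · intro h
    rcases eq_zero_or_succ r with rfl | ⟨c, rfl⟩
    · exact .inl rfl
    · right
      have : c = 0 := by simpa using h
      simp [this]
  · rintro (rfl | rfl) <;> simp

theorem eq_one_of_dvd_one {d : M} (h : d ∣ 1) : d = 1 := by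
  obtain ⟨c, hc⟩ := h
  have hd : 0 < d := pos_iff_ne_zero.2 fun h => by simp [h] at hc
  have hc' : 0 < c := pos_iff_ne_zero.2 fun h => by simp [h] at hc
  exact le_antisymm (hc ▸ le_mul_of_pos hc') (PMinus.one_le_of_pos _ hd)

theorem isPow2_one : IsPow2 (1 : M) := ⟨zero_lt_one, fun _ hd => .inl (eq_one_of_dvd_one hd)⟩

theorem IsPow2.eq_one_or {p : M} (hp : IsPow2 p) : p = 1 ∨ ∃ q, IsPow2 q ∧ p = 2 * q := by
  refine (hp.2 p dvd_rfl).imp_right ?_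
  rintro ⟨q, rfl⟩
  exact ⟨q, ⟨pos_of_mul_pos_right hp.1 zero_le, fun d hd => hp.2 d (hd.mul_left 2)⟩, rfl⟩

theorem IsPow2.of_dvd {p q : M} (hp : IsPow2 p) (h : q ∣ p) : IsPow2 q := by
  refine ⟨pos_iff_ne_zero.2 ?_, fun d hd => hp.2 d (hd.trans h)⟩
  rintro rfl
  exact hp.1.ne' (zero_dvd_iff.1 h)

variable [IDelta0 M]

theorem exists_div_mod (x : M) {b : M} (hb : 0 < b) : ∃ q r, r < b ∧ x = b * q + r := by
  suffices ∃ q, q < x + 1 ∧ ∃ r, r < b ∧ x = b * q + r by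
    obtain ⟨q, -, r, h⟩ := this
    exact ⟨q, r, h⟩
  refine d0_induction (S := ∅) (p := fun x => ∃ q, q < x + 1 ∧ ∃ r, r < b ∧ x = b * q + r)
    inferInstance ⟨0, by simp, 0, hb, by simp⟩ ?_ x
  rintro a ⟨q, hq, r, hr, h⟩
  rcases (add_one_le_iff'.2 hr).lt_or_eq with hr' | hr'
  · exact ⟨q, hq.trans (lt_add_one_iff'.2 le_rfl), r + 1, hr', by rw [h, add_assoc]⟩
  · exact ⟨q + 1, by gcongr, 0, hb, by rw [h, ← hr']; ring⟩

theorem eq_two_mul_or (x : M) : ∃ q, x = 2 * q ∨ x = 2 * q + 1 := by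
  obtain ⟨q, r, hr, h⟩ := exists_div_mod x two_pos'
  refine ⟨q, ?_⟩
  rcases lt_two_iff.1 hr with rfl | rfl <;> simp [h]

/-- The cofactor `c` in `2 * y = d * c` must be even, because a product of odd numbers is odd. -/
theorem dvd_of_odd_dvd_two_mul {d y : M} (hd : ¬ 2 ∣ d) (h : d ∣ 2 * y) : d ∣ y := by
  obtain ⟨c, hc⟩ := h
  obtain ⟨b, rfl | rfl⟩ := eq_two_mul_or c
  · exact ⟨b, mul_left_cancel₀ (two_ne_zero (α := M)) (by rw [hc]; ring)⟩
  · obtain ⟨a, rfl | rfl⟩ := eq_two_mul_or d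
    · exact absurd ⟨a, rfl⟩ hd
    · refine absurd ⟨y, ?_⟩ (not_two_dvd_add_one (2 * a * b + a + b))
      rw [hc]
      ring

theorem IsPow2.dvd_of_odd_dvd_mul {d p x : M} (hp : IsPow2 p) (hd : ¬ 2 ∣ d) (h : d ∣ p * x) :
    d ∣ x := by
  refine d0_strong_induction (S := ∅) (p := fun p => IsPow2 p → d ∣ p * x → d ∣ x)
    inferInstance ?_ p hp h
  intro p ih hp h
  rcases hp.eq_one_or with rfl | ⟨q, hq, rfl⟩
  · simpa using h
  · refine ih q ?_ hq (dvd_of_odd_dvd_two_mul hd (by rwa [← mul_assoc]))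
    simpa [two_mul] using hq.1

theorem IsPow2.mul {p q : M} (hp : IsPow2 p) (hq : IsPow2 q) : IsPow2 (p * q) := by
  refine ⟨mul_pos hp.1 hq.1, fun d hd => ?_⟩
  by_cases h : 2 ∣ d
  · exact .inr h
  · exact hq.2 d (hp.dvd_of_odd_dvd_mul h hd)

theorem isPow2_two : IsPow2 (2 : M) := by
  refine ⟨two_pos', fun d hd => or_iff_not_imp_right.2 fun h => ?_⟩
  exact eq_one_of_dvd_one (dvd_of_odd_dvd_two_mul h (by simpa using hd))

/-- Both powers are halved simultaneously until the smaller one is `1`. -/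
theorem IsPow2.dvd_of_le {p q : M} (hp : IsPow2 p) (hq : IsPow2 q) (h : p ≤ q) : p ∣ q := by
  refine d0_strong_induction (S := ∅)
    -- The second power changes during the induction; bounding it by `q + 1` keeps the formula
    -- `Σ⁰₀`.
    (p := fun p => ∀ q', q' < q + 1 → IsPow2 p → IsPow2 q' → p ≤ q' → p ∣ q') inferInstance ?_ p q
    (lt_add_one_iff'.2 le_rfl) hp hq h
  intro p ih q' hq' hp hpow h
  rcases hp.eq_one_or with rfl | ⟨r, hr, rfl⟩
  · exact one_dvd _
  · rcases hpow.eq_one_or with rfl | ⟨s, hs, rfl⟩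
    · exact absurd (h.trans_lt (by simp : (1 : M) < 2)) (not_lt.2 (le_mul_of_pos hr.1))
    · have hrs : r ≤ s := le_of_mul_le_mul_left h two_pos'
      refine mul_dvd_mul_left 2 (ih r ?_ s ?_ hr hs hrs)
      · simpa [two_mul] using hr.1
      · refine lt_of_le_of_lt ?_ hq'
        simp [two_mul]

/-! ### Strings -/

omit [IDelta0 M] in
theorem IsPrefix.refl {σ : M} (h : 0 < σ) : IsPrefix σ σ :=
  ⟨h, 1, 0, isPow2_one, zero_lt_one, by simp⟩

omit [IDelta0 M] in
theorem IsPrefix.le {σ τ : M} (h : IsPrefix σ τ) : σ ≤ τ := by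
  obtain ⟨_, p, r, hp, _, rfl⟩ := h
  exact (le_mul_of_pos hp.1).trans le_self_add

theorem IsPrefix.trans {σ τ ρ : M} (h : IsPrefix σ τ) (h' : IsPrefix τ ρ) : IsPrefix σ ρ := by
  obtain ⟨hσ, p, r, hp, hr, rfl⟩ := h
  obtain ⟨_, q, s, hq, hs, rfl⟩ := h'
  refine ⟨hσ, p * q, r * q + s, hp.mul hq, ?_, by ring⟩
  calc r * q + s < r * q + q := by gcongr
    _ = (r + 1) * q := by ring
    _ ≤ p * q := mul_le_mul_left (add_one_le_iff'.2 hr) q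

/-- The larger cut-off power is `p' = p * k`. Dividing the remainder `r'` by `p` exposes the bits by
which the longer prefix extends the shorter one. -/
theorem IsPrefix.comparable {σ σ' τ : M} (h : IsPrefix σ τ) (h' : IsPrefix σ' τ) :
    IsPrefix σ σ' ∨ IsPrefix σ' σ := by
  have key : ∀ {σ σ' p p' r r' : M}, 0 < σ' → IsPow2 p → IsPow2 p' → r < p → r' < p' →
      σ * p + r = σ' * p' + r' → p ≤ p' → IsPrefix σ' σ := by
    intro σ σ' p p' r r' hσ' hp hp' hr hr' e hpp
    obtain ⟨k, rfl⟩ := hp.dvd_of_le hp' hpp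
    have hk := hp'.of_dvd (Dvd.intro_left p rfl)
    obtain ⟨a, b, hb, rfl⟩ := exists_div_mod r' hp.1
    have ha : a < k := by
      by_contra hka
      exact absurd (mul_le_mul_right (not_lt.1 hka) p) (not_le.2 (le_self_add.trans_lt hr'))
    refine ⟨hσ', k, a, hk, ha, ?_⟩
    have e' : σ * p + r = (σ' * k + a) * p + b := by rw [e]; ring
    have lt : ∀ {x y r b : M}, b < p → x * p + r = y * p + b → x ≤ y := by
      intro x y r b hb e
      by_contra hxy
      have := mul_le_mul_left (add_one_le_iff'.2 (not_le.1 hxy)) p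
      have h1 : x * p ≤ y * p + b := e ▸ le_self_add
      have h2 : y * p + b < (y + 1) * p := by
        rw [add_mul, one_mul]
        gcongr
      exact absurd (this.trans h1) (not_le.2 h2)
    exact le_antisymm (lt hb e') (lt hr e'.symm)
  obtain ⟨hσ, p, r, hp, hr, e⟩ := h
  obtain ⟨hσ', p', r', hp', hr', e'⟩ := h'
  rcases le_total p p' with hpp | hpp
  · exact .inr (key hσ' hp hp' hr hr' (e.symm.trans e') hpp)
  · exact .inl (key hσ hp' hp hr' hr (e'.symm.trans e) hpp)

theorem IsPrefix.of_le {σ σ' τ : M} (h : IsPrefix σ τ) (h' : IsPrefix σ' τ) (hle : σ ≤ σ') :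
    IsPrefix σ σ' := by
  rcases h.comparable h' with h | h''
  · exact h
  · rw [le_antisymm hle h''.le] at h ⊢
    exact .refl h'.1

/-- The least prefix `≥ b` works: dropping its last bit gives a number below `b`. The intervals `[b,
2b)` thus play the role of levels of the tree, with no need for lengths or exponentiation. -/
theorem exists_prefix_lt {b τ : M} (hb : 0 < b) (h : b ≤ τ) :
    ∃ σ, IsPrefix σ τ ∧ b ≤ σ ∧ σ < 2 * b := by
  have hτ := hb.trans_le h
  obtain ⟨σ, ⟨hσ, hbσ⟩, hmin⟩ := d0_least (S := ∅) (p := fun σ => IsPrefix σ τ ∧ b ≤ σ) inferInstance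
    ⟨.refl hτ, h⟩
  refine ⟨σ, hσ, hbσ, ?_⟩
  obtain ⟨ρ, hρ⟩ := eq_two_mul_or σ
  have hle : σ ≤ 2 * ρ + 1 := by
    rcases hρ with rfl | rfl
    · exact le_self_add
    · exact le_rfl
  rcases eq_or_ne ρ 0 with rfl | h0
  · refine (hle.trans ?_).trans_lt (lt_of_lt_of_le (by simp : (1 : M) < 2) (le_mul_of_pos hb))
    simp
  · have hpos := pos_iff_ne_zero.2 h0
    have hpre : IsPrefix ρ σ := by
      rcases hρ with rfl | rfl
      · exact ⟨hpos, 2, 0, isPow2_two, two_pos', by ring⟩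
      · exact ⟨hpos, 2, 1, isPow2_two, by simp, by ring⟩
    have hlt : ρ < σ := lt_of_lt_of_le (by simpa [two_mul] using hpos)
      (show 2 * ρ ≤ σ by rcases hρ with rfl | rfl <;> simp)
    have hρb : ρ < b := by
      by_contra hcon
      exact hmin ρ hlt ⟨hpre.trans hσ, not_lt.1 hcon⟩
    refine hle.trans_lt ?_
    calc 2 * ρ + 1 < 2 * ρ + 1 + 1 := lt_add_one_iff'.2 le_rfl
      _ = 2 * (ρ + 1) := by ring
      _ ≤ 2 * b := mul_le_mul_right (add_one_le_iff'.2 hρb) 2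

end

/-! ### Coded sets -/

section

variable {M : Type u} [PMinus M]

/-- `x` is an element of the finite set coded by `s`. -/
def Elem (x s : M) : Prop :=
  ∃ a, a < s + 1 ∧ ∃ c, c < s + 1 ∧ ∃ d, d < s + 1 ∧ s = pr a (pr c d) ∧ x < a ∧ (x + 1) * d + 1 ∣ c

theorem elem_pr {x a c d : M} : Elem x (pr a (pr c d)) ↔ x < a ∧ (x + 1) * d + 1 ∣ c := by
  constructor
  · rintro ⟨a', -, c', -, d', -, e, h⟩
    obtain ⟨ha, e⟩ := pr_inj.1 e
    obtain ⟨hc, hd⟩ := pr_inj.1 e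
    rwa [ha, hc, hd]
  · intro h
    exact ⟨a, lt_add_one_iff'.2 (le_pr_left _ _), c,
      lt_add_one_iff'.2 ((le_pr_left _ _).trans (le_pr_right _ _)), d,
      lt_add_one_iff'.2 ((le_pr_right _ _).trans (le_pr_right _ _)), rfl, h⟩

theorem Elem.lt {x s : M} (h : Elem x s) : x < s := by
  obtain ⟨a, ha, -, -, -, -, -, h, -⟩ := h
  exact h.trans_le (lt_add_one_iff'.1 ha)

variable {S : Set (Set M)}

instance {n : ℕ} {s t : (Fin n → M) → M} [IsTF s] [IsTF t] : IsD0 S fun v => Elem (s v) (t v) := by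
  unfold Elem
  infer_instance

theorem exists_common_multiple [Fact (ISigma 1 S)] {t : M → M} (ht : IsTF fun v : Fin 1 → M => t (v 0))
    (h : ∀ x, 0 < t x) (a : M) : ∃ c, 0 < c ∧ ∀ x, x < a → t x ∣ c := by
  have : ∀ ⦃n : ℕ⦄ (s : (Fin n → M) → M) [IsTF s], IsTF fun v => t (s v) := fun n s _ =>
    ⟨ht.out.compTF (g := fun v _ => s v) fun _ => IsTF.out⟩
  refine s1_induction (S := S) (p := fun a => ∃ c, 0 < c ∧ ∀ x, x < a → t x ∣ c) inferInstance
    ⟨1, zero_lt_one, fun x hx => absurd hx (not_lt.2 zero_le)⟩ ?_ a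
  rintro a ⟨c, hc, hd⟩
  refine ⟨c * t a, mul_pos hc (h a), fun x hx => ?_⟩
  rcases (lt_add_one_iff'.1 hx).lt_or_eq with hx | rfl
  · exact (hd x hx).mul_right _
  · exact dvd_mul_left _ _

/-- Coprimality of the Gödel moduli, in the form used for cancellation. Their difference is `k * d`
with `k ∣ d`, and `(x + 1) * d` is `-1` modulo the first modulus, so the factors `d` and `k` can be
removed in turn. -/
theorem modulus_dvd {a d x y c : M} (hd : ∀ k, 0 < k → k < a → k ∣ d) (hx : x < a) (hy : y < a)
    (hxy : x ≠ y) (h : (x + 1) * d + 1 ∣ ((y + 1) * d + 1) * c) : (x + 1) * d + 1 ∣ c := by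
  have key : ∀ k, 0 < k → k < a → (x + 1) * d + 1 ∣ k * d * c → (x + 1) * d + 1 ∣ c := by
    intro k hk hka h
    have h1 : (x + 1) * d + 1 ∣ k * c := by
      refine dvd_of_dvd_add (h.mul_left (x + 1)) (Dvd.intro (k * c) ?_)
      ring
    obtain ⟨l, rfl⟩ := hd k hk hka
    refine dvd_of_dvd_add (h1.mul_left ((x + 1) * l)) (Dvd.intro c ?_)
    ring
  rcases lt_or_gt_of_ne hxy with hlt | hlt
  · obtain ⟨k, rfl⟩ := le_iff_exists_add.1 hlt.le
    refine key k (pos_iff_ne_zero.2 ?_) (le_add_self.trans_lt hy) ?_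
    · rintro rfl
      simp at hxy
    · refine dvd_of_dvd_add (dvd_mul_right _ c) (h.trans (dvd_of_eq ?_))
      ring
  · obtain ⟨k, rfl⟩ := le_iff_exists_add.1 hlt.le
    refine key k (pos_iff_ne_zero.2 ?_) (le_add_self.trans_lt hx) ?_
    · rintro rfl
      simp at hxy
    · refine dvd_of_dvd_add h (Dvd.intro c ?_)
      ring

/-- Bounded `Σ⁰₁` comprehension, with a bound for the codes. -/
theorem exists_code_lt [Fact (ISigma 1 S)] (a : M) : ∃ b, ∀ p : M → Prop,
    IsS1 S (fun v : Fin 1 → M => p (v 0)) → ∃ s, s < b ∧ ∀ x, Elem x s ↔ x < a ∧ p x := by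
  obtain ⟨d, hd, hdvd⟩ := exists_common_multiple (S := S) (t := fun x : M => x + 1) inferInstance
    (fun x => lt_of_lt_of_le zero_lt_one le_add_self) a
  have hdvd : ∀ k, 0 < k → k < a → k ∣ d := by
    intro k hk hka
    rcases eq_zero_or_succ k with rfl | ⟨k, rfl⟩
    · exact absurd hk (lt_irrefl _)
    · exact hdvd k ((lt_add_one_iff'.2 le_rfl).trans hka)
  -- `C` is a multiple of all moduli below `a`. It bounds the codes of all `p` at once.
  obtain ⟨C, hC, hmul⟩ := exists_common_multiple (S := S) (t := fun x : M => (x + 1) * d + 1)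
    inferInstance (fun x => lt_of_lt_of_le zero_lt_one le_add_self) a
  refine ⟨pr a (pr C d) + 1, fun p hp => ?_⟩
  have := hp.app
  -- `c` is the least positive multiple of the moduli of the elements of `p`. If the modulus of a
  -- non-element divided `c`, cancelling it would leave a smaller such multiple by `modulus_dvd`.
  obtain ⟨c, ⟨hc, hcp⟩, hmin⟩ := pi1_least (S := S)
    (p := fun c => 0 < c ∧ ∀ x, x < a → p x → (x + 1) * d + 1 ∣ c) (a := C)
    ((inferInstance : IsS1 S fun v : Fin 1 → M =>
      v 0 ≤ 0 ∨ ∃ x, x < a ∧ p x ∧ ¬ (x + 1) * d + 1 ∣ v 0).congr fun v => by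
        simp only [not_and_or, not_forall, not_lt, exists_prop]) ⟨hC, fun x hx _ => hmul x hx⟩
  refine ⟨pr a (pr c d), lt_add_one_iff'.2 (pr_le_pr le_rfl (pr_le_pr ?_ le_rfl)), fun x => ?_⟩
  · by_contra hlt
    exact hmin C (not_le.1 hlt) ⟨hC, fun x hx _ => hmul x hx⟩
  · rw [elem_pr]
    refine and_congr_right fun hx => ⟨fun hdiv => ?_, fun h => hcp x hx h⟩
    by_contra hpx
    obtain ⟨c', rfl⟩ := hdiv
    have hc' : 0 < c' := pos_of_mul_pos_right hc zero_le
    refine hmin c' ?_ ⟨hc', fun y hy hpy => ?_⟩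
    · have : 0 < (x + 1) * d * c' := mul_pos (mul_pos (lt_of_lt_of_le zero_lt_one le_add_self) hd) hc'
      rw [add_mul, one_mul]
      exact lt_add_of_pos_left _ this
    · exact modulus_dvd hdvd hy hx (fun h => hpx (h ▸ hpy)) (hcp y hy hpy)

theorem exists_code [Fact (ISigma 1 S)] (a : M) {p : M → Prop}
    (hp : IsS1 S fun v : Fin 1 → M => p (v 0)) : ∃ s, ∀ x, Elem x s ↔ x < a ∧ p x := by
  obtain ⟨b, hb⟩ := exists_code_lt (S := S) a
  obtain ⟨s, -, hs⟩ := hb p hp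
  exact ⟨s, hs⟩

end

/-! ### Forcing with subtrees -/

section

variable {M : Type u} [PMinus M]

/-- An infinite tree `T` and a sequence `E j` of properties of strings that persist under
end-extension, all of them bounded relative to `S`. -/
structure TreeForcing (S : Set (Set M)) (T : M → Prop) (E : M → M → Prop) : Prop where
  isD0_tree : IsD0 S fun v : Fin 1 → M => T (v 0)
  closed : ∀ {σ τ}, T τ → IsPrefix σ τ → T σ
  unbounded : ∀ b, ∃ τ, b ≤ τ ∧ T τ
  isD0_prop : IsD0 S fun v : Fin 2 → M => E (v 0) (v 1)
  mono : ∀ {j σ τ}, E j σ → IsPrefix σ τ → E j τ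

/-- The strings of `T` that have none of the properties `E k`, where `k < e` and `F k`. -/
def Cond (T : M → Prop) (E : M → M → Prop) (F : M → Prop) (e τ : M) : Prop :=
  T τ ∧ ∀ k, k < e → F k → ¬ E k τ

/-- From `b` on, the strings of `T` avoiding `E k` for all `k < j` in `s` have the property `E j`. -/
def ForcedFrom (T : M → Prop) (E : M → M → Prop) (s j b : M) : Prop :=
  0 < b ∧ ∀ τ, τ < 2 * b → b ≤ τ → T τ → (∀ k, k < j → Elem k s → ¬ E k τ) → E j τ

/-- Below `e`, the set coded by `s` results from the greedy choice. -/
def Correct (T : M → Prop) (E : M → M → Prop) (s e : M) : Prop :=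
  ∀ j, j < e → (Elem j s ↔ ¬ ∃ b, ForcedFrom T E s j b)

/-- The greedy choice of properties to be avoided. -/
def Greedy (T : M → Prop) (E : M → M → Prop) (j : M) : Prop :=
  ∃ s, Correct T E s (j + 1) ∧ Elem j s

namespace TreeForcing

variable {S : Set (Set M)} {T : M → Prop} {E : M → M → Prop}

theorem forcedFrom_congr {s s' j b : M} (h : ∀ k, k < j → (Elem k s ↔ Elem k s')) :
    ForcedFrom T E s j b ↔ ForcedFrom T E s' j b := by
  refine and_congr_right fun _ => forall_congr' fun τ => ?_
  refine imp_congr_right fun _ => imp_congr_right fun _ => imp_congr_right fun _ => ?_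
  refine imp_congr_left (forall_congr' fun k => ?_)
  exact imp_congr_right fun hk => by rw [h k hk]

theorem isD0_forcedFrom (hF : TreeForcing S T E) :
    IsD0 S fun v : Fin 3 → M => ForcedFrom T E (v 0) (v 1) (v 2) := by
  have := hF.isD0_tree.app
  have := hF.isD0_prop.app₂
  unfold ForcedFrom
  infer_instance

/-- All relevant finite sets have codes below one `B`, and those that leave only a bounded part of
the tree form a `Σ⁰₁` set, itself coded by some `h`. With `h` as a parameter the greedy construction
is a bounded induction. -/
theorem exists_alive [Fact (ISigma 1 S)] (hF : TreeForcing S T E) (e : M) :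
    ∃ s, Correct T E s e ∧
      ∀ b, 0 < b → ∃ τ, τ < 2 * b ∧ b ≤ τ ∧ T τ ∧ ∀ k, k < e → Elem k s → ¬ E k τ := by
  have iT := hF.isD0_tree.app
  have iE := hF.isD0_prop.app₂
  obtain ⟨B, hB⟩ := exists_code_lt (S := S) e
  -- A set is dead if, on some interval `[b, 2b)`, no string of `T` avoids all of its properties.
  let dead : M → Prop := fun s => ∃ b, 0 < b ∧ ∀ τ, τ < 2 * b → b ≤ τ → T τ →
    ∃ k, k < e ∧ Elem k s ∧ E k τ
  have idead : IsS1 S fun v : Fin 1 → M => dead (v 0) := by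
    simp only [dead]
    infer_instance
  have dead_congr : ∀ {s s'}, (∀ k, k < e → (Elem k s ↔ Elem k s')) → dead s → dead s' := by
    rintro s s' h ⟨b, hb, H⟩
    refine ⟨b, hb, fun τ h1 h2 h3 => ?_⟩
    obtain ⟨k, hk, hks, hE⟩ := H τ h1 h2 h3
    exact ⟨k, hk, (h k hk).1 hks, hE⟩
  obtain ⟨h, hh⟩ := exists_code B idead
  have hh' : ∀ {s}, s < B → (Elem s h ↔ dead s) := fun hs => by simp [hh, hs]
  -- Stage `i` of the construction: an alive `s ⊆ [0, i)` which contains `j < i` exactly if `(s ∩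
  -- [0, j)) ∪ {j}` is alive.
  let good : M → Prop := fun i => i ≤ e → ∃ s, s < B ∧ ¬ Elem s h ∧ (∀ k, k < s → Elem k s → k < i) ∧
    ∀ j, j < i → (Elem j s ↔ ∃ s', s' < B ∧ ¬ Elem s' h ∧
      ∀ k, k < e → (Elem k s' ↔ (Elem k s ∧ k < j) ∨ k = j))
  have igood : IsD0 S fun v : Fin 1 → M => good (v 0) := by
    simp only [good]
    infer_instance
  have key : good e := by
    refine d0_induction igood ?_ ?_ e
    · intro _
      obtain ⟨s, hs, H⟩ := hB (fun _ => (0 : M) = 1) inferInstance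
      simp only [zero_ne_one, and_false, iff_false] at H
      refine ⟨s, hs, ?_, fun k _ hk => absurd hk (H k), fun j hj => absurd hj (not_lt.2 zero_le)⟩
      rw [hh' hs]
      rintro ⟨b, hb, H'⟩
      obtain ⟨τ, hτ, hT⟩ := hF.unbounded b
      have : IDelta0 M := (Fact.out : ISigma 0 S).iDelta0
      obtain ⟨σ, hσ, hbσ, hlt⟩ := exists_prefix_lt hb hτ
      obtain ⟨k, -, hk, -⟩ := H' σ hlt hbσ (hF.closed hT hσ)
      exact H k hk
    · intro i ih hi
      have hie : i < e := add_one_le_iff'.1 hi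
      obtain ⟨s, hs, hsh, hsi, hsj⟩ := ih hie.le
      replace hsi : ∀ k, Elem k s → k < i := fun k hk => hsi k hk.lt hk
      -- The candidate `s ∪ {i}` is kept if it is alive; otherwise `s` stays unchanged.
      obtain ⟨s', hs', H⟩ := hB (fun k => Elem k s ∨ k = i) inferInstance
      have H' : ∀ k, Elem k s' ↔ Elem k s ∨ k = i := by
        intro k
        rw [H, and_iff_right_iff_imp]
        rintro (h | rfl)
        · exact (hsi k h).trans hie
        · exact hie
      by_cases hd : Elem s' h
      · refine ⟨s, hs, hsh, fun k _ hk => (hsi k hk).trans (lt_add_one_iff'.2 le_rfl), fun j hj => ?_⟩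
        rcases (lt_add_one_iff'.1 hj).lt_or_eq with hj | rfl
        · exact hsj j hj
        · refine iff_of_false (fun hj => lt_irrefl _ (hsi j hj)) ?_
          rintro ⟨s'', hs'', hd', hk⟩
          rw [hh' hs''] at hd'
          refine hd' (dead_congr (fun k hke => ?_) ((hh' hs').1 hd))
          rw [hk k hke, H']
          exact or_congr_left ⟨fun h => ⟨h, hsi k h⟩, fun h => h.1⟩
      · refine ⟨s', hs', hd, fun k _ hk => ?_, fun j hj => ?_⟩
        · rcases (H' k).1 hk with hk | rfl
          · exact (hsi k hk).trans (lt_add_one_iff'.2 le_rfl)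
          · exact lt_add_one_iff'.2 le_rfl
        · rcases (lt_add_one_iff'.1 hj).lt_or_eq with hj | rfl
          · rw [H', or_iff_left hj.ne, hsj j hj]
            refine exists_congr fun s'' => and_congr_right fun _ => and_congr_right fun _ => ?_
            refine forall_congr' fun k => imp_congr_right fun _ => ?_
            rw [H']
            refine iff_congr Iff.rfl (or_congr_left (and_congr_left fun hkj => ?_))
            rw [or_iff_left (hkj.trans hj).ne]
          · refine iff_of_true ((H' j).2 (.inr rfl)) ⟨s', hs', hd, fun k hk => ?_⟩
            rw [H']
            constructor
            · rintro (h | rfl)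
              · exact .inl ⟨.inl h, hsi k h⟩
              · exact .inr rfl
            · rintro (⟨h, -⟩ | rfl)
              · exact h
              · exact .inr rfl
  obtain ⟨s, hs, hsh, hsi, hsj⟩ := key le_rfl
  have alive : ∀ {s}, s < B → ¬ Elem s h → ∀ b, 0 < b →
      ∃ τ, τ < 2 * b ∧ b ≤ τ ∧ T τ ∧ ∀ k, k < e → Elem k s → ¬ E k τ := by
    intro s hs hsh b hb
    rw [hh' hs] at hsh
    by_contra! H
    exact hsh ⟨b, hb, H⟩
  refine ⟨s, fun j hj => ?_, alive hs hsh⟩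
  rw [hsj j hj]
  -- For a correct choice below `j`, the set `(s ∩ [0, j)) ∪ {j}` is dead at `b` exactly if `E j` is
  -- forced from `b`.
  constructor
  · rintro ⟨s', hs', hd, H⟩ ⟨b, hb, hforce⟩
    obtain ⟨τ, h1, h2, h3, h4⟩ := alive hs' hd b hb
    refine h4 j hj ((H j hj).2 (.inr rfl)) (hforce τ h1 h2 h3 fun k hk hks => ?_)
    exact h4 k (hk.trans hj) ((H k (hk.trans hj)).2 (.inl ⟨hks, hk⟩))
  · intro hnf
    obtain ⟨s', hs', H⟩ := hB (fun k => (Elem k s ∧ k < j) ∨ k = j) inferInstance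
    refine ⟨s', hs', ?_, fun k hk => by rw [H, and_iff_right hk]⟩
    rw [hh' hs']
    rintro ⟨b, hb, Hd⟩
    refine hnf ⟨b, hb, fun τ h1 h2 h3 h4 => ?_⟩
    obtain ⟨k, hk, hks, hE⟩ := Hd τ h1 h2 h3
    rcases ((H k).1 hks).2 with ⟨hks, hkj⟩ | rfl
    · exact absurd hE (h4 k hkj hks)
    · exact hE

/-- Whether `j` belongs to a correct set depends only on the set below `j`, so correct sets agree by
strong induction. -/
theorem elem_congr [Fact (ISigma 0 S)] {s s' e e' : M} (h : Correct T E s e) (h' : Correct T E s' e')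
    (j : M) : j < e → j < e' → (Elem j s ↔ Elem j s') := by
  refine d0_strong_induction (S := S) (p := fun j => j < e → j < e' → (Elem j s ↔ Elem j s'))
    inferInstance ?_ j
  intro j ih hj hj'
  rw [h j hj, h' j hj']
  refine not_congr (exists_congr fun b => forcedFrom_congr fun k hk => ?_)
  exact ih k hk (hk.trans hj) (hk.trans hj')

theorem elem_iff_greedy [Fact (ISigma 1 S)] (_hF : TreeForcing S T E) {s e j : M}
    (h : Correct T E s e) (hj : j < e) : Elem j s ↔ Greedy T E j := by
  constructor
  · intro hs
    exact ⟨s, fun k hk => h k ((lt_add_one_iff'.1 hk).trans_lt hj), hs⟩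
  · rintro ⟨s', h', hs'⟩
    exact (elem_congr (S := S) h h' j hj (lt_add_one_iff'.2 le_rfl)).2 hs'

/-- Initial segments of `Greedy` are finite sets in the sense of `M`, even though `Greedy` is a
`Σ⁰₂` predicate. This is what preserves `IΣ⁰₁`. -/
theorem exists_code_greedy [Fact (ISigma 1 S)] (hF : TreeForcing S T E) (e : M) :
    ∃ s, ∀ j, Elem j s ↔ j < e ∧ Greedy T E j := by
  obtain ⟨s, hs, -⟩ := hF.exists_alive e
  obtain ⟨s', hs'⟩ := exists_code (S := S) e (p := fun j => Elem j s) inferInstance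
  refine ⟨s', fun j => ?_⟩
  rw [hs']
  exact and_congr_right fun hj => hF.elem_iff_greedy hs hj

theorem exists_cond [Fact (ISigma 1 S)] (hF : TreeForcing S T E) (e b : M) :
    ∃ τ, b ≤ τ ∧ Cond T E (Greedy T E) e τ := by
  obtain ⟨s, hs, H⟩ := hF.exists_alive e
  obtain ⟨τ, -, h1, h2, h3⟩ := H (b + 1) (lt_of_lt_of_le zero_lt_one le_add_self)
  exact ⟨τ, le_self_add.trans h1, h2, fun k hk hD => h3 k hk ((hF.elem_iff_greedy hs hk).2 hD)⟩

theorem exists_forced [Fact (ISigma 1 S)] (hF : TreeForcing S T E) {j : M} (hj : ¬ Greedy T E j) :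
    ∃ b, 0 < b ∧ ∀ τ, τ < 2 * b → b ≤ τ → Cond T E (Greedy T E) j τ → E j τ := by
  obtain ⟨s, hs, -⟩ := hF.exists_alive (j + 1)
  have hlt : j < j + 1 := lt_add_one_iff'.2 le_rfl
  have h1 := (hF.elem_iff_greedy hs hlt).not.2 hj
  rw [hs j hlt, not_not] at h1
  obtain ⟨b, hb, H⟩ := h1
  refine ⟨b, hb, fun τ h1 h2 h3 => H τ h1 h2 h3.1 fun k hk hks => h3.2 k hk ?_⟩
  exact (hF.elem_iff_greedy hs (hk.trans hlt)).1 hks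

/-- The greedy choice is `Σ⁰₂`. -/
theorem greedy_iff [Fact (ISigma 1 S)] (hF : TreeForcing S T E) :
    ∃ θ : M → M → M → M → Prop, IsD0 S (fun v : Fin 4 → M => θ (v 0) (v 1) (v 2) (v 3)) ∧
      ∀ j, Greedy T E j ↔ ∃ s w, ∀ q, θ j s w q := by
  have iF : ∀ ⦃n : ℕ⦄ (s j b : (Fin n → M) → M) [IsTF s] [IsTF j] [IsTF b],
      IsD0 S fun v => ForcedFrom T E (s v) (j v) (b v) := by
    intro n s j b _ _ _
    exact ⟨hF.isD0_forcedFrom.out.compTF (g := fun w => ![s w, j w, b w])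
      (Fin.cases (IsTF.out (t := s)) (Fin.cases (IsTF.out (t := j)) fun i => by
        rw [Subsingleton.elim i 0]; exact IsTF.out (t := b)))⟩
  -- `w` bounds the forcing witnesses of all non-elements of `s` at once, by collection; `q` ranges
  -- over the levels at which an element of `s` might be forced.
  refine ⟨fun j s w q => Elem j s ∧ (∀ i, i < j + 1 → Elem i s → ¬ ForcedFrom T E s i q) ∧
    ∀ i, i < j + 1 → ¬ Elem i s → ∃ b, b < w ∧ ForcedFrom T E s i b, inferInstance, fun j => ?_⟩
  constructor
  · rintro ⟨s, hs, hj⟩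
    have : ∀ i, i < j + 1 → ∃ b, ¬ Elem i s → ForcedFrom T E s i b := by
      intro i hi
      by_cases h : Elem i s
      · exact ⟨0, fun h' => absurd h h'⟩
      · have h' := h
        rw [hs i hi, not_not] at h'
        exact h'.imp fun b hb _ => hb
    obtain ⟨w, hw⟩ := d0_collection (S := S) (p := fun i b => ¬ Elem i s → ForcedFrom T E s i b)
      inferInstance this
    refine ⟨s, w, fun q => ⟨hj, fun i hi his hf => (hs i hi).1 his ⟨q, hf⟩, fun i hi his => ?_⟩⟩
    obtain ⟨b, hb, h⟩ := hw i hi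
    exact ⟨b, hb, h his⟩
  · rintro ⟨s, w, H⟩
    refine ⟨s, fun i hi => ⟨fun his ⟨q, hf⟩ => (H q).2.1 i hi his hf, fun hnf => ?_⟩, (H 0).1⟩
    by_contra his
    obtain ⟨b, -, h⟩ := (H 0).2.2 i hi his
    exact hnf ⟨b, h⟩

end TreeForcing

end

/-! ### A universal `Σ⁰₁` relation -/

section

variable {M : Type u} [PMinus M]

/-- One step of verification: the code `i, f, g` applied to the number `x` is verified from the
set `X` of verified pairs and the oracle `O`. The rules are those for constants, variables, sums,
products, comparisons, the oracle and its complement, conjunctions, disjunctions, quantifiers and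
bounded universal quantifiers. -/
def RuleAt (e : M) (O X : M → Prop) (i f g x : M) : Prop :=
  (i = 0 ∧ ∃ y, y < e ∧ x = pr f y) ∨
  (i = 1 ∧ ∃ y, y < e ∧ ∃ u, u < e ∧ x = pr y (pr y u)) ∨
  (i = 2 ∧ ∃ y, y < e ∧ ∃ a, a < e ∧ ∃ u, u < e ∧ x = pr y (pr a u) ∧ X (pr f (pr y u))) ∨
  (i = 3 ∧ ∃ y, y < e ∧ ∃ z, z < e ∧ ∃ u, u < e ∧ x = pr (y + z) u ∧ X (pr f (pr y u)) ∧
    X (pr g (pr z u))) ∨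
  (i = 4 ∧ ∃ y, y < e ∧ ∃ z, z < e ∧ ∃ u, u < e ∧ x = pr (y * z) u ∧ X (pr f (pr y u)) ∧
    X (pr g (pr z u))) ∨
  (i = 5 ∧ ∃ y, y < e ∧ ∃ z, z < e ∧ y < z ∧ X (pr f (pr y x)) ∧ X (pr g (pr z x))) ∨
  (i = 6 ∧ ∃ y, y < e ∧ O y ∧ X (pr f (pr y x))) ∨
  (i = 7 ∧ ∃ y, y < e ∧ ¬ O y ∧ X (pr f (pr y x))) ∨
  (i = 8 ∧ X (pr f x) ∧ X (pr g x)) ∨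
  (i = 9 ∧ (X (pr f x) ∨ X (pr g x))) ∨
  (i = 10 ∧ ∃ a, a < e ∧ X (pr f (pr a x))) ∨
  (i = 11 ∧ ∃ b, b < e ∧ X (pr f (pr b x)) ∧ ∀ a, a < b → X (pr g (pr a x)))

def Rule (e : M) (O X : M → Prop) (z : M) : Prop :=
  ∃ i, i < e ∧ ∃ f, f < e ∧ ∃ g, g < e ∧ ∃ x, x < e ∧ z = pr (pr i (pr f g)) x ∧
    RuleAt e O X i f g x

/-- `X` occurs only positively, and the oracle is queried only below `e`. -/
theorem RuleAt.mono {e e' : M} {O O' X X' : M → Prop} {i f g x : M} (he : e ≤ e')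
    (hO : ∀ y, y < e → (O y ↔ O' y)) (hX : ∀ y, X y → X' y) (h : RuleAt e O X i f g x) :
    RuleAt e' O' X' i f g x := by
  rcases h with ⟨hi, y, hy, h⟩ | ⟨hi, y, hy, u, hu, h⟩ | ⟨hi, y, hy, a, ha, u, hu, h, h'⟩ |
    ⟨hi, y, hy, z, hz, u, hu, h, h', h''⟩ | ⟨hi, y, hy, z, hz, u, hu, h, h', h''⟩ |
    ⟨hi, y, hy, z, hz, h, h', h''⟩ | ⟨hi, y, hy, h, h'⟩ | ⟨hi, y, hy, h, h'⟩ | ⟨hi, h, h'⟩ |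
    ⟨hi, h⟩ | ⟨hi, a, ha, h⟩ | ⟨hi, b, hb, h, h'⟩
  · exact .inl ⟨hi, y, hy.trans_le he, h⟩
  · exact .inr <| .inl ⟨hi, y, hy.trans_le he, u, hu.trans_le he, h⟩
  · exact .inr <| .inr <| .inl
      ⟨hi, y, hy.trans_le he, a, ha.trans_le he, u, hu.trans_le he, h, hX _ h'⟩
  · exact .inr <| .inr <| .inr <| .inl
      ⟨hi, y, hy.trans_le he, z, hz.trans_le he, u, hu.trans_le he, h, hX _ h', hX _ h''⟩
  · exact .inr <| .inr <| .inr <| .inr <| .inl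
      ⟨hi, y, hy.trans_le he, z, hz.trans_le he, u, hu.trans_le he, h, hX _ h', hX _ h''⟩
  · exact .inr <| .inr <| .inr <| .inr <| .inr <| .inl
      ⟨hi, y, hy.trans_le he, z, hz.trans_le he, h, hX _ h', hX _ h''⟩
  · exact .inr <| .inr <| .inr <| .inr <| .inr <| .inr <| .inl
      ⟨hi, y, hy.trans_le he, (hO y hy).1 h, hX _ h'⟩
  · exact .inr <| .inr <| .inr <| .inr <| .inr <| .inr <| .inr <| .inl
      ⟨hi, y, hy.trans_le he, (hO y hy).not.1 h, hX _ h'⟩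
  · exact .inr <| .inr <| .inr <| .inr <| .inr <| .inr <| .inr <| .inr <| .inl ⟨hi, hX _ h, hX _ h'⟩
  · exact .inr <| .inr <| .inr <| .inr <| .inr <| .inr <| .inr <| .inr <| .inr <| .inl
      ⟨hi, h.imp (hX _) (hX _)⟩
  · exact .inr <| .inr <| .inr <| .inr <| .inr <| .inr <| .inr <| .inr <| .inr <| .inr <| .inl
      ⟨hi, a, ha.trans_le he, hX _ h⟩
  · exact .inr <| .inr <| .inr <| .inr <| .inr <| .inr <| .inr <| .inr <| .inr <| .inr <| .inr
      ⟨hi, b, hb.trans_le he, hX _ h, fun a ha => hX _ (h' a ha)⟩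

/-- The pairs consulted are built from numbers below `e`, so each application of a rule uses only a
bounded part of `X`. -/
theorem RuleAt.bounded {e : M} {O X : M → Prop} {i f g x : M} (hf : f < e) (hg : g < e) (hx : x < e)
    (h : RuleAt e O X i f g x) :
    RuleAt e O (fun y => y < pr e (pr e e) + 1 ∧ X y) i f g x := by
  have h2 : ∀ {f x}, f < e → x < e → pr f x < pr e (pr e e) + 1 := fun hf hx =>
    lt_add_one_iff'.2 (pr_le_pr hf.le (hx.le.trans (le_pr_left _ _)))
  have h3 : ∀ {f y x}, f < e → y < e → x < e → pr f (pr y x) < pr e (pr e e) + 1 := fun hf hy hx =>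
    lt_add_one_iff'.2 (pr_le_pr hf.le (pr_le_pr hy.le hx.le))
  rcases h with ⟨hi, y, hy, h⟩ | ⟨hi, y, hy, u, hu, h⟩ | ⟨hi, y, hy, a, ha, u, hu, h, h'⟩ |
    ⟨hi, y, hy, z, hz, u, hu, h, h', h''⟩ | ⟨hi, y, hy, z, hz, u, hu, h, h', h''⟩ |
    ⟨hi, y, hy, z, hz, h, h', h''⟩ | ⟨hi, y, hy, h, h'⟩ | ⟨hi, y, hy, h, h'⟩ | ⟨hi, h, h'⟩ |
    ⟨hi, h⟩ | ⟨hi, a, ha, h⟩ | ⟨hi, b, hb, h, h'⟩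
  · exact .inl ⟨hi, y, hy, h⟩
  · exact .inr <| .inl ⟨hi, y, hy, u, hu, h⟩
  · exact .inr <| .inr <| .inl ⟨hi, y, hy, a, ha, u, hu, h, h3 hf hy hu, h'⟩
  · exact .inr <| .inr <| .inr <| .inl
      ⟨hi, y, hy, z, hz, u, hu, h, ⟨h3 hf hy hu, h'⟩, h3 hg hz hu, h''⟩
  · exact .inr <| .inr <| .inr <| .inr <| .inl
      ⟨hi, y, hy, z, hz, u, hu, h, ⟨h3 hf hy hu, h'⟩, h3 hg hz hu, h''⟩
  · exact .inr <| .inr <| .inr <| .inr <| .inr <| .inl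
      ⟨hi, y, hy, z, hz, h, ⟨h3 hf hy hx, h'⟩, h3 hg hz hx, h''⟩
  · exact .inr <| .inr <| .inr <| .inr <| .inr <| .inr <| .inl ⟨hi, y, hy, h, h3 hf hy hx, h'⟩
  · exact .inr <| .inr <| .inr <| .inr <| .inr <| .inr <| .inr <| .inl
      ⟨hi, y, hy, h, h3 hf hy hx, h'⟩
  · exact .inr <| .inr <| .inr <| .inr <| .inr <| .inr <| .inr <| .inr <| .inl
      ⟨hi, ⟨h2 hf hx, h⟩, h2 hg hx, h'⟩
  · exact .inr <| .inr <| .inr <| .inr <| .inr <| .inr <| .inr <| .inr <| .inr <| .inl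
      ⟨hi, h.imp (fun h => ⟨h2 hf hx, h⟩) (fun h => ⟨h2 hg hx, h⟩)⟩
  · exact .inr <| .inr <| .inr <| .inr <| .inr <| .inr <| .inr <| .inr <| .inr <| .inr <| .inl
      ⟨hi, a, ha, h3 hf ha hx, h⟩
  · exact .inr <| .inr <| .inr <| .inr <| .inr <| .inr <| .inr <| .inr <| .inr <| .inr <| .inr
      ⟨hi, b, hb, ⟨h3 hf hb hx, h⟩, fun a ha => ⟨h3 hg (ha.trans hb) hx, h' a ha⟩⟩

theorem Rule.mono {e e' : M} {O O' X X' : M → Prop} {z : M} (he : e ≤ e')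
    (hO : ∀ y, y < e → (O y ↔ O' y)) (hX : ∀ y, X y → X' y) (h : Rule e O X z) :
    Rule e' O' X' z := by
  obtain ⟨i, hi, f, hf, g, hg, x, hx, hz, h⟩ := h
  exact ⟨i, hi.trans_le he, f, hf.trans_le he, g, hg.trans_le he, x, hx.trans_le he, hz,
    h.mono he hO hX⟩

theorem Rule.bounded {e : M} {O X : M → Prop} {z : M} (h : Rule e O X z) :
    Rule e O (fun y => y < pr e (pr e e) + 1 ∧ X y) z := by
  obtain ⟨i, hi, f, hf, g, hg, x, hx, hz, h⟩ := h
  exact ⟨i, hi, f, hf, g, hg, x, hx, hz, h.bounded hf hg hx⟩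

/-- A list of numbers as a number. -/
def code : {n : ℕ} → (Fin n → M) → M
  | 0, _ => 0
  | _ + 1, v => pr (v 0) (code fun i => v i.succ)

theorem isTF_code : ∀ {n k : ℕ} (g : (Fin k → M) → Fin n → M), (∀ i, TF fun v => g v i) →
    TF fun v => code (g v)
  | 0, _, _, _ => .const 0
  | n + 1, k, g, hg => by
    have h0 : IsTF fun v => g v 0 := ⟨hg 0⟩
    have h1 : IsTF fun v => code fun i : Fin n => g v i.succ := ⟨isTF_code _ fun i => hg i.succ⟩
    exact (inferInstance : IsTF fun v => pr (g v 0) (code fun i => g v i.succ)).out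

/-- `U` is closed under the rules, and each of its elements comes from a rule. -/
def IsUniversal (O U : M → Prop) : Prop :=
  ∀ z, U z ↔ ∃ e, Rule e O U z

/-- `R` is a section of `U`. -/
def Rep (U : M → Prop) {n : ℕ} (R : (Fin n → M) → Prop) : Prop :=
  ∃ f, ∀ v, U (pr f (code v)) ↔ R v

theorem exists_gt₃ (a b c : M) : ∃ e, a < e ∧ b < e ∧ c < e :=
  ⟨a + b + c + 1, lt_add_one_iff'.2 (le_self_add.trans le_self_add),
    lt_add_one_iff'.2 (le_add_self.trans le_self_add), lt_add_one_iff'.2 le_add_self⟩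

-- Fixed points of the rules represent all `Σ⁰₁` relations

namespace IsUniversal

variable {O U : M → Prop} {n : ℕ}

theorem iff_ruleAt (hU : IsUniversal O U) (i f g x : M) :
    U (pr (pr i (pr f g)) x) ↔ ∃ e, RuleAt e O U i f g x := by
  rw [hU]
  constructor
  · rintro ⟨e, i', -, f', -, g', -, x', -, h, h'⟩
    obtain ⟨h, hx⟩ := pr_inj.1 h
    obtain ⟨hi, h⟩ := pr_inj.1 h
    obtain ⟨hf, hg⟩ := pr_inj.1 h
    subst hi hf hg hx
    exact ⟨e, h'⟩
  · rintro ⟨e, h⟩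
    obtain ⟨e₁, he, hi, hf⟩ := exists_gt₃ e i f
    obtain ⟨e₂, he₁, hg, hx⟩ := exists_gt₃ e₁ g x
    exact ⟨e₂, i, hi.trans he₁, f, hf.trans he₁, g, hg, x, hx, rfl,
      h.mono (he.trans he₁).le (fun _ _ => Iff.rfl) fun _ => id⟩

theorem const_iff (hU : IsUniversal O U) (f x : M) :
    U (pr (pr 0 (pr f 0)) x) ↔ ∃ y, x = pr f y := by
  rw [hU.iff_ruleAt]
  constructor
  · rintro ⟨e, h⟩
    simp only [RuleAt] at h
    -- Numerals are distinct in `M`, so only the disjunct with the given rule number survives.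
    norm_num at h
    exact h.imp fun _ => And.right
  · rintro ⟨y, h⟩
    obtain ⟨e, h1, -⟩ := exists_gt₃ y y y
    exact ⟨e, .inl ⟨rfl, y, h1, h⟩⟩

theorem var_iff (hU : IsUniversal O U) (x : M) :
    U (pr (pr 1 (pr 0 0)) x) ↔ ∃ y u, x = pr y (pr y u) := by
  rw [hU.iff_ruleAt]
  constructor
  · rintro ⟨e, h⟩
    simp only [RuleAt] at h
    norm_num at h
    obtain ⟨y, -, u, -, h⟩ := h
    exact ⟨y, u, h⟩
  · rintro ⟨y, u, h⟩
    obtain ⟨e, h1, h2, -⟩ := exists_gt₃ y u y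
    exact ⟨e, .inr <| .inl ⟨rfl, y, h1, u, h2, h⟩⟩

theorem drop_iff (hU : IsUniversal O U) (f x : M) :
    U (pr (pr 2 (pr f 0)) x) ↔ ∃ y a u, x = pr y (pr a u) ∧ U (pr f (pr y u)) := by
  rw [hU.iff_ruleAt]
  constructor
  · rintro ⟨e, h⟩
    simp only [RuleAt] at h
    norm_num at h
    obtain ⟨y, -, a, -, u, -, h⟩ := h
    exact ⟨y, a, u, h⟩
  · rintro ⟨y, a, u, h⟩
    obtain ⟨e, h1, h2, h3⟩ := exists_gt₃ y a u
    exact ⟨e, .inr <| .inr <| .inl ⟨rfl, y, h1, a, h2, u, h3, h⟩⟩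

theorem add_iff (hU : IsUniversal O U) (f g x : M) :
    U (pr (pr 3 (pr f g)) x) ↔
      ∃ y z u, x = pr (y + z) u ∧ U (pr f (pr y u)) ∧ U (pr g (pr z u)) := by
  rw [hU.iff_ruleAt]
  constructor
  · rintro ⟨e, h⟩
    simp only [RuleAt] at h
    norm_num at h
    obtain ⟨y, -, a, -, u, -, h⟩ := h
    exact ⟨y, a, u, h⟩
  · rintro ⟨y, a, u, h⟩
    obtain ⟨e, h1, h2, h3⟩ := exists_gt₃ y a u
    exact ⟨e, .inr <| .inr <| .inr <| .inl ⟨rfl, y, h1, a, h2, u, h3, h⟩⟩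

theorem mul_iff (hU : IsUniversal O U) (f g x : M) :
    U (pr (pr 4 (pr f g)) x) ↔
      ∃ y z u, x = pr (y * z) u ∧ U (pr f (pr y u)) ∧ U (pr g (pr z u)) := by
  rw [hU.iff_ruleAt]
  constructor
  · rintro ⟨e, h⟩
    simp only [RuleAt] at h
    norm_num at h
    obtain ⟨y, -, a, -, u, -, h⟩ := h
    exact ⟨y, a, u, h⟩
  · rintro ⟨y, a, u, h⟩
    obtain ⟨e, h1, h2, h3⟩ := exists_gt₃ y a u
    exact ⟨e, .inr <| .inr <| .inr <| .inr <| .inl ⟨rfl, y, h1, a, h2, u, h3, h⟩⟩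

theorem lt_iff (hU : IsUniversal O U) (f g x : M) :
    U (pr (pr 5 (pr f g)) x) ↔ ∃ y z, y < z ∧ U (pr f (pr y x)) ∧ U (pr g (pr z x)) := by
  rw [hU.iff_ruleAt]
  constructor
  · rintro ⟨e, h⟩
    simp only [RuleAt] at h
    norm_num at h
    obtain ⟨y, -, z, -, h⟩ := h
    exact ⟨y, z, h⟩
  · rintro ⟨y, z, h⟩
    obtain ⟨e, h1, h2, -⟩ := exists_gt₃ y z y
    exact ⟨e, .inr <| .inr <| .inr <| .inr <| .inr <| .inl ⟨rfl, y, h1, z, h2, h⟩⟩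

theorem oracle_iff (hU : IsUniversal O U) (f x : M) :
    U (pr (pr 6 (pr f 0)) x) ↔ ∃ y, O y ∧ U (pr f (pr y x)) := by
  rw [hU.iff_ruleAt]
  constructor
  · rintro ⟨e, h⟩
    simp only [RuleAt] at h
    norm_num at h
    exact h.imp fun _ => And.right
  · rintro ⟨y, h⟩
    obtain ⟨e, h1, -⟩ := exists_gt₃ y y y
    exact ⟨e, .inr <| .inr <| .inr <| .inr <| .inr <| .inr <| .inl ⟨rfl, y, h1, h⟩⟩

theorem not_oracle_iff (hU : IsUniversal O U) (f x : M) :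
    U (pr (pr 7 (pr f 0)) x) ↔ ∃ y, ¬ O y ∧ U (pr f (pr y x)) := by
  rw [hU.iff_ruleAt]
  constructor
  · rintro ⟨e, h⟩
    simp only [RuleAt] at h
    norm_num at h
    exact h.imp fun _ => And.right
  · rintro ⟨y, h⟩
    obtain ⟨e, h1, -⟩ := exists_gt₃ y y y
    exact ⟨e, .inr <| .inr <| .inr <| .inr <| .inr <| .inr <| .inr <| .inl ⟨rfl, y, h1, h⟩⟩

theorem and_iff (hU : IsUniversal O U) (f g x : M) :
    U (pr (pr 8 (pr f g)) x) ↔ U (pr f x) ∧ U (pr g x) := by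
  rw [hU.iff_ruleAt]
  constructor
  · rintro ⟨e, h⟩
    simp only [RuleAt] at h
    norm_num at h
    exact h
  · intro h
    exact ⟨0, .inr <| .inr <| .inr <| .inr <| .inr <| .inr <| .inr <| .inr <| .inl ⟨rfl, h⟩⟩

theorem or_iff (hU : IsUniversal O U) (f g x : M) :
    U (pr (pr 9 (pr f g)) x) ↔ U (pr f x) ∨ U (pr g x) := by
  rw [hU.iff_ruleAt]
  constructor
  · rintro ⟨e, h⟩
    simp only [RuleAt] at h
    norm_num at h
    exact h
  · intro h
    exact ⟨0, .inr <| .inr <| .inr <| .inr <| .inr <| .inr <| .inr <| .inr <| .inr <| .inl ⟨rfl, h⟩⟩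

theorem ex_iff (hU : IsUniversal O U) (f x : M) :
    U (pr (pr 10 (pr f 0)) x) ↔ ∃ a, U (pr f (pr a x)) := by
  rw [hU.iff_ruleAt]
  constructor
  · rintro ⟨e, h⟩
    simp only [RuleAt] at h
    norm_num at h
    exact h.imp fun _ => And.right
  · rintro ⟨y, h⟩
    obtain ⟨e, h1, -⟩ := exists_gt₃ y y y
    exact ⟨e, .inr <| .inr <| .inr <| .inr <| .inr <| .inr <| .inr <| .inr <| .inr <| .inr <|
      .inl ⟨rfl, y, h1, h⟩⟩

theorem ball_iff (hU : IsUniversal O U) (f g x : M) :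
    U (pr (pr 11 (pr f g)) x) ↔ ∃ b, U (pr f (pr b x)) ∧ ∀ a, a < b → U (pr g (pr a x)) := by
  rw [hU.iff_ruleAt]
  constructor
  · rintro ⟨e, h⟩
    simp only [RuleAt] at h
    norm_num at h
    exact h.imp fun _ => And.right
  · rintro ⟨y, h⟩
    obtain ⟨e, h1, -⟩ := exists_gt₃ y y y
    exact ⟨e, .inr <| .inr <| .inr <| .inr <| .inr <| .inr <| .inr <| .inr <| .inr <| .inr <|
      .inr ⟨rfl, y, h1, h⟩⟩

/-- The graph of a term keeps the value in front of the argument list; rule `2` deletes the entry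
just behind it, which shifts the variables by one. -/
theorem rep_drop (hU : IsUniversal O U) {t : (Fin n → M) → M}
    (h : Rep U fun w : Fin (n + 1) → M => w 0 = t fun i => w i.succ) :
    Rep U fun w : Fin (n + 2) → M => w 0 = t fun i => w i.succ.succ := by
  obtain ⟨f, hf⟩ := h
  refine ⟨pr 2 (pr f 0), fun w => ?_⟩
  have := hf (Matrix.vecCons (w 0) fun i => w i.succ.succ)
  simp only [code, Matrix.cons_val_zero, Matrix.cons_val_succ] at this
  rw [hU.drop_iff]
  beta_reduce
  rw [← this]
  simp only [code, pr_inj]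
  constructor
  · rintro ⟨y, a, u, ⟨rfl, rfl, rfl⟩, h⟩
    exact h
  · intro h
    exact ⟨_, _, _, ⟨rfl, rfl, rfl⟩, h⟩

theorem rep_var (hU : IsUniversal O U) : ∀ {n : ℕ} (i : Fin n),
    Rep U fun w : Fin (n + 1) → M => w 0 = w i.succ
  | 0, i => i.elim0
  | n + 1, i => by
    refine Fin.cases ?_ (fun i => hU.rep_drop (t := fun v => v i) (hU.rep_var i)) i
    refine ⟨pr 1 (pr 0 0), fun w => ?_⟩
    simp only [hU.var_iff, code, pr_inj]
    constructor
    · rintro ⟨y, u, h1, h2, -⟩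
      exact h1.trans h2.symm
    · intro h
      exact ⟨_, _, rfl, h.symm, rfl⟩

/-- Terms are represented by their graphs, since the rules evaluate sums and products from already
verified values. -/
theorem rep_eq_of_tf (hU : IsUniversal O U) {t : (Fin n → M) → M} (ht : TF t) :
    Rep U fun w : Fin (n + 1) → M => w 0 = t fun i => w i.succ := by
  induction ht with
  | var i => exact hU.rep_var i
  | const c =>
    refine ⟨pr 0 (pr c 0), fun w => ?_⟩
    simp only [hU.const_iff, code, pr_inj]
    exact ⟨fun ⟨_, h, _⟩ => h, fun h => ⟨_, h, rfl⟩⟩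
  | @add s t _ _ hs ht =>
    obtain ⟨f, hf⟩ := hs
    obtain ⟨g, hg⟩ := ht
    refine ⟨pr 3 (pr f g), fun w => ?_⟩
    have hf' := fun y => hf (Matrix.vecCons y fun i => w i.succ)
    have hg' := fun y => hg (Matrix.vecCons y fun i => w i.succ)
    simp only [code, Matrix.cons_val_zero, Matrix.cons_val_succ] at hf' hg'
    simp only [hU.add_iff, code, pr_inj]
    constructor
    · rintro ⟨y, z, u, ⟨h, rfl⟩, h1, h2⟩
      rw [h, (hf' y).1 h1, (hg' z).1 h2]
    · intro h
      exact ⟨_, _, _, ⟨h, rfl⟩, (hf' _).2 rfl, (hg' _).2 rfl⟩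
  | @mul s t _ _ hs ht =>
    obtain ⟨f, hf⟩ := hs
    obtain ⟨g, hg⟩ := ht
    refine ⟨pr 4 (pr f g), fun w => ?_⟩
    have hf' := fun y => hf (Matrix.vecCons y fun i => w i.succ)
    have hg' := fun y => hg (Matrix.vecCons y fun i => w i.succ)
    simp only [code, Matrix.cons_val_zero, Matrix.cons_val_succ] at hf' hg'
    simp only [hU.mul_iff, code, pr_inj]
    constructor
    · rintro ⟨y, z, u, ⟨h, rfl⟩, h1, h2⟩
      rw [h, (hf' y).1 h1, (hg' z).1 h2]
    · intro h
      exact ⟨_, _, _, ⟨h, rfl⟩, (hf' _).2 rfl, (hg' _).2 rfl⟩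

theorem exists_section (hU : IsUniversal O U) {t : (Fin n → M) → M} (ht : TF t) :
    ∃ f, ∀ v y, U (pr f (pr y (code v))) ↔ y = t v := by
  obtain ⟨f, hf⟩ := hU.rep_eq_of_tf ht
  refine ⟨f, fun v y => ?_⟩
  simpa [code] using hf (Matrix.vecCons y v)

variable {R R' : (Fin n → M) → Prop} {s t : (Fin n → M) → M}

theorem rep_lt (hU : IsUniversal O U) (hs : TF s) (ht : TF t) : Rep U fun v => s v < t v := by
  obtain ⟨f, hf⟩ := hU.exists_section hs
  obtain ⟨g, hg⟩ := hU.exists_section ht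
  exact ⟨pr 5 (pr f g), fun v => by simp [hU.lt_iff, hf, hg]⟩

theorem rep_oracle (hU : IsUniversal O U) (ht : TF t) : Rep U fun v => O (t v) := by
  obtain ⟨f, hf⟩ := hU.exists_section ht
  exact ⟨pr 6 (pr f 0), fun v => by simp [hU.oracle_iff, hf]⟩

theorem rep_not_oracle (hU : IsUniversal O U) (ht : TF t) : Rep U fun v => ¬ O (t v) := by
  obtain ⟨f, hf⟩ := hU.exists_section ht
  exact ⟨pr 7 (pr f 0), fun v => by simp [hU.not_oracle_iff, hf]⟩

theorem rep_and (hU : IsUniversal O U) (h : Rep U R) (h' : Rep U R') :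
    Rep U fun v => R v ∧ R' v := by
  obtain ⟨f, hf⟩ := h
  obtain ⟨g, hg⟩ := h'
  exact ⟨pr 8 (pr f g), fun v => by simp [hU.and_iff, hf, hg]⟩

theorem rep_or (hU : IsUniversal O U) (h : Rep U R) (h' : Rep U R') :
    Rep U fun v => R v ∨ R' v := by
  obtain ⟨f, hf⟩ := h
  obtain ⟨g, hg⟩ := h'
  exact ⟨pr 9 (pr f g), fun v => by simp [hU.or_iff, hf, hg]⟩

theorem rep_ex (hU : IsUniversal O U) {R : (Fin (n + 1) → M) → Prop} (h : Rep U R) :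
    Rep U fun v => ∃ a, R (Matrix.vecCons a v) := by
  obtain ⟨f, hf⟩ := h
  refine ⟨pr 10 (pr f 0), fun v => ?_⟩
  simp [hU.ex_iff, ← hf, code]

theorem rep_ball (hU : IsUniversal O U) {R : (Fin (n + 1) → M) → Prop} (ht : TF t) (h : Rep U R) :
    Rep U fun v => ∀ a, a < t v → R (Matrix.vecCons a v) := by
  obtain ⟨f, hf⟩ := hU.exists_section ht
  obtain ⟨g, hg⟩ := h
  refine ⟨pr 11 (pr f g), fun v => ?_⟩
  simp [hU.ball_iff, hf, ← hg, code]

theorem rep_bex (hU : IsUniversal O U) {R : (Fin (n + 1) → M) → Prop} (ht : TF t) (h : Rep U R) :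
    Rep U fun v => ∃ a, a < t v ∧ R (Matrix.vecCons a v) := by
  obtain ⟨f, hf⟩ := hU.rep_ex (hU.rep_and (hU.rep_lt (TF.var 0) (ht.comp Fin.succ)) h)
  exact ⟨f, fun v => by simp [hf]⟩

/-- The rules have no negation, so a relation and its complement are represented together. The
induction is on the standard formula, hence no minimality of `U` is needed. -/
theorem rep_d0 (hU : IsUniversal O U) (h : D0 {{x | O x}} R) : Rep U R ∧ Rep U fun v => ¬ R v := by
  induction h with
  | eq hs ht =>
    obtain ⟨f, hf⟩ := hU.rep_or (hU.rep_lt hs ht) (hU.rep_lt ht hs)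
    obtain ⟨g, hg⟩ := hU.rep_ex (hU.rep_and (hU.rep_eq_of_tf hs) (hU.rep_eq_of_tf ht))
    refine ⟨⟨g, fun v => by simp [hg]⟩, ⟨f, fun v => ?_⟩⟩
    rw [hf]
    exact ne_iff_lt_or_gt.symm
  | lt hs ht =>
    refine ⟨hU.rep_lt hs ht, ?_⟩
    obtain ⟨f, hf⟩ := hU.rep_lt ht hs
    obtain ⟨g, hg⟩ := hU.rep_ex (hU.rep_and (hU.rep_eq_of_tf hs) (hU.rep_eq_of_tf ht))
    obtain ⟨k, hk⟩ := hU.rep_or ⟨f, hf⟩ ⟨g, hg⟩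
    refine ⟨k, fun v => ?_⟩
    rw [hk]
    beta_reduce
    rw [not_lt, le_iff_lt_or_eq]
    simp [eq_comm]
  | @mem _ X _ hX ht =>
    obtain rfl : X = {x | O x} := hX
    exact ⟨hU.rep_oracle ht, hU.rep_not_oracle ht⟩
  | not _ h => exact ⟨h.2, by simpa using h.1⟩
  | and _ _ h h' =>
    exact ⟨hU.rep_and h.1 h'.1, by simpa only [not_and_or] using hU.rep_or h.2 h'.2⟩
  | or _ _ h h' =>
    exact ⟨hU.rep_or h.1 h'.1, by simpa only [not_or] using hU.rep_and h.2 h'.2⟩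
  | ballCons ht _ h =>
    exact ⟨hU.rep_ball ht h.1, by simpa only [not_forall, exists_prop] using hU.rep_bex ht h.2⟩
  | bexCons ht _ h =>
    exact ⟨hU.rep_bex ht h.1, by simpa only [not_exists, not_and] using hU.rep_ball ht h.2⟩

theorem rep_s1 (hU : IsUniversal O U) (h : IsS1 {{x | O x}} R) : Rep U R := by
  obtain ⟨R', h, e⟩ := isS1_iff.1 h
  obtain ⟨f, hf⟩ := hU.rep_ex (hU.rep_d0 h).1
  exact ⟨f, fun v => by rw [hf, e]⟩

end IsUniversal

end

/-! ### The generic path -/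

section

variable {M : Type u} [PMinus M]

/-- Membership in the join of `A` with the path of the strings below `τ`. -/
def OracleAt (A : Set M) (τ y : M) : Prop :=
  (∃ a, a < y + 1 ∧ y = 2 * a ∧ a ∈ A) ∨ ∃ b, b < y + 1 ∧ y = 2 * b + 1 ∧ IsPrefix b τ

/-- All elements of the set coded by `s` are verified from it, with the oracle given by `τ`. -/
def Justified (A : Set M) (s τ : M) : Prop :=
  ∀ z, z < s → Elem z s → Rule τ (OracleAt A τ) (fun y => Elem y s) z

/-- The properties of strings to be decided: end-extending a given string and verifying a given
number. -/
def Forces (A : Set M) (j τ : M) : Prop :=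
  (∃ k, k < j + 1 ∧ j = 2 * k ∧ IsPrefix k τ) ∨
    ∃ k, k < j + 1 ∧ j = 2 * k + 1 ∧ ∃ s, s < τ ∧ Justified A s τ ∧ Elem k s

theorem two_mul_ne (a b : M) : 2 * a ≠ 2 * b + 1 :=
  fun h => not_two_dvd_add_one b ⟨a, h.symm⟩

theorem two_mul_inj {a b : M} : 2 * a = 2 * b ↔ a = b :=
  mul_right_inj' two_ne_zero

theorem le_two_mul (a : M) : a ≤ 2 * a := by
  rw [two_mul]
  exact le_self_add

theorem forces_even {A : Set M} {k τ : M} : Forces A (2 * k) τ ↔ IsPrefix k τ := by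
  constructor
  · rintro (⟨l, -, h, h'⟩ | ⟨l, -, h, -⟩)
    · rwa [two_mul_inj.1 h]
    · exact absurd h (two_mul_ne _ _)
  · intro h
    exact .inl ⟨k, lt_add_one_iff'.2 (le_two_mul k), rfl, h⟩

theorem forces_odd {A : Set M} {k τ : M} :
    Forces A (2 * k + 1) τ ↔ ∃ s, s < τ ∧ Justified A s τ ∧ Elem k s := by
  constructor
  · rintro (⟨l, -, h, h'⟩ | ⟨l, -, h, h'⟩)
    · exact absurd h.symm (two_mul_ne _ _)
    · rwa [two_mul_inj.1 (add_right_cancel h)]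
  · intro h
    exact .inr ⟨k, lt_add_one_iff'.2 ((le_two_mul k).trans le_self_add), rfl, h⟩

instance {A : Set M} {n : ℕ} {s t : (Fin n → M) → M} [IsTF s] [IsTF t] :
    IsD0 {A} fun v => OracleAt A (s v) (t v) := by
  have : ∀ ⦃k : ℕ⦄ (t : (Fin k → M) → M) [IsTF t], IsD0 {A} fun v => t v ∈ A :=
    fun k t _ => isD0_mem (Set.mem_singleton A)
  unfold OracleAt
  infer_instance

set_option synthInstance.maxHeartbeats 400000 in
set_option synthInstance.maxSize 4000 in
instance {A : Set M} {n : ℕ} {s t : (Fin n → M) → M} [IsTF s] [IsTF t] :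
    IsD0 {A} fun v => Justified A (s v) (t v) := by
  unfold Justified Rule RuleAt
  infer_instance

instance {A : Set M} {n : ℕ} {s t : (Fin n → M) → M} [IsTF s] [IsTF t] :
    IsD0 {A} fun v => Forces A (s v) (t v) := by
  unfold Forces
  infer_instance

theorem mem_join_iff {A P : Set M} {y : M} : y ∈ join A P ↔
    (∃ a, a < y + 1 ∧ y = 2 * a ∧ a ∈ A) ∨ ∃ b, b < y + 1 ∧ y = 2 * b + 1 ∧ b ∈ P := by
  constructor
  · rintro (⟨a, ha, rfl⟩ | ⟨b, hb, rfl⟩)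
    · exact .inl ⟨a, lt_add_one_iff'.2 (le_two_mul a), rfl, ha⟩
    · exact .inr ⟨b, lt_add_one_iff'.2 ((le_two_mul b).trans le_self_add), rfl, hb⟩
  · rintro (⟨a, -, rfl, ha⟩ | ⟨b, -, rfl, hb⟩)
    · exact .inl ⟨a, ha, rfl⟩
    · exact .inr ⟨b, hb, rfl⟩

variable [IDelta0 M] {A : Set M}

/-- A string below `σ` that is a prefix of `τ` is already a prefix of `σ`. -/
theorem oracleAt_congr {σ τ y : M} (h : IsPrefix σ τ) (hy : y < σ) :
    OracleAt A σ y ↔ OracleAt A τ y := by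
  refine or_congr Iff.rfl (exists_congr fun b => and_congr_right fun hb => and_congr_right fun _ => ?_)
  refine ⟨fun hp => hp.trans h, fun hp => hp.of_le h ?_⟩
  exact (lt_add_one_iff'.1 hb).trans hy.le

/-- The string itself bounds the rule, so the oracle is queried only where `σ` and `τ` agree. -/
theorem Justified.mono {s σ τ : M} (hs : Justified A s σ) (h : IsPrefix σ τ) : Justified A s τ :=
  fun z hz hzs => (hs z hz hzs).mono h.le (fun _ hy => oracleAt_congr h hy) fun _ => id

theorem Forces.mono {j σ τ : M} (hj : Forces A j σ) (h : IsPrefix σ τ) : Forces A j τ := by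
  rcases hj with ⟨k, hk, e, hp⟩ | ⟨k, hk, e, s, hs, hj, hks⟩
  · exact .inl ⟨k, hk, e, hp.trans h⟩
  · exact .inr ⟨k, hk, e, s, hs.trans_le h.le, hj.mono h, hks⟩

theorem treeForcing {T : M → Prop} (hT : IsD0 {A} fun v : Fin 1 → M => T (v 0))
    (hc : ∀ {σ τ}, T τ → IsPrefix σ τ → T σ) (hu : ∀ b, ∃ τ, b ≤ τ ∧ T τ) :
    TreeForcing {A} T (Forces A) :=
  ⟨hT, hc, hu, inferInstance, Forces.mono⟩

-- The path and the verified facts, read off from the greedy choice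

namespace TreeForcing

variable {T : M → Prop} [Fact (ISigma 1 {A})]

/-- The path determined by the greedy choice. -/
def path (T : M → Prop) (A : Set M) : Set M := {σ | ¬ Greedy T (Forces A) (2 * σ)}

/-- The numbers verified by the path. -/
def Verified (T : M → Prop) (A : Set M) (z : M) : Prop := ¬ Greedy T (Forces A) (2 * z + 1)

omit [Fact (ISigma 1 {A})] in
theorem cond_closed (hF : TreeForcing {A} T (Forces A)) {F : M → Prop} {e σ τ : M}
    (h : Cond T (Forces A) F e τ) (hp : IsPrefix σ τ) : Cond T (Forces A) F e σ :=
  ⟨hF.closed h.1 hp, fun k hk hF hE => h.2 k hk hF (hE.mono hp)⟩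

/-- A condition `≥ b` has a prefix in `[b, 2b)`. That prefix is again a condition, so it has
property `E j`, which persists. -/
theorem exists_forced' (hF : TreeForcing {A} T (Forces A)) {j : M} (hj : ¬ Greedy T (Forces A) j) :
    ∃ b, ∀ τ, b ≤ τ → Cond T (Forces A) (Greedy T (Forces A)) j τ → Forces A j τ := by
  obtain ⟨b, hb, H⟩ := hF.exists_forced hj
  refine ⟨b, fun τ hτ hc => ?_⟩
  obtain ⟨σ, hσ, hbσ, hlt⟩ := exists_prefix_lt hb hτ
  exact (H σ hlt hbσ (hF.cond_closed hc hσ)).mono hσ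

omit [IDelta0 M] [Fact (ISigma 1 {A})] in
theorem _root_.SOArith.Cond.anti {E : M → M → Prop} {F : M → Prop} {e e' τ : M}
    (h : Cond T E F e' τ) (he : e ≤ e') : Cond T E F e τ :=
  ⟨h.1, fun k hk => h.2 k (hk.trans_le he)⟩

/-- What is not chosen holds of arbitrarily long strings that respect the choice. -/
theorem exists_cond_forces (hF : TreeForcing {A} T (Forces A)) {j : M}
    (hj : ¬ Greedy T (Forces A) j) (e b : M) :
    ∃ τ, b ≤ τ ∧ Cond T (Forces A) (Greedy T (Forces A)) e τ ∧ Forces A j τ := by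
  obtain ⟨c, hc⟩ := hF.exists_forced' hj
  obtain ⟨τ, hτ, h⟩ := hF.exists_cond (e + j) (b + c)
  exact ⟨τ, le_self_add.trans hτ, h.anti le_self_add, hc τ (le_add_self.trans hτ) (h.anti le_add_self)⟩

/-- Some condition extends `σ`, because extending `σ` is unavoidable; conditions are closed under
prefixes. -/
theorem cond_of_mem_path (hF : TreeForcing {A} T (Forces A)) {σ : M} (hσ : σ ∈ path T A) (e : M) :
    Cond T (Forces A) (Greedy T (Forces A)) e σ := by
  obtain ⟨τ, -, hc, hf⟩ := hF.exists_cond_forces hσ e 0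
  exact hF.cond_closed hc (forces_even.1 hf)

theorem not_greedy_of_forces (hF : TreeForcing {A} T (Forces A)) {σ j : M} (hσ : σ ∈ path T A)
    (h : Forces A j σ) : ¬ Greedy T (Forces A) j :=
  fun hg => (hF.cond_of_mem_path hσ (j + 1)).2 j (lt_add_one_iff'.2 le_rfl) hg h

theorem mem_path_of_isPrefix (hF : TreeForcing {A} T (Forces A)) {σ τ : M} (hτ : τ ∈ path T A)
    (h : IsPrefix σ τ) : σ ∈ path T A :=
  hF.not_greedy_of_forces hτ (forces_even.2 h)

/-- Both strings are prefixes of one long enough condition. -/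
theorem comparable_of_mem_path (hF : TreeForcing {A} T (Forces A)) {σ τ : M} (hσ : σ ∈ path T A)
    (hτ : τ ∈ path T A) : IsPrefix σ τ ∨ IsPrefix τ σ := by
  obtain ⟨b, hb⟩ := hF.exists_forced' hσ
  obtain ⟨ρ, hρ, hc, hf⟩ := hF.exists_cond_forces hτ (2 * σ) b
  exact (forces_even.1 (hb ρ hρ hc)).comparable (forces_even.1 hf)

theorem exists_mem_path (hF : TreeForcing {A} T (Forces A)) (b : M) : ∃ σ ∈ path T A, b ≤ σ := by
  -- The bound `2 * (2 * (b + 1))` exceeds the index `2 * σ` of every prefix `σ` in `[b + 1, 2 * (b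
  -- + 1))`. Such a prefix of `τ` was not avoided, so it is on the path.
  obtain ⟨τ, hτ, hc⟩ := hF.exists_cond (2 * (2 * (b + 1))) (b + 1)
  obtain ⟨σ, hσ, hb, hlt⟩ := exists_prefix_lt (lt_of_lt_of_le zero_lt_one le_add_self) hτ
  refine ⟨σ, fun hg => hc.2 _ ?_ hg (forces_even.2 hσ), le_self_add.trans hb⟩
  exact mul_lt_mul_of_pos_left hlt two_pos'

theorem oracleAt_iff (hF : TreeForcing {A} T (Forces A)) {σ y : M} (hσ : σ ∈ path T A)
    (hy : y < σ) : OracleAt A σ y ↔ y ∈ join A (path T A) := by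
  rw [mem_join_iff]
  refine or_congr Iff.rfl (exists_congr fun b => and_congr_right fun hb => and_congr_right fun _ => ?_)
  refine ⟨fun hp => hF.mem_path_of_isPrefix hσ hp, fun hp => ?_⟩
  refine (hF.comparable_of_mem_path hp hσ).resolve_right fun h => ?_
  exact absurd (h.le.trans (lt_add_one_iff'.1 hb)) (not_le.2 hy)

theorem verified_of_forces (hF : TreeForcing {A} T (Forces A)) {σ s z : M} (hσ : σ ∈ path T A)
    (hs : s < σ) (hj : Justified A s σ) (hz : Elem z s) : Verified T A z :=
  hF.not_greedy_of_forces hσ (forces_odd.2 ⟨s, hs, hj, hz⟩)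

/-- One path string suffices for all verified numbers below `N`: a code of `Greedy` makes forcing a
bounded relation, and collection bounds the levels at which it happens. -/
theorem exists_justified (hF : TreeForcing {A} T (Forces A)) (N : M) :
    ∃ b, ∀ σ ∈ path T A, b ≤ σ → ∀ y < N, Verified T A y →
      ∃ s, s < σ ∧ Justified A s σ ∧ Elem y s := by
  obtain ⟨t, ht⟩ := hF.exists_code_greedy (2 * N + 1)
  have hlt : ∀ {y}, y < N → 2 * y + 1 < 2 * N + 1 := fun hy => by gcongr
  have iF : ∀ ⦃n : ℕ⦄ (s j b : (Fin n → M) → M) [IsTF s] [IsTF j] [IsTF b],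
      IsD0 {A} fun v => ForcedFrom T (Forces A) (s v) (j v) (b v) := by
    have := hF.isD0_tree.app
    unfold ForcedFrom
    intros
    infer_instance
  have : ∀ y, y < N → ∃ b, ¬ Elem (2 * y + 1) t → ForcedFrom T (Forces A) t (2 * y + 1) b := by
    intro y hy
    by_cases h : Greedy T (Forces A) (2 * y + 1)
    · exact ⟨0, fun h' => absurd ((ht _).2 ⟨hlt hy, h⟩) h'⟩
    · obtain ⟨b, hb, H⟩ := hF.exists_forced h
      refine ⟨b, fun _ => ⟨hb, fun τ h1 h2 h3 h4 => H τ h1 h2 ⟨h3, fun k hk hg => h4 k hk ?_⟩⟩⟩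
      exact (ht k).2 ⟨hk.trans (hlt hy), hg⟩
  obtain ⟨w, hw⟩ := d0_collection (S := {A})
    (p := fun y b => ¬ Elem (2 * y + 1) t → ForcedFrom T (Forces A) t (2 * y + 1) b)
    inferInstance this
  refine ⟨w, fun σ hσ hwσ y hy hv => forces_odd.1 ?_⟩
  obtain ⟨b, hbw, hb⟩ := hw y hy
  obtain ⟨hb, H⟩ := hb fun h => hv ((ht _).1 h).2
  obtain ⟨ρ, hρ, hbρ, hlt⟩ := exists_prefix_lt hb (hbw.le.trans hwσ)
  have hc := hF.cond_closed (hF.cond_of_mem_path hσ (2 * y + 1)) hρ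
  exact (H ρ hlt hbρ hc.1 fun k hk hks => hc.2 k hk ((ht k).1 hks).2).mono hρ

/-- Downwards, a verified `z` lies in a set justified along the path, which supplies a rule for `z`.
Upwards, a rule uses boundedly many verified numbers, and their justified sets together with `z`
form a justified set. -/
theorem isUniversal (hF : TreeForcing {A} T (Forces A)) :
    IsUniversal (· ∈ join A (path T A)) (Verified T A) := by
  intro z
  constructor
  · intro hz
    obtain ⟨b, hb⟩ := hF.exists_justified (z + 1)
    obtain ⟨σ, hσ, hbσ⟩ := hF.exists_mem_path b
    obtain ⟨s, hs, hj, hzs⟩ := hb σ hσ hbσ z (lt_add_one_iff'.2 le_rfl) hz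
    refine ⟨σ, (hj z hzs.lt hzs).mono le_rfl (fun y hy => hF.oracleAt_iff hσ hy) fun y hy => ?_⟩
    exact hF.verified_of_forces hσ hs hj hy
  · rintro ⟨e, he⟩
    obtain ⟨b, hb⟩ := hF.exists_justified (pr e (pr e e) + 1)
    obtain ⟨σ, hσ, hbσ⟩ := hF.exists_mem_path (b + e + z + 1)
    have hzσ : z < σ := add_one_le_iff'.1 ((add_le_add_left le_add_self 1).trans hbσ)
    have heσ : e ≤ σ := (le_add_self.trans (le_self_add.trans le_self_add)).trans hbσ
    replace hb := hb σ hσ ((le_self_add.trans (le_self_add.trans le_self_add)).trans hbσ)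
    -- The union of all sets `s < σ` justified at `σ`, with `z` added.
    obtain ⟨t, ht⟩ := exists_code (S := {A}) σ
      (p := fun x => (∃ s, s < σ ∧ Justified A s σ ∧ Elem x s) ∨ x = z) inferInstance
    -- The code `t` may exceed `σ`, while an event at `τ` requires a code below `τ`.
    obtain ⟨τ, hτ, hle⟩ := hF.exists_mem_path (σ + t + 1)
    have hστ : σ ≤ τ := (le_self_add.trans le_self_add).trans hle
    have hpre : IsPrefix σ τ := by
      rcases hF.comparable_of_mem_path hσ hτ with h | h
      · exact h
      · obtain rfl := le_antisymm hστ h.le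
        exact h
    refine hF.verified_of_forces hτ
      (add_one_le_iff'.1 ((add_le_add_left le_add_self 1).trans hle)) (s := t) ?_
      ((ht z).2 ⟨hzσ, .inr rfl⟩)
    intro x _ hx
    rcases ((ht x).1 hx).2 with ⟨s, hs, hj, hxs⟩ | rfl
    · refine (hj x hxs.lt hxs).mono hστ (fun y hy => oracleAt_congr hpre hy) fun y hy => ?_
      exact (ht y).2 ⟨hy.lt.trans hs, .inl ⟨s, hs, hj, hy⟩⟩
    · refine he.bounded.mono (heσ.trans hστ) (fun y hy => ?_) fun y hy => ?_
      · exact (hF.oracleAt_iff hτ (hy.trans_le (heσ.trans hστ))).symm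
      · obtain ⟨s, hs, hj, hys⟩ := hb y hy.1 hy.2
        exact (ht y).2 ⟨hys.lt.trans hs, .inl ⟨s, hs, hj, hys⟩⟩

end TreeForcing

end

/-! ### The low basis theorem -/

section

variable {M : Type u} [PMinus M]

namespace TreeForcing

variable [IDelta0 M] {A : Set M} {T : M → Prop} [Fact (ISigma 1 {A})]

/-- On `[0, a]` the `Σ⁰₁` property is the complement of a section of a coded segment of `Greedy`, so
induction for bounded formulas without set parameters suffices. -/
theorem iSigma_one_join (hF : TreeForcing {A} T (Forces A)) : ISigma 1 {join A (path T A)} := by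
  refine iSigma_iff.2 fun p hp h0 hs a => ?_
  obtain ⟨f, hf⟩ := hF.isUniversal.rep_s1 ⟨hp⟩
  replace hf : ∀ x, Verified T A (pr f (pr x 0)) ↔ p x := fun x => hf fun _ => x
  -- Pairing is monotone, so this segment contains the odd indices for all `x ≤ a`.
  obtain ⟨t, ht⟩ := hF.exists_code_greedy (2 * pr f (pr a 0) + 2)
  have key : ∀ x, x ≤ a → (¬ Elem (2 * pr f (pr x 0) + 1) t ↔ p x) := by
    intro x hx
    have hlt : 2 * pr f (pr x 0) + 1 < 2 * pr f (pr a 0) + 2 :=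
      add_lt_add_of_le_of_lt (mul_le_mul_right (pr_le_pr le_rfl (pr_le_pr hx le_rfl)) 2) (by simp)
    rw [ht, and_iff_right hlt, ← hf]
    rfl
  have hind : a ≤ a → ¬ Elem (2 * pr f (pr a 0) + 1) t := by
    refine d0_induction (S := ∅) (p := fun x => x ≤ a → ¬ Elem (2 * pr f (pr x 0) + 1) t)
      inferInstance (fun _ => (key 0 zero_le).2 h0) (fun x ih hx => ?_) a
    have hxa := le_self_add.trans hx
    exact (key _ hx).2 (hs x ((key x hxa).1 (ih hxa)))
  exact (key a le_rfl).1 (hind le_rfl)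

/-- The complement of a `Σ⁰₁` relation in the join is a section of `Greedy`, which is `Σ⁰₂` in `A`;
the leading existential quantifiers are contracted by pairing. -/
theorem sig_two_of_sig_join (hF : TreeForcing {A} T (Forces A)) {n : ℕ} {R : (Fin n → M) → Prop}
    (h : Sig {join A (path T A)} 2 R) : Sig {A} 2 R := by
  obtain ⟨R', h, e⟩ := h
  obtain ⟨f, hf⟩ := hF.isUniversal.rep_s1 ⟨h⟩
  obtain ⟨θ, hθ, hg⟩ := hF.greedy_iff
  have key : ∀ v, R v ↔ ∃ a s w, ∀ q, θ (2 * pr f (pr a (code v)) + 1) s w q := by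
    intro v
    rw [e]
    refine exists_congr fun a => ?_
    rw [← hg, ← not_iff_not]
    refine (hf _).symm.trans ?_
    simp only [code, Matrix.cons_val_zero, Matrix.cons_val_succ]
    rfl
  have : ∀ ⦃n : ℕ⦄ (a b c d : (Fin n → M) → M) [IsTF a] [IsTF b] [IsTF c] [IsTF d],
      IsD0 {A} fun v => θ (a v) (b v) (c v) (d v) := by
    intro n a b c d _ _ _ _
    exact ⟨hθ.out.compTF (g := fun w => ![a w, b w, c w, d w])
      (Fin.cases (IsTF.out (t := a)) (Fin.cases (IsTF.out (t := b)) (Fin.cases (IsTF.out (t := c))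
        fun i => by rw [Subsingleton.elim i 0]; exact IsTF.out (t := d))))⟩
  have : IsTF fun v : Fin n → M => code v := ⟨isTF_code _ TF.var⟩
  have hS : IsS1 {A} fun w : Fin (n + 1) → M => ∃ q, ¬ ∃ a, a < w 0 + 1 ∧ ∃ s, s < w 0 + 1 ∧
      ∃ u, u < w 0 + 1 ∧ w 0 = pr a (pr s u) ∧
        θ (2 * pr f (pr a (code fun i => w i.succ)) + 1) s u q := by
    have : ∀ ⦃k : ℕ⦄ (g : Fin n → Fin k), IsTF fun v : Fin k → M => code fun i => v (g i) :=
      fun k g => ⟨isTF_code _ fun i => .var _⟩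
    infer_instance
  refine ⟨_, hS.out.congr (R' := fun w => ¬ ∀ q, _) fun w => not_forall, fun v => ?_⟩
  rw [key]
  constructor
  · rintro ⟨a, s, u, h⟩
    refine ⟨pr a (pr s u), fun q => ⟨a, lt_add_one_iff'.2 (le_pr_left _ _), s,
      lt_add_one_iff'.2 ((le_pr_left _ _).trans (le_pr_right _ _)), u,
      lt_add_one_iff'.2 ((le_pr_right _ _).trans (le_pr_right _ _)), rfl, ?_⟩⟩
    simpa using h q
  · rintro ⟨p, hp⟩
    -- The pair is decoded anew under each `q`; injectivity of `pr` shows that the components do not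
    -- depend on `q`.
    obtain ⟨a, -, s, -, u, -, hp0, -⟩ := hp 0
    refine ⟨a, s, u, fun q => ?_⟩
    obtain ⟨a', -, s', -, u', -, hp', h⟩ := hp q
    obtain ⟨ha, h'⟩ := pr_inj.1 (hp0.symm.trans hp')
    obtain ⟨hs, hu⟩ := pr_inj.1 h'
    subst ha hs hu
    simpa using h

theorem sig_of_sig_join (hF : TreeForcing {A} T (Forces A)) {k : ℕ} (hk : 2 ≤ k) :
    ∀ {n : ℕ} {R : (Fin n → M) → Prop}, Sig {join A (path T A)} k R → Sig {A} k R := by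
  induction k, hk using Nat.le_induction with
  | base => exact hF.sig_two_of_sig_join
  | succ k _ ih =>
    rintro n R ⟨R', h, e⟩
    exact ⟨R', ih h, e⟩

end TreeForcing

/-- The construction needs a `Σ⁰₀` tree, so `T` is replaced by a larger tree with no more infinite
paths: `τ` is removed only once the complement of `T` enumerates one of its prefixes with a witness
below `τ`. -/
theorem exists_low_path {A T : Set M} (hI : ISigma 1 {A}) (hΔ : IsDeltaSet {A} 1 T) (hT : IsTree T)
    (hinf : IsInfinite T) : ∃ P : Set M, IsInfinitePathThrough T P ∧ ISigma 1 {join A P} ∧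
      ∀ k, 2 ≤ k → ∀ (n : ℕ) (R : (Fin n → M) → Prop), Sig {join A P} k R → Sig {A} k R := by
  have : IDelta0 M := hI.zero_of_one.iDelta0
  have : Fact (ISigma 1 {A}) := ⟨hI⟩
  obtain ⟨R, hR, e⟩ := isS1_iff.1 ⟨isSigmaSet_iff.1 hΔ.2⟩
  let Q : M → M → Prop := fun w σ => R ![w, σ]
  have hQ : IsD0 {A} fun v : Fin 2 → M => Q (v 0) (v 1) :=
    ⟨hR.congr fun v => iff_of_eq (congrArg R (funext fun i => by fin_cases i <;> rfl))⟩
  have iQ := hQ.app₂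
  replace e : ∀ σ, σ ∉ T ↔ ∃ w, Q w σ := by
    intro σ
    refine (e fun _ => σ).trans (exists_congr fun w => iff_of_eq (congrArg R (funext fun i => ?_)))
    fin_cases i <;> rfl
  let T' : M → Prop := fun τ => 0 < τ ∧ ∀ σ, σ < τ + 1 → IsPrefix σ τ → ∀ w, w < τ → ¬ Q w σ
  have hF : TreeForcing {A} T' (Forces A) := by
    refine treeForcing inferInstance (fun {σ τ} hτ hp => ⟨hp.1, fun ρ hρ hpre w hw => ?_⟩) fun b => ?_
    · exact hτ.2 ρ (hρ.trans_le (by gcongr; exact hp.le)) (hpre.trans hp) w (hw.trans_le hp.le)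
    · by_contra! H
      refine hinf ⟨b, fun τ hτ => ?_⟩
      by_contra hb
      refine H τ (not_lt.1 hb) ⟨hT.1 τ hτ, fun σ _ hp w _ hw => ?_⟩
      exact (e σ).2 ⟨w, hw⟩ (hT.2 τ hτ σ hp)
  refine ⟨TreeForcing.path T' A, ⟨fun σ hσ => ?_, ⟨⟨fun σ hσ => ?_, fun τ hτ σ hp => ?_⟩,
    fun σ hσ τ hτ => hF.comparable_of_mem_path hσ hτ⟩, ?_⟩, hF.iSigma_one_join,
    fun k hk n R => hF.sig_of_sig_join hk⟩
  · by_contra hσT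
    obtain ⟨w, hw⟩ := (e σ).1 hσT
    obtain ⟨τ, hτ, hle⟩ := hF.exists_mem_path (σ + w + 1)
    have hσw : σ + w < τ := add_one_le_iff'.1 hle
    have hp : IsPrefix σ τ := by
      refine (hF.comparable_of_mem_path hσ hτ).resolve_right fun h => ?_
      exact absurd h.le (not_le.2 (le_self_add.trans_lt hσw))
    exact (hF.cond_of_mem_path hτ 0).1.2 σ (lt_add_one_iff'.2 hp.le) hp w
      (le_add_self.trans_lt hσw) hw
  · exact (hF.cond_of_mem_path hσ 0).1.1
  · exact hF.mem_path_of_isPrefix hτ hp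
  · rintro ⟨b, hb⟩
    obtain ⟨σ, hσ, hle⟩ := hF.exists_mem_path b
    exact absurd (hb σ hσ) (not_lt.2 hle)

-- Preservation of the two theories

theorem ISigma.of_sig {S S' : Set (Set M)} {k : ℕ} (hI : ISigma k S)
    (h : ∀ (n : ℕ) (R : (Fin n → M) → Prop), Sig S' k R → Sig S k R) : ISigma k S' :=
  iSigma_iff.2 fun _ hp => hI.induction (h _ _ hp)

theorem BSigma.of_sig {S S' : Set (Set M)} {k : ℕ} (hB : BSigma k S) (h0 : ISigma 0 S')
    (h : ∀ (n : ℕ) (R : (Fin n → M) → Prop), Sig S' k R → Sig S k R) : BSigma k S' :=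
  bSigma_iff.2 ⟨h0, fun R hR => (bSigma_iff.1 hB).2 R (h _ _ hR)⟩

/-- The theories `IΣ⁰₁ + IΣ⁰ₙ` and `IΣ⁰₁ + BΣ⁰ₙ₊₁`. -/
def Theory (bounding : Prop) (n : ℕ) (S : Set (Set M)) : Prop :=
  ISigma 1 S ∧ (¬ bounding → ISigma n S) ∧ (bounding → BSigma (n + 1) S)

/-- For `IΣ⁰₁` itself, induction in the join was proved directly; every other scheme concerns some
`k ≥ 2`, where the join defines no new `Σ⁰ₖ` relations. -/
theorem Theory.exists_path {bounding : Prop} {n : ℕ} (hn : 1 ≤ n) {A T : Set M}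
    (h : Theory bounding n {A}) (hΔ : IsDeltaSet {A} 1 T) (hT : IsTree T) (hinf : IsInfinite T) :
    ∃ P : Set M, IsInfinitePathThrough T P ∧ Theory bounding n {join A P} := by
  obtain ⟨P, hP, hI, hlow⟩ := exists_low_path h.1 hΔ hT hinf
  refine ⟨P, hP, hI, fun hb => ?_, fun hb => ?_⟩
  · rcases hn.eq_or_lt with rfl | hn
    · exact hI
    · exact (h.2.1 hb).of_sig (hlow n hn)
  · exact (h.2.2 hb).of_sig hI.zero_of_one (hlow (n + 1) (by omega))

end

/-! ### Sets that are `Δ⁰₁` as parameters -/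

section

variable {M : Type u} [PMinus M] {S S' : Set (Set M)}

theorem isDeltaSet_iff {X : Set M} : IsDeltaSet S 1 X ↔
    IsS1 S (fun v : Fin 1 → M => v 0 ∈ X) ∧ IsS1 S fun v : Fin 1 → M => v 0 ∉ X :=
  and_congr (isSigmaSet_iff.trans ⟨fun h => ⟨h⟩, fun h => h.out⟩)
    (isSigmaSet_iff.trans ⟨fun h => ⟨h⟩, fun h => h.out⟩)

theorem IsD0.isDeltaSet {X : Set M} (h : IsD0 S fun v : Fin 1 → M => v 0 ∈ X) : IsDeltaSet S 1 X :=
  isDeltaSet_iff.2 ⟨inferInstance, inferInstance⟩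

theorem isDeltaSet_of_mem {X : Set M} (h : X ∈ S) : IsDeltaSet S 1 X :=
  (isD0_mem h).isDeltaSet

theorem isDeltaSet_join_left (A P : Set M) : IsDeltaSet {join A P} 1 A := by
  refine IsD0.isDeltaSet ((isD0_mem (Set.mem_singleton _) :
    IsD0 {join A P} fun v : Fin 1 → M => 2 * v 0 ∈ join A P).congr fun v => ?_)
  constructor
  · exact fun h => .inl ⟨_, h, rfl⟩
  · rintro (⟨a, ha, h⟩ | ⟨b, -, h⟩)
    · rwa [two_mul_inj.1 h]
    · exact absurd h (two_mul_ne _ _)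

theorem isDeltaSet_join_right (A P : Set M) : IsDeltaSet {join A P} 1 P := by
  refine IsD0.isDeltaSet ((isD0_mem (Set.mem_singleton _) :
    IsD0 {join A P} fun v : Fin 1 → M => 2 * v 0 + 1 ∈ join A P).congr fun v => ?_)
  constructor
  · exact fun h => .inr ⟨_, h, rfl⟩
  · rintro (⟨a, -, h⟩ | ⟨b, hb, h⟩)
    · exact absurd h.symm (two_mul_ne _ _)
    · rwa [two_mul_inj.1 (add_right_cancel h)]

/-- The relation and its negation are treated together, so that negation swaps the two claims;
`IΣ⁰₁` handles the bounded quantifiers. -/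
theorem D0.isS1_of_isDeltaSet (hI : ISigma 1 S') (hS : ∀ X ∈ S, IsDeltaSet S' 1 X) {n : ℕ}
    {R : (Fin n → M) → Prop} (h : D0 S R) : IsS1 S' R ∧ IsS1 S' fun v => ¬ R v := by
  have : Fact (ISigma 1 S') := ⟨hI⟩
  induction h with
  | eq hs ht => exact ⟨IsD0.isS1 ⟨.eq hs ht⟩, IsD0.isS1 ⟨(D0.eq hs ht).not⟩⟩
  | lt hs ht => exact ⟨IsD0.isS1 ⟨.lt hs ht⟩, IsD0.isS1 ⟨(D0.lt hs ht).not⟩⟩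
  | @mem n X t hX ht =>
    obtain ⟨h, h'⟩ := isDeltaSet_iff.1 (hS X hX)
    have : IsTF t := ⟨ht⟩
    exact ⟨h.app t, h'.app (p := fun x => x ∉ X) t⟩
  | not _ h => exact ⟨h.2, by simpa using h.1⟩
  | and _ _ h h' =>
    obtain ⟨h1, h2⟩ := h
    obtain ⟨h3, h4⟩ := h'
    exact ⟨inferInstance, by simp only [not_and_or]; infer_instance⟩
  | or _ _ h h' =>
    obtain ⟨h1, h2⟩ := h
    obtain ⟨h3, h4⟩ := h'
    exact ⟨inferInstance, by simp only [not_or]; infer_instance⟩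
  | @ballCons n t R ht _ h =>
    obtain ⟨h1, h2⟩ := h
    have : IsTF t := ⟨ht⟩
    have e : ∀ w : Fin (n + 1) → M, Matrix.vecCons (w 0) (fun i => w i.succ) = w := fun w =>
      Matrix.cons_head_tail w
    have h1' : IsS1 S' fun w : Fin (n + 1) → M => R (Matrix.vecCons (w 0) fun i => w i.succ) := by
      simpa only [e] using h1
    have h2' : IsS1 S' fun w : Fin (n + 1) → M => ¬ R (Matrix.vecCons (w 0) fun i => w i.succ) := by
      simpa only [e] using h2
    refine ⟨inferInstance, ?_⟩
    simp only [not_forall, exists_prop]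
    infer_instance
  | @bexCons n t R ht _ h =>
    obtain ⟨h1, h2⟩ := h
    have : IsTF t := ⟨ht⟩
    have e : ∀ w : Fin (n + 1) → M, Matrix.vecCons (w 0) (fun i => w i.succ) = w := fun w =>
      Matrix.cons_head_tail w
    have h1' : IsS1 S' fun w : Fin (n + 1) → M => R (Matrix.vecCons (w 0) fun i => w i.succ) := by
      simpa only [e] using h1
    have h2' : IsS1 S' fun w : Fin (n + 1) → M => ¬ R (Matrix.vecCons (w 0) fun i => w i.succ) := by
      simpa only [e] using h2
    refine ⟨inferInstance, ?_⟩
    simp only [not_exists, not_and]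
    infer_instance

theorem Sig.of_isDeltaSet (hI : ISigma 1 S') (hS : ∀ X ∈ S, IsDeltaSet S' 1 X) {k : ℕ} (hk : 1 ≤ k) :
    ∀ {n : ℕ} {R : (Fin n → M) → Prop}, Sig S k R → Sig S' k R := by
  induction k, hk using Nat.le_induction with
  | base =>
    intro n R h
    have : Fact (ISigma 1 S') := ⟨hI⟩
    obtain ⟨R', h, e⟩ := isS1_iff.1 ⟨h⟩
    have h1 := (h.isS1_of_isDeltaSet hI hS).1
    have h1' : IsS1 S' fun w : Fin (n + 1) → M => R' (Matrix.vecCons (w 0) fun i => w i.succ) := by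
      have e : ∀ w : Fin (n + 1) → M, Matrix.vecCons (w 0) (fun i => w i.succ) = w := fun w =>
        Matrix.cons_head_tail w
      simpa only [e] using h1
    exact ((inferInstance : IsS1 S' fun v => ∃ a, R' (Matrix.vecCons a v)).congr e).out
  | succ k _ ih =>
    rintro n R ⟨R', h, e⟩
    exact ⟨R', ih h, e⟩

theorem IsDeltaSet.trans (hI : ISigma 1 S') (hS : ∀ X ∈ S, IsDeltaSet S' 1 X) {X : Set M}
    (h : IsDeltaSet S 1 X) : IsDeltaSet S' 1 X := by
  obtain ⟨h1, h2⟩ := isDeltaSet_iff.1 h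
  exact isDeltaSet_iff.2 ⟨⟨h1.out.of_isDeltaSet hI hS le_rfl⟩, ⟨h2.out.of_isDeltaSet hI hS le_rfl⟩⟩

theorem Theory.of_isDeltaSet {bounding : Prop} {n : ℕ} (hn : 1 ≤ n) (h : Theory bounding n S')
    (hS : ∀ X ∈ S, IsDeltaSet S' 1 X) : Theory bounding n S := by
  have h1 : ISigma 1 S := h.1.of_sig fun _ _ => Sig.of_isDeltaSet h.1 hS le_rfl
  exact ⟨h1, fun hb => (h.2.1 hb).of_sig fun _ _ => Sig.of_isDeltaSet h.1 hS hn,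
    fun hb => (h.2.2 hb).of_sig h1.zero_of_one fun _ _ => Sig.of_isDeltaSet h.1 hS (by omega)⟩

/-! ### Unions of chains -/

/-- A formula mentions only finitely many set parameters, so they all occur at one stage of the
chain. -/
theorem D0.exists_of_iUnion {F : ℕ → Set (Set M)} (hF : Monotone F) {n : ℕ} {R : (Fin n → M) → Prop}
    (h : D0 (⋃ k, F k) R) : ∃ k, D0 (F k) R := by
  induction h with
  | eq hs ht => exact ⟨0, .eq hs ht⟩
  | lt hs ht => exact ⟨0, .lt hs ht⟩
  | mem hX ht =>
    obtain ⟨k, hk⟩ := Set.mem_iUnion.1 hX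
    exact ⟨k, .mem hk ht⟩
  | not _ h => exact h.imp fun _ => .not
  | and _ _ h h' =>
    obtain ⟨k, hk⟩ := h
    obtain ⟨l, hl⟩ := h'
    exact ⟨max k l, (hk.mono (hF (le_max_left k l))).and (hl.mono (hF (le_max_right k l)))⟩
  | or _ _ h h' =>
    obtain ⟨k, hk⟩ := h
    obtain ⟨l, hl⟩ := h'
    exact ⟨max k l, (hk.mono (hF (le_max_left k l))).or (hl.mono (hF (le_max_right k l)))⟩
  | ballCons ht _ h => exact h.imp fun _ => .ballCons ht
  | bexCons ht _ h => exact h.imp fun _ => .bexCons ht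

theorem Sig.exists_of_iUnion {F : ℕ → Set (Set M)} (hF : Monotone F) {k : ℕ} :
    ∀ {n : ℕ} {R : (Fin n → M) → Prop}, Sig (⋃ k, F k) k R → ∃ l, Sig (F l) k R := by
  induction k with
  | zero => exact fun h => D0.exists_of_iUnion hF h
  | succ k ih =>
    rintro n R ⟨R', h, e⟩
    exact (ih h).imp fun l h => ⟨R', h, e⟩

theorem ISigma.iUnion {F : ℕ → Set (Set M)} (hF : Monotone F) {k : ℕ} (h : ∀ l, ISigma k (F l)) :
    ISigma k (⋃ l, F l) :=
  iSigma_iff.2 fun _ hp => by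
    obtain ⟨l, hp⟩ := hp.exists_of_iUnion hF
    exact (h l).induction hp

theorem BSigma.iUnion {F : ℕ → Set (Set M)} (hF : Monotone F) {k : ℕ} (h : ∀ l, BSigma k (F l)) :
    BSigma k (⋃ l, F l) :=
  bSigma_iff.2 ⟨ISigma.iUnion hF fun l => (h l).1, fun R hR => by
    obtain ⟨l, hR⟩ := hR.exists_of_iUnion hF
    exact (bSigma_iff.1 (h l)).2 R hR⟩

theorem Theory.iUnion {bounding : Prop} {n : ℕ} {F : ℕ → Set (Set M)} (hF : Monotone F)
    (h : ∀ l, Theory bounding n (F l)) : Theory bounding n (⋃ l, F l) :=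
  ⟨.iUnion hF fun l => (h l).1, fun hb => .iUnion hF fun l => (h l).2.1 hb,
    fun hb => .iUnion hF fun l => (h l).2.2 hb⟩

end

/-! ### Countability -/

def Tm.encode {n : ℕ} : Tm n → ℕ
  | .var i => Nat.pair 0 i
  | .zero => Nat.pair 1 0
  | .one => Nat.pair 2 0
  | .add s t => Nat.pair 3 (Nat.pair s.encode t.encode)
  | .mul s t => Nat.pair 4 (Nat.pair s.encode t.encode)

theorem Tm.encode_injective {n : ℕ} : Function.Injective (Tm.encode : Tm n → ℕ) := by
  intro s
  induction s <;> intro t h <;> cases t <;> simp_all [Tm.encode, Nat.pair_eq_pair, Fin.ext_iff]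
  all_goals aesop

def Fml.encode {m : ℕ} : {n : ℕ} → Fml m n → ℕ
  | _, .eq s t => Nat.pair 0 (Nat.pair s.encode t.encode)
  | _, .lt s t => Nat.pair 1 (Nat.pair s.encode t.encode)
  | _, .mem t i => Nat.pair 2 (Nat.pair t.encode i)
  | _, .neg φ => Nat.pair 3 φ.encode
  | _, .and φ ψ => Nat.pair 4 (Nat.pair φ.encode ψ.encode)
  | _, .or φ ψ => Nat.pair 5 (Nat.pair φ.encode ψ.encode)
  | _, .ball t φ => Nat.pair 6 (Nat.pair t.encode φ.encode)
  | _, .bex t φ => Nat.pair 7 (Nat.pair t.encode φ.encode)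
  | _, .all φ => Nat.pair 8 φ.encode
  | _, .ex φ => Nat.pair 9 φ.encode

theorem Fml.encode_injective {m n : ℕ} : Function.Injective (Fml.encode : Fml m n → ℕ) := by
  intro φ
  induction φ <;> intro ψ h <;> cases ψ <;>
    simp_all [Fml.encode, Nat.pair_eq_pair, Fin.ext_iff, Tm.encode_injective.eq_iff]
  all_goals aesop

instance {m n : ℕ} : Countable (Fml m n) := Fml.encode_injective.countable

theorem countable_isDeltaSet {M : Type u} [PMinus M] [Countable M] (A : Set M) :
    {X : Set M | IsDeltaSet {A} 1 X}.Countable := by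
  refine (Set.countable_range fun d : (Σ m n : ℕ, Fml m (n + 1) × (Fin n → M)) =>
    {a : M | d.2.2.1.Holds (fun _ => A) (Matrix.vecCons a d.2.2.2)}).mono ?_
  rintro X ⟨⟨m, n, φ, Y, e, -, hY, h⟩, -⟩
  obtain rfl : Y = fun _ => A := funext hY
  exact ⟨⟨m, n, φ, e⟩, Set.ext fun a => (h a).symm⟩

/-! ### Closing a countable model under paths -/

section

variable {M : Type u} [PMinus M]

open Classical in
/-- Add a path through `T` to `A`, if the theory allows it. -/
def addPath (bounding : Prop) (n : ℕ) (A T : Set M) : Set M :=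
  if h : ∃ P, IsInfinitePathThrough T P ∧ Theory bounding n {join A P} then join A h.choose else A

theorem isDeltaSet_addPath (bounding : Prop) (n : ℕ) (A T : Set M) :
    IsDeltaSet {addPath bounding n A T} 1 A := by
  unfold addPath
  split_ifs
  · exact isDeltaSet_join_left _ _
  · exact isDeltaSet_of_mem rfl

theorem theory_addPath {bounding : Prop} {n : ℕ} {A : Set M} (h : Theory bounding n {A}) (T : Set M) :
    Theory bounding n {addPath bounding n A T} := by
  unfold addPath
  split_ifs with hP
  · exact hP.choose_spec.2
  · exact h

theorem exists_path_addPath {bounding : Prop} {n : ℕ} (hn : 1 ≤ n) {A T : Set M}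
    (h : Theory bounding n {A}) (hΔ : IsDeltaSet {A} 1 T) (hT : IsTree T) (hinf : IsInfinite T) :
    ∃ P, IsDeltaSet {addPath bounding n A T} 1 P ∧ IsInfinitePathThrough T P := by
  have hP := h.exists_path hn hΔ hT hinf
  refine ⟨hP.choose, ?_, hP.choose_spec.1⟩
  rw [addPath, dif_pos hP]
  exact isDeltaSet_join_right _ _

/-- The second-order part is the union of the `Δ⁰₁` sets of an increasing sequence `B k`. Each `Δ⁰₁`
tree of each stage is treated at some later stage. -/
theorem exists_wkl_model [Countable M] {bounding : Prop} {n : ℕ} (hn : 1 ≤ n) {A : Set M}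
    (h : Theory bounding n {A}) : ∃ S : Set (Set M), (∀ X, IsDeltaSet {A} 1 X → X ∈ S) ∧
      RCA0 S ∧ Theory bounding n S ∧ WKL S := by
  have henum : ∀ B : Set M, ∃ f : ℕ → Set M, {X | IsDeltaSet {B} 1 X} ⊆ Set.range f := fun B => by
    obtain ⟨f, hf⟩ := (countable_isDeltaSet B).exists_eq_range ⟨B, isDeltaSet_of_mem rfl⟩
    exact ⟨f, hf.subset⟩
  choose en hen using henum
  -- Course-of-values recursion: `st k` records `B 0, …, B k`. Step `k = Nat.pair i j` adds a path
  -- through the `j`-th `Δ⁰₁` set of `B i`, where `i ≤ k`.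
  let st : ℕ → ℕ → Set M := fun k => Nat.rec (fun _ => A) (fun k s => Function.update s (k + 1)
    (addPath bounding n (s k) (en (s k.unpair.1) k.unpair.2))) k
  let B : ℕ → Set M := fun k => st k k
  have hst : ∀ i k, i ≤ k → st k i = B i := by
    intro i k hik
    induction k, hik using Nat.le_induction with
    | base => rfl
    | succ k hk ih =>
      rw [← ih]
      exact Function.update_of_ne (by omega) _ _
  have hB : ∀ k, B (k + 1) = addPath bounding n (B k) (en (B k.unpair.1) k.unpair.2) := by
    intro k
    rw [← hst _ _ (Nat.unpair_left_le k)]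
    exact Function.update_self _ _ _
  have hth : ∀ k, Theory bounding n {B k} := by
    intro k
    induction k with
    | zero => exact h
    | succ k ih =>
      rw [hB]
      exact theory_addPath ih _
  have hmono : Monotone fun k => {X | IsDeltaSet {B k} 1 X} := by
    refine monotone_nat_of_le_succ fun k X hX =>
      show IsDeltaSet _ 1 X from IsDeltaSet.trans (S := {B k}) (hth (k + 1)).1 ?_ hX
    rintro _ rfl
    rw [hB]
    exact isDeltaSet_addPath _ _ _ _
  have hth' : Theory bounding n (⋃ k, {X | IsDeltaSet {B k} 1 X}) :=
    .iUnion hmono fun k => (hth k).of_isDeltaSet hn fun X hX => hX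
  refine ⟨_, fun X hX => Set.mem_iUnion.2 ⟨0, hX⟩, ⟨?_, hth'.1⟩, hth', ?_⟩
  · intro X hX
    obtain ⟨h1, h2⟩ := isDeltaSet_iff.1 hX
    obtain ⟨k, hk⟩ := h1.out.exists_of_iUnion hmono
    obtain ⟨l, hl⟩ := h2.out.exists_of_iUnion hmono
    refine Set.mem_iUnion.2 ⟨max k l, IsDeltaSet.trans (hth _).1 (fun _ h => h)
      (isDeltaSet_iff.2 ⟨⟨hk.mono (hmono (le_max_left k l))⟩, ⟨hl.mono (hmono (le_max_right k l))⟩⟩)⟩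
  · intro T hT htree hinf
    obtain ⟨i, hi⟩ := Set.mem_iUnion.1 hT
    obtain ⟨j, rfl⟩ := hen _ hi
    have hk := hmono (Nat.left_le_pair i j) hi
    obtain ⟨P, hP, hP'⟩ := exists_path_addPath hn (hth _) hk htree hinf
    refine ⟨P, Set.mem_iUnion.2 ⟨Nat.pair i j + 1, ?_⟩, hP'⟩
    rw [hB]
    simpa using hP

end

/-! ### Countable elementary submodels -/

section

variable {M : Type u} [PMinus M] {m : ℕ}

open Classical in
/-- A witness for an existential formula. -/
noncomputable def witness (X : Fin m → Set M) {k : ℕ} (φ : Fml m (k + 1)) (e : Fin k → M) : M :=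
  if h : ∃ a, φ.Holds X (Matrix.vecCons a e) then h.choose else 0

theorem holds_witness {X : Fin m → Set M} {k : ℕ} {φ : Fml m (k + 1)} {e : Fin k → M}
    (h : ∃ a, φ.Holds X (Matrix.vecCons a e)) :
    φ.Holds X (Matrix.vecCons (witness X φ e) e) := by
  rw [witness, dif_pos h]
  exact h.choose_spec

/-- Löwenheim–Skolem: the empty set is closed off under the countably many witness functions in `ω`
steps. -/
theorem exists_countable_closed (X : Fin m → Set M) : ∃ N : Set M, N.Countable ∧
    ∀ (k : ℕ) (φ : Fml m (k + 1)) (e : Fin k → M), (∀ i, e i ∈ N) → witness X φ e ∈ N := by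
  let next : Set M → Set M := fun C => C ∪
    Set.range fun d : (Σ k : ℕ, Fml m (k + 1) × (Fin k → C)) => witness X d.2.1 fun i => d.2.2 i
  let C : ℕ → Set M := fun j => next^[j] ∅
  have hC : ∀ j, C (j + 1) = next (C j) := fun j => Function.iterate_succ_apply' next j ∅
  have hcount : ∀ j, (C j).Countable := by
    intro j
    induction j with
    | zero => exact Set.countable_empty
    | succ j ih =>
      rw [hC]
      have := ih.to_subtype
      exact ih.union (Set.countable_range _)
  have hmono : Monotone C := monotone_nat_of_le_succ fun j => by
    rw [hC]
    exact Set.subset_union_left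
  refine ⟨⋃ j, C j, Set.countable_iUnion hcount, fun k φ e he => ?_⟩
  simp only [Set.mem_iUnion] at he ⊢
  choose j hj using he
  have he : ∀ i, e i ∈ C (Finset.univ.sup j) := fun i =>
    hmono (Finset.le_sup (Finset.mem_univ i)) (hj i)
  refine ⟨Finset.univ.sup j + 1, ?_⟩
  rw [hC]
  exact .inr ⟨⟨k, φ, fun i => ⟨e i, he i⟩⟩, rfl⟩

/-- A subset that contains witnesses for all existential formulas. -/
structure ElementarySubset (X : Fin m → Set M) (N : Subsemiring M) : Prop where
  witness_mem : ∀ {k : ℕ} (φ : Fml m (k + 1)) (e : Fin k → M), (∀ i, e i ∈ N) → witness X φ e ∈ N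

theorem exists_elementarySubset (X : Fin m → Set M) :
    ∃ N : Subsemiring M, Countable N ∧ ElementarySubset X N := by
  obtain ⟨N, hN, hw⟩ := exists_countable_closed X
  have key : ∀ {k : ℕ} (t : Tm k) (e : Fin k → M), (∀ i, e i ∈ N) → t.val e ∈ N := by
    intro k t e he
    -- The only witness of `x = t` is the value of `t`, so closure under witnesses gives closure
    -- under terms.
    have := hw k (.eq (.var 0) (t.rename Fin.succ)) e he
    have h := holds_witness (X := X) (φ := .eq (.var 0) (t.rename Fin.succ)) (e := e)
      ⟨t.val e, by simp [Fml.Holds, Tm.val, Tm.val_rename]⟩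
    simp only [Fml.Holds, Tm.val, Tm.val_rename, Matrix.cons_val_zero, Matrix.cons_val_succ] at h
    rwa [h] at this
  refine ⟨{ carrier := N
            mul_mem' := fun {a b} ha hb => by
              simpa [Tm.val] using key (.mul (.var 0) (.var 1)) ![a, b] (by simp [Fin.forall_fin_two, ha, hb])
            one_mem' := by simpa [Tm.val] using key .one ![] (by simp)
            add_mem' := fun {a b} ha hb => by
              simpa [Tm.val] using key (.add (.var 0) (.var 1)) ![a, b] (by simp [Fin.forall_fin_two, ha, hb])
            zero_mem' := by simpa [Tm.val] using key .zero ![] (by simp) }, hN.to_subtype, ⟨?_⟩⟩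
  exact fun φ e he => hw _ φ e he

namespace ElementarySubset

variable {X : Fin m → Set M} {N : Subsemiring M}

theorem exists_holds (hN : ElementarySubset X N) {k : ℕ} (φ : Fml m (k + 1)) (e : Fin k → N)
    (h : ∃ a, φ.Holds X (Matrix.vecCons a fun i => e i)) :
    ∃ a : N, φ.Holds X (Matrix.vecCons (a : M) fun i => e i) :=
  ⟨⟨_, hN.witness_mem φ _ fun i => (e i).2⟩, holds_witness h⟩

theorem canonicallyOrderedAdd (hN : ElementarySubset X N) : CanonicallyOrderedAdd N where
  exists_add_of_le {a b} hab := by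
    obtain ⟨c, hc⟩ := le_iff_exists_add.1 (show (a : M) ≤ b from hab)
    obtain ⟨d, hd⟩ := hN.exists_holds (.eq (.var 2) (.add (.var 1) (.var 0))) ![a, b]
      ⟨c, by simpa [Fml.Holds, Tm.val] using hc⟩
    refine ⟨d, Subtype.ext ?_⟩
    simpa [Fml.Holds, Tm.val] using hd
  le_add_self _ _ := show (_ : M) ≤ _ from le_add_self
  le_self_add _ _ := show (_ : M) ≤ _ from le_self_add

/-- The ordered semiring structure of an elementary subset. -/
abbrev pMinus (hN : ElementarySubset X N) : PMinus N :=
  { (inferInstance : CommSemiring N), (inferInstance : LinearOrder N),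
    (inferInstance : IsStrictOrderedRing N), hN.canonicallyOrderedAdd with
    one_le_of_pos := fun a ha => PMinus.one_le_of_pos (a : M) ha }

end ElementarySubset

/-- Elementary embeddings with respect to arithmetical formulas. -/
structure Elementary {K : Type u} [PMinus K] (Y : Fin m → Set K) (X : Fin m → Set M) (ι : K → M) :
    Prop where
  map_zero : ι 0 = 0
  map_one : ι 1 = 1
  map_add : ∀ a b, ι (a + b) = ι a + ι b
  map_mul : ∀ a b, ι (a * b) = ι a * ι b
  lt_iff : ∀ {a b}, ι a < ι b ↔ a < b
  mem_iff : ∀ {a i}, ι a ∈ X i ↔ a ∈ Y i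
  exists_holds : ∀ {k : ℕ} (φ : Fml m (k + 1)) (e : Fin k → K),
    (∃ a, φ.Holds X (Matrix.vecCons a fun i => ι (e i))) →
      ∃ a, φ.Holds X (Matrix.vecCons (ι a) fun i => ι (e i))

theorem exists_countable_elementary (X : Fin m → Set M) :
    ∃ (K : Type u) (_ : PMinus K) (Y : Fin m → Set K) (ι : K → M), Countable K ∧ Elementary Y X ι := by
  obtain ⟨N, hc, hN⟩ := exists_elementarySubset X
  let _ := hN.pMinus
  exact ⟨N, hN.pMinus, fun i => {a | (a : M) ∈ X i}, fun a => a, hc, rfl, rfl, fun _ _ => rfl,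
    fun _ _ => rfl, Iff.rfl, Iff.rfl, hN.exists_holds⟩

-- Transfer of truth, induction and bounding along elementary embeddings

namespace Elementary

variable {K : Type u} [PMinus K] {Y : Fin m → Set K} {X : Fin m → Set M} {ι : K → M}

theorem inj (h : Elementary Y X ι) {a b : K} : ι a = ι b ↔ a = b := by
  refine ⟨fun hab => ?_, fun hab => by rw [hab]⟩
  by_contra hne
  rcases lt_or_gt_of_ne hne with hlt | hlt
  · exact absurd (h.lt_iff.2 hlt) (hab ▸ lt_irrefl _)
  · exact absurd (h.lt_iff.2 hlt) (hab ▸ lt_irrefl _)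

theorem val (h : Elementary Y X ι) {n : ℕ} (t : Tm n) (e : Fin n → K) :
    t.val (fun i => ι (e i)) = ι (t.val e) := by
  induction t with
  | var => rfl
  | zero => exact h.map_zero.symm
  | one => exact h.map_one.symm
  | add _ _ h1 h2 => simp [Tm.val, h1, h2, h.map_add]
  | mul _ _ h1 h2 => simp [Tm.val, h1, h2, h.map_mul]

omit [PMinus M] [PMinus K] in
theorem vecCons {n : ℕ} (a : K) (e : Fin n → K) :
    (fun i => ι (Matrix.vecCons a e i)) = Matrix.vecCons (ι a) fun i => ι (e i) := by
  funext i
  refine Fin.cases ?_ (fun i => ?_) i <;> simp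

theorem holds_iff (h : Elementary Y X ι) {n : ℕ} (φ : Fml m n) (e : Fin n → K) :
    φ.Holds X (fun i => ι (e i)) ↔ φ.Holds Y e := by
  induction φ with
  | eq s t => simp [Fml.Holds, h.val, h.inj]
  | lt s t => simp [Fml.Holds, h.val, h.lt_iff]
  | mem t i => simp [Fml.Holds, h.val, h.mem_iff]
  | neg φ ih => simp [Fml.Holds, ih]
  | and φ ψ ih ih' => simp [Fml.Holds, ih, ih']
  | or φ ψ ih ih' => simp [Fml.Holds, ih, ih']
  | ball t φ ih =>
    simp only [Fml.Holds, ← ih, vecCons, h.val]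
    refine ⟨fun H a ha => H _ (h.lt_iff.2 ha), fun H => ?_⟩
    by_contra! hcon
    obtain ⟨a, ha⟩ := h.exists_holds (.and (.lt (.var 0) (t.rename Fin.succ)) (.neg φ)) e (by
      simpa [Fml.Holds, Tm.val, Tm.val_rename, h.val] using hcon)
    simp only [Fml.Holds, Tm.val, Tm.val_rename, Matrix.cons_val_zero, Matrix.cons_val_succ, h.val,
      h.lt_iff] at ha
    exact ha.2 (H a ha.1)
  | bex t φ ih =>
    simp only [Fml.Holds, ← ih, vecCons, h.val]
    refine ⟨fun hcon => ?_, fun ⟨a, ha, h'⟩ => ⟨_, h.lt_iff.2 ha, h'⟩⟩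
    obtain ⟨a, ha⟩ := h.exists_holds (.and (.lt (.var 0) (t.rename Fin.succ)) φ) e (by
      simpa [Fml.Holds, Tm.val, Tm.val_rename, h.val] using hcon)
    simp only [Fml.Holds, Tm.val, Tm.val_rename, Matrix.cons_val_zero, Matrix.cons_val_succ, h.val,
      h.lt_iff] at ha
    exact ⟨a, ha⟩
  | all φ ih =>
    simp only [Fml.Holds, ← ih, vecCons]
    refine ⟨fun H a => H _, fun H => ?_⟩
    by_contra! hcon
    obtain ⟨a, ha⟩ := h.exists_holds (.neg φ) e hcon
    exact ha (H a)
  | ex φ ih =>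
    simp only [Fml.Holds, ← ih, vecCons]
    exact ⟨h.exists_holds φ e, fun ⟨a, ha⟩ => ⟨_, ha⟩⟩

/-- Formulas with parameters from the range of `Y` are formulas with parameters `Y`. -/
theorem exists_rename {l n k : ℕ} {φ : Fml l n} (hφ : φ.IsSigma k) {Z : Fin l → Set K}
    (hZ : ∀ i, Z i ∈ Set.range Y) :
    ∃ ψ : Fml m n, ψ.IsSigma k ∧ ∀ e, φ.Holds Z e ↔ ψ.Holds Y e := by
  choose g hg using hZ
  refine ⟨φ.rename g id, (Fml.isSigma_isPi_rename _ _ _).1 hφ, fun e => ?_⟩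
  simp [Fml.holds_rename, hg]

theorem iSigma (h : Elementary Y X ι) {k : ℕ} (hI : ISigma k (Set.range X)) :
    ISigma k (Set.range Y) := by
  rintro B ⟨l, n, φ, Z, e, hφ, hZ, hB⟩ h0 hs a
  obtain ⟨ψ, hψ, hφψ⟩ := exists_rename hφ hZ
  have key : ∀ a, a ∈ B ↔ ψ.Holds X (Matrix.vecCons (ι a) fun i => ι (e i)) := fun a => by
    rw [hB, hφψ, ← h.holds_iff, vecCons]
  refine (key a).2 (hI {x | ψ.Holds X (Matrix.vecCons x fun i => ι (e i))}
    ⟨m, n, ψ, X, _, hψ, fun i => ⟨i, rfl⟩, fun _ => Iff.rfl⟩ ?_ ?_ _)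
  · simpa [h.map_zero] using (key 0).1 h0
  · by_contra! hcon
    obtain ⟨x, hx, hx'⟩ := hcon
    -- A failure of the induction step in `M` is reflected to the submodel. The formula names the
    -- successor by a quantified variable, so only renaming is needed.
    obtain ⟨a, ha⟩ := h.exists_holds (.and ψ (.ex (.and (.eq (.var 0) (.add (.var 1) .one))
      (.neg (ψ.rename id (liftVar Fin.succ)))))) e
      ⟨x, hx, x + 1, rfl, by
        rw [Fml.Holds, Fml.holds_rename, vecCons_comp_liftVar]
        exact hx'⟩
    obtain ⟨h1, y, h2, h3⟩ := ha
    rw [Fml.Holds, Fml.holds_rename, vecCons_comp_liftVar] at h3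
    have hy : y = ι (a + 1) := by simpa [Fml.Holds, Tm.val, h.map_add, h.map_one] using h2
    subst hy
    exact h3 (by simpa using (key _).1 (hs a ((key a).2 h1)))

/-- Elementarity is used for a counterexample to the premise, for the common bound, and for the
individual witnesses below it; the renamings only reorder variables. -/
theorem bSigma (h : Elementary Y X ι) {k : ℕ} (hB : BSigma k (Set.range X)) :
    BSigma k (Set.range Y) := by
  refine ⟨h.iSigma hB.1, fun l n φ Z e hφ hZ x₀ hx₀ => ?_⟩
  obtain ⟨ψ, hψ, hφψ⟩ := exists_rename hφ hZ
  have key : ∀ x y, φ.Holds Z (Matrix.vecCons x (Matrix.vecCons y e)) ↔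
      ψ.Holds X (Matrix.vecCons (ι x) (Matrix.vecCons (ι y) fun i => ι (e i))) := fun x y => by
    rw [hφψ, ← h.holds_iff, vecCons, vecCons]
  have ren : ∀ x y x' (e' : Fin n → M),
      (ψ.rename id (Fin.cases (1 : Fin (n + 3)) (Fin.cases 0 fun i => i.succ.succ.succ))).Holds X
        (Matrix.vecCons y (Matrix.vecCons x (Matrix.vecCons x' e'))) ↔
      ψ.Holds X (Matrix.vecCons x (Matrix.vecCons y e')) := by
    intro x y x' e'
    rw [Fml.holds_rename]
    refine iff_of_eq (congrArg _ (funext fun i => ?_))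
    exact Fin.cases rfl (Fin.cases rfl fun i => rfl) i
  have ren' : ∀ x y y' x' (e' : Fin n → M),
      (ψ.rename id (Fin.cases (1 : Fin (n + 4)) (Fin.cases 0 fun i => i.succ.succ.succ.succ))).Holds X
        (Matrix.vecCons y (Matrix.vecCons x (Matrix.vecCons y' (Matrix.vecCons x' e')))) ↔
      ψ.Holds X (Matrix.vecCons x (Matrix.vecCons y e')) := by
    intro x y y' x' e'
    rw [Fml.holds_rename]
    refine iff_of_eq (congrArg _ (funext fun i => ?_))
    exact Fin.cases rfl (Fin.cases rfl fun i => rfl) i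
  obtain ⟨y₀, hy₀⟩ := hB.2 m n ψ X (fun i => ι (e i)) hψ (fun i => ⟨i, rfl⟩) (ι x₀) (by
    by_contra! hcon
    obtain ⟨x, hx⟩ := h.exists_holds (.and (.lt (.var 0) (.var 1)) (.neg (.ex (ψ.rename id
      (Fin.cases (1 : Fin (n + 3)) (Fin.cases 0 fun i => i.succ.succ.succ))))))
      (Matrix.vecCons x₀ e) (by
        obtain ⟨x, hx, hxy⟩ := hcon
        refine ⟨x, ?_⟩
        rw [vecCons]
        exact ⟨by simpa [Fml.Holds, Tm.val] using hx, fun ⟨y, hy⟩ => hxy y ((ren _ _ _ _).1 hy)⟩)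
    rw [vecCons] at hx
    obtain ⟨y, hy⟩ := hx₀ x (h.lt_iff.1 (by simpa [Fml.Holds, Tm.val] using hx.1))
    exact hx.2 ⟨ι y, (ren _ _ _ _).2 ((key x y).1 hy)⟩)
  -- The formula says that its variable `0` is a common bound, so a bound found in `M` can be
  -- replaced by one from the submodel.
  let χ : Fml m (n + 2) := .ball (.var 1) (.bex (.var 1) (ψ.rename id
    (Fin.cases (1 : Fin (n + 4)) (Fin.cases 0 fun i => i.succ.succ.succ.succ))))
  have hχ : ∀ y, χ.Holds X (Matrix.vecCons y (Matrix.vecCons (ι x₀) fun i => ι (e i))) ↔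
      ∀ x < ι x₀, ∃ z < y, ψ.Holds X (Matrix.vecCons x (Matrix.vecCons z fun i => ι (e i))) := by
    intro y
    simp only [χ, Fml.Holds, Tm.val, ren']
    simp
  obtain ⟨y, hy⟩ := h.exists_holds χ (Matrix.vecCons x₀ e) ⟨y₀, by
    rw [vecCons]
    exact (hχ y₀).2 hy₀⟩
  rw [vecCons, hχ] at hy
  refine ⟨y, fun x hx => ?_⟩
  obtain ⟨z, hz⟩ := h.exists_holds (.and (.lt (.var 0) (.var 2)) (ψ.rename id
    (Fin.cases (1 : Fin (n + 4)) (Fin.cases 0 fun i => i.succ.succ.succ.succ))))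
    (Matrix.vecCons x (Matrix.vecCons y (Matrix.vecCons x₀ e))) (by
      obtain ⟨z, hz, hψz⟩ := hy (ι x) (h.lt_iff.2 hx)
      refine ⟨z, ?_⟩
      rw [vecCons, vecCons, vecCons]
      exact ⟨by simpa [Fml.Holds, Tm.val] using hz, (ren' _ _ _ _ _).2 hψz⟩)
  rw [vecCons, vecCons, vecCons] at hz
  exact ⟨z, h.lt_iff.1 (by simpa [Fml.Holds, Tm.val] using hz.1), (key x z).2 ((ren' _ _ _ _ _).1 hz.2)⟩

end Elementary

/-! ### Conservation -/

/-- Finitely many set parameters are tagged with standard numerals and joined into one set. -/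
theorem exists_isDeltaSet_range (X : Fin m → Set M) : ∃ A : Set M, IsDeltaSet (Set.range X) 1 A ∧
    ∀ i, IsDeltaSet {A} 1 (X i) := by
  have hex : ∀ {m : ℕ} {R : Fin m → (Fin 1 → M) → Prop} {S : Set (Set M)}, (∀ i, IsD0 S (R i)) →
      IsD0 S fun v => ∃ i, R i v := by
    intro m R S hR
    induction m with
    | zero => exact (inferInstance : IsD0 S fun v : Fin 1 → M => v 0 < v 0).congr fun v => by simp
    | succ m ih =>
      have h0 := hR 0
      have h1 := ih fun i => hR i.succ
      exact (inferInstance : IsD0 S fun v => R 0 v ∨ ∃ i : Fin m, R i.succ v).congr fun v => by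
        simp [Fin.exists_fin_succ]
  let A : Set M := {y | ∃ i : Fin m, ∃ x, x < y + 1 ∧ x ∈ X i ∧ y = pr ((i : ℕ) : M) x}
  refine ⟨A, ?_, fun i => ?_⟩
  · refine IsD0.isDeltaSet (hex fun i => ?_)
    have : ∀ ⦃k : ℕ⦄ (t : (Fin k → M) → M) [IsTF t], IsD0 (Set.range X) fun v => t v ∈ X i :=
      fun k t _ => isD0_mem ⟨i, rfl⟩
    infer_instance
  · refine IsD0.isDeltaSet ((isD0_mem (Set.mem_singleton A)
      (t := fun v : Fin 1 → M => pr ((i : ℕ) : M) (v 0))).congr fun v => ?_)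
    simp only [A, Set.mem_ofPred_eq, pr_inj, Nat.cast_inj, Fin.val_inj]
    constructor
    · exact fun h => ⟨i, v 0, lt_add_one_iff'.2 (le_pr_right _ _), h, rfl, rfl⟩
    · rintro ⟨j, x, -, hx, rfl, rfl⟩
      exact hx

end

/-- Only the parameters `X` are kept from the original second-order part. Countability is needed
solely to enumerate the trees, and arithmetical truth survives both the passage to the submodel and
the enlargement of the second-order part. -/
theorem wkl_conservative {bounding : Prop} {n : ℕ} (hn : 1 ≤ n)
    {Γ : ∀ (M : Type u) [PMinus M], Set (Set M) → Prop}
    (hΓ : ∀ (M : Type u) [PMinus M] (S : Set (Set M)), Γ M S ↔ RCA0 S ∧ Theory bounding n S) :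
    WKLPi11ConservativeOver Γ := by
  intro m θ H M _ S hS X hX
  have hth := ((hΓ M S).1 hS).2
  have hsub : Set.range X ⊆ S := by
    rintro _ ⟨i, rfl⟩
    exact hX i
  have hth := hth.of_isDeltaSet hn fun Z hZ => isDeltaSet_of_mem (hsub hZ)
  obtain ⟨K, _, Y, ι, _, hι⟩ := exists_countable_elementary X
  have hK : Theory bounding n (Set.range Y) :=
    ⟨hι.iSigma hth.1, fun hb => hι.iSigma (hth.2.1 hb), fun hb => hι.bSigma (hth.2.2 hb)⟩
  obtain ⟨A, hA, hYA⟩ := exists_isDeltaSet_range Y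
  obtain ⟨S', hS', hrca, hth', hwkl⟩ := exists_wkl_model hn (hK.of_isDeltaSet hn (S := {A}) (by
    rintro _ rfl
    exact hA))
  have := H K S' ((hΓ K S').2 ⟨hrca, hth'⟩) hwkl Y fun i => hS' _ (hYA i)
  rw [← hι.holds_iff] at this
  convert this

end SOArith

-- The induction and bounding cases combined

theorem mainTheorem7 (n : ℕ) (hn : 1 ≤ n) :
    (∀ (M : Type u) [SOArith.PMinus M] (A T : Set M),
      SOArith.ISigma 1 {A} →
      SOArith.IsDeltaSet {A} 1 T → SOArith.IsTree T → SOArith.IsInfinite T →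
      (SOArith.ISigma n {A} →
        ∃ P : Set M, SOArith.IsInfinitePathThrough T P ∧
          SOArith.ISigma n {SOArith.join A P}) ∧
      (SOArith.BSigma (n + 1) {A} →
        ∃ P : Set M, SOArith.IsInfinitePathThrough T P ∧
          SOArith.BSigma (n + 1) {SOArith.join A P})) ∧
    SOArith.WKLPi11ConservativeOver.{u}
      (fun _ _ S => SOArith.RCA0 S ∧ SOArith.ISigma n S) ∧
    SOArith.WKLPi11ConservativeOver.{u}
      (fun _ _ S => SOArith.RCA0 S ∧ SOArith.BSigma (n + 1) S) := by
  refine ⟨fun M _ A T hI hΔ hT hinf => ⟨fun h => ?_, fun h => ?_⟩,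
    SOArith.wkl_conservative (bounding := False) hn fun M _ S => ?_,
    SOArith.wkl_conservative (bounding := True) hn fun M _ S => ?_⟩
  · obtain ⟨P, hP, h⟩ := SOArith.Theory.exists_path (bounding := False) hn
      ⟨hI, fun _ => h, False.elim⟩ hΔ hT hinf
    exact ⟨P, hP, h.2.1 id⟩
  · obtain ⟨P, hP, h⟩ := SOArith.Theory.exists_path (bounding := True) hn
      ⟨hI, fun h => absurd trivial h, fun _ => h⟩ hΔ hT hinf
    exact ⟨P, hP, h.2.2 trivial⟩
  · exact and_congr_right fun h => ⟨fun h' => ⟨h.2, fun _ => h', False.elim⟩, fun h' => h'.2.1 id⟩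
  · exact and_congr_right fun h =>
      ⟨fun h' => ⟨h.2, fun h => absurd trivial h, fun _ => h'⟩, fun h' => h'.2.2 trivial⟩
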